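/- Let $T>0$, let $W=(W_t)_{0\le t\le T}$ be a standard $d$-dimensional Brownian motion on a probability space $(\Omega,\mathcal F,\mathbb P)$ with natural (completed) filtration $(\mathcal F_t)_{0\le t\le T}$, and let $x_0\in\mathbb R^d$, $b:[0,T]\times\mathbb R^d\to\mathbb R^d$, $\sigma:[0,T]\times\mathbb R^d\to\mathbb R^{d\times d}$, $f:[0,T]\times\mathbb R^d\times\mathbb R\times\mathbb R^d\to\mathbb R$, $\Phi:\mathbb R^d\to\mathbb R$. Assume that there are constants $L,L_f\ge0$ such that $$|b(t,x_1)-b(t,x_2)|+|\sigma(t,x_1)-\sigma(t,x_2)|\le L|x_1-x_2|,$$ $$|f(t_1,x_1,y_1,z_1)-f(t_2,x_2,y_2,z_2)|\le L_f\big(\sqrt{|t_1-t_2|}+|x_1-x_2|+|y_1-y_2|+|z_1-z_2|\big)$$ for all arguments, and that $\Phi$ is measurable and bounded. Let $m\ge1$ and let $\widetilde\alpha_j,\widetilde\gamma_j,\alpha_j$ $(1\le j\le m)$ and $\gamma_j$ $(0\le j\le m)$ be real numbers. For $N\ge m$ put $h=T/N$, $t_i=ih$, $W_i=W_{t_i}$,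 $\mathbb E_i[\cdot]=\mathbb E[\cdot\mid\mathcal F_{t_i}]$; let $X_0^\pi=x_0$, $X^\pi_{i+1}=X^\pi_i+h\,b(t_i,X_i^\pi)+\sigma(t_i,X_i^\pi)(W_{i+1}-W_i)$ be the Euler scheme, and let $\lambda_{m,0},\dots,\lambda_{m,m}$ be the unique solution of $\frac1{j!}\sum_{n=0}^m\lambda_{m,n}(nh)^j=\mathbf 1_{\{j=1\}}$, $0\le j\le m$. Given random variables $\varepsilon_i^Y,\varepsilon_i^Z\in\mathbb L_2(\mathcal F_{t_i})$, $0\le i\le N-m$, real-valued and $\mathbb R^d$-valued respectively, a pair $(\bar Y,\bar Z)$ solves the predictor–corrector scheme perturbed by $(\varepsilon^Y,\varepsilon^Z)$ if $\bar Y_k,\bar Z_k\in\mathbb L_2(\mathcal F_{t_k})$ for the starting indices $N-m+1\le k\le N$ and, almost surely, for $i=N-m,\dots,0$, $$\bar{\widetilde Y}_i=\mathbb E_i\Big[\sum_{j=1}^m\widetilde\alpha_j\bar Y_{i+j}+\sum_{j=1}^m\widetilde\gamma_jh f(t_{i+j},X^\pi_{i+j},\bar Y_{i+j},\bar Z_{i+j})\Big],$$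 $$\bar Y_i=\mathbb E_i\Big[\sum_{j=1}^m\alpha_j\bar Y_{i+j}+\gamma_0hf(t_i,X^\pi_i,\bar{\widetilde Y}_i,\bar Z_i)+\sum_{j=1}^m\gamma_jhf(t_{i+j},X^\pi_{i+j},\bar Y_{i+j},\bar Z_{i+j})\Big]+\varepsilon_i^Y,$$ $$\bar Z_i=\mathbb E_i\Big[\sum_{j=1}^m\lambda_{m,j}\bar Y_{i+j}(W_{i+j}-W_i)\Big]+\varepsilon_i^Z.$$ A pair $(Y,Z)$ solves the scheme if it satisfies this with $\varepsilon^Y=0$, $\varepsilon^Z=0$, and $Y_N=\Phi(X_N^\pi)$. The scheme is called $\mathbb L_2$-stable if there is a constant $C$ such that for all $N\ge m$, all solutions $(Y,Z)$ of the scheme, all $(\varepsilon^Y,\varepsilon^Z)$ as above and all solutions $(\bar Y,\bar Z)$ of the scheme perturbed by $(\varepsilon^Y,\varepsilon^Z)$ with $\bar Z_k=Z_k$ for $N-m+1\le k\le N$, $$\max_{0\le i\le N-m}\mathbb E|Y_i-\bar Y_i|^2+\sum_{i=0}^{N-m}h\,\mathbb E|Z_i-\bar Z_i|^2\le C\Big(\max_{N-m+1\le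 k\le N}\mathbb E|Y_k-\bar Y_k|^2+\sum_{i=0}^{N-m}\mathbb E\big[h|\varepsilon_i^Z|^2+\tfrac1h|\varepsilon_i^Y|^2\big]\Big).$$ Then the scheme is $\mathbb L_2$-stable if and only if the polynomial $P(\zeta)=\zeta^m-\alpha_1\zeta^{m-1}-\dots-\alpha_m$ satisfies Dahlquist's root condition: all complex roots of $P$ lie in the closed unit disc, and the roots on the unit circle are simple. -/

import Mathlib

open MeasureTheory ProbabilityTheory

noncomputable section

namespace MultistepBSDE

/-- The `d`-dimensional Euclidean space. -/
abbrev E (d : ℕ) : Type := EuclideanSpace ℝ (Fin d)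

/-! ### Brownian motion on `[0, T]` -/

/-- The natural filtration `ℱ_t = σ(W_s : 0 ≤ s ≤ t)`. -/
abbrev natF {Ω : Type*} {d : ℕ} (W : ℝ → Ω → E d) (t : ℝ) : MeasurableSpace Ω :=
  ⨆ s ∈ Set.Icc (0 : ℝ) t, MeasurableSpace.comap (W s) inferInstance

/-- `W` restricted to `[0, T]` is a standard `d`-dimensional Brownian motion. -/
structure IsBrownianMotion {Ω : Type*} [MeasurableSpace Ω] {d : ℕ}
    (T : ℝ) (W : ℝ → Ω → E d) (μ : Measure Ω) : Prop where
  measurable : ∀ t ∈ Set.Icc (0 : ℝ) T, Measurable (W t)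
  zero : ∀ᵐ ω ∂μ, W 0 ω = 0
  law : ∀ s t : ℝ, 0 ≤ s → s ≤ t → t ≤ T →
    HasLaw (fun ω => W t ω - W s ω)
      (multivariateGaussian (0 : E d) ((t - s) • (1 : Matrix (Fin d) (Fin d) ℝ))) μ
  indep : ∀ s t : ℝ, 0 ≤ s → s ≤ t → t ≤ T →
    Indep (MeasurableSpace.comap (fun ω => W t ω - W s ω) inferInstance) (natF W s) μ
  continuous : ∀ᵐ ω ∂μ, ContinuousOn (fun t => W t ω) (Set.Icc (0 : ℝ) T)

/-! ### The equation and the scheme -/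

/-- The data of the decoupled forward-backward equation
`X_t = x₀ + ∫₀ᵗ b(s, X_s) ds + ∫₀ᵗ σ(s, X_s) dW_s`,
`Y_t = Φ(X_T) + ∫ₜᵀ f(s, X_s, Y_s, Z_s) ds - ∫ₜᵀ Z_s dW_s`. -/
structure FBSDE (d : ℕ) where
  T : ℝ
  x₀ : E d
  b : ℝ → E d → E d
  σ : ℝ → E d → (E d →L[ℝ] E d)
  f : ℝ → E d → ℝ → E d → ℝ
  Φ : E d → ℝ

/-- The coefficients of an `m`-step predictor-corrector scheme: predictor coefficients
`α' j, γ' j` (`1 ≤ j ≤ m`) and corrector coefficients `α j` (`1 ≤ j ≤ m`), `γ j` (`0 ≤ j ≤ m`).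
Values at other indices are never used. -/
structure Coeffs where
  m : ℕ
  α' : ℕ → ℝ
  γ' : ℕ → ℝ
  α : ℕ → ℝ
  γ : ℕ → ℝ

/-- The weights `λ_{m,n}`, `0 ≤ n ≤ m`, of the difference formula
`u'(t) ≈ ∑ n, λ_{m,n} u(t + n h)` that is exact on polynomials of degree at most `m`:
the derivatives at `0` of the Lagrange basis at the nodes `0, 1, …, m`, divided by `h`. -/
def lam (m : ℕ) (h : ℝ) (n : ℕ) : ℝ :=
  h⁻¹ * (Polynomial.derivative
    (Lagrange.basis (Finset.range (m + 1)) (fun k : ℕ => (k : ℝ)) n)).eval 0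

/-- The weights satisfy the order conditions `(1/j!) ∑ n, λ_{m,n} (n h)^j = 1` if `j = 1` and `0`
otherwise, for `0 ≤ j ≤ m`. -/
theorem lam_spec (m : ℕ) {h : ℝ} (hh : h ≠ 0) (j : ℕ) (hj : j ≤ m) :
    (1 / (j.factorial : ℝ)) * ∑ n ∈ Finset.range (m + 1), lam m h n * ((n : ℝ) * h) ^ j
      = if j = 1 then 1 else 0 := by
  have hinj : Set.InjOn (fun k : ℕ => (k : ℝ)) (Finset.range (m + 1) : Finset ℕ) :=
    fun a _ b _ hab => by simpa using hab
  have hdeg : ((Polynomial.X : Polynomial ℝ) ^ j).degree < (Finset.range (m + 1)).card := by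
    rw [Polynomial.degree_X_pow, Finset.card_range]
    exact_mod_cast Nat.lt_succ_of_le hj
  have key := congrArg (fun p : Polynomial ℝ => (Polynomial.derivative p).eval 0)
    (Lagrange.eq_interpolate hinj hdeg)
  simp only [Lagrange.interpolate_apply, Polynomial.derivative_sum, Polynomial.eval_finsetSum,
    Polynomial.derivative_C_mul, Polynomial.derivative_X_pow,
    Polynomial.eval_mul, Polynomial.eval_C, Polynomial.eval_pow, Polynomial.eval_X] at key
  have hsum : ∑ n ∈ Finset.range (m + 1), lam m h n * ((n : ℝ) * h) ^ j
      = h⁻¹ * h ^ j * ((j : ℝ) * 0 ^ (j - 1)) := by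
    rw [key, Finset.mul_sum]
    refine Finset.sum_congr rfl fun n _ => ?_
    rw [lam, mul_pow]
    ring
  rw [hsum]
  rcases j with _ | _ | j
  · simp
  · simp [hh]
  · simp

section Scheme

variable {Ω : Type*} [MeasurableSpace Ω] {d : ℕ}

/-- The step size `h = T / N`. -/
def FBSDE.h (D : FBSDE d) (N : ℕ) : ℝ := D.T / N

/-- The grid point `t_i = i h`. -/
def FBSDE.t (D : FBSDE d) (N i : ℕ) : ℝ := i * D.h N

/-- The Euler discretization `X^π` of the forward equation. -/
def FBSDE.euler (D : FBSDE d) (W : ℝ → Ω → E d) (N : ℕ) : ℕ → Ω → E d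
  | 0 => fun _ => D.x₀
  | i + 1 => fun ω =>
      D.euler W N i ω + D.h N • D.b (D.t N i) (D.euler W N i ω)
        + D.σ (D.t N i) (D.euler W N i ω) (W (D.t N (i + 1)) ω - W (D.t N i) ω)

/-- `ξ` belongs to `𝕃₂(ℱ)`; measurability is up to null sets, i.e. with respect to the completion
of `ℱ`. -/
def InL2 {F : Type*} [NormedAddCommGroup F] (μ : Measure Ω) (ℱ : MeasurableSpace Ω)
    (ξ : Ω → F) : Prop :=
  AEStronglyMeasurable[ℱ] ξ μ ∧ MemLp ξ 2 μ

/-- The driver along the approximation, `f(t_i, X_i^π, y, z)` for random `y` and `z`. -/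
def FBSDE.driver (D : FBSDE d) (W : ℝ → Ω → E d) (N i : ℕ) (y : Ω → ℝ) (z : Ω → E d) : Ω → ℝ :=
  fun ω => D.f (D.t N i) (D.euler W N i ω) (y ω) (z ω)

/-- The predicted value at step `i`,
`𝔼_i[∑ α'_j Y_{i+j} + ∑ γ'_j h f(t_{i+j}, X_{i+j}, Y_{i+j}, Z_{i+j})]`. -/
def predictor (D : FBSDE d) (S : Coeffs) (W : ℝ → Ω → E d) (μ : Measure Ω) (N : ℕ)
    (Y : ℕ → Ω → ℝ) (Z : ℕ → Ω → E d) (i : ℕ) : Ω → ℝ :=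
  μ[fun ω => ∑ j ∈ Finset.Icc 1 S.m, S.α' j * Y (i + j) ω
      + ∑ j ∈ Finset.Icc 1 S.m, S.γ' j * D.h N * D.driver W N (i + j) (Y (i + j)) (Z (i + j)) ω
    | natF W (D.t N i)]

/-- The corrected value at step `i`,
`𝔼_i[∑ α_j Y_{i+j} + γ_0 h f(t_i, X_i, Ỹ_i, Z_i) + ∑ γ_j h f(t_{i+j}, X_{i+j}, Y_{i+j}, Z_{i+j})]`
with the predicted value `Ỹ_i`. -/
def corrector (D : FBSDE d) (S : Coeffs) (W : ℝ → Ω → E d) (μ : Measure Ω) (N : ℕ)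
    (Y : ℕ → Ω → ℝ) (Z : ℕ → Ω → E d) (i : ℕ) : Ω → ℝ :=
  μ[fun ω => ∑ j ∈ Finset.Icc 1 S.m, S.α j * Y (i + j) ω
      + S.γ 0 * D.h N * D.driver W N i (predictor D S W μ N Y Z i) (Z i) ω
      + ∑ j ∈ Finset.Icc 1 S.m, S.γ j * D.h N * D.driver W N (i + j) (Y (i + j)) (Z (i + j)) ω
    | natF W (D.t N i)]

/-- The value `𝔼_i[∑ λ_{m,j} Y_{i+j} (W_{i+j} - W_i)]`. -/
def zStep (D : FBSDE d) (S : Coeffs) (W : ℝ → Ω → E d) (μ : Measure Ω) (N : ℕ)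
    (Y : ℕ → Ω → ℝ) (i : ℕ) : Ω → E d :=
  μ[fun ω => ∑ j ∈ Finset.Icc 1 S.m,
      (lam S.m (D.h N) j * Y (i + j) ω) • (W (D.t N (i + j)) ω - W (D.t N i) ω)
    | natF W (D.t N i)]

/-- `(Y, Z)` solves the scheme on the grid with `N` steps, perturbed by `(εY, εZ)`: the `m` starting
values `(Y_k, Z_k)`, `N - m < k ≤ N`, are given in `𝕃₂(ℱ_{t_k})`, and the other ones are
computed by the perturbed recursion for `i = N - m, …, 0`. -/
structure IsPerturbedSolution (D : FBSDE d) (S : Coeffs) (W : ℝ → Ω → E d) (μ : Measure Ω) (N : ℕ)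
    (εY : ℕ → Ω → ℝ) (εZ : ℕ → Ω → E d) (Y : ℕ → Ω → ℝ) (Z : ℕ → Ω → E d) : Prop where
  startY : ∀ k, N < k + S.m → k ≤ N → InL2 μ (natF W (D.t N k)) (Y k)
  startZ : ∀ k, N < k + S.m → k ≤ N → InL2 μ (natF W (D.t N k)) (Z k)
  stepY : ∀ i, i + S.m ≤ N → Y i =ᵐ[μ] corrector D S W μ N Y Z i + εY i
  stepZ : ∀ i, i + S.m ≤ N → Z i =ᵐ[μ] zStep D S W μ N Y i + εZ i

/-- `(Y, Z)` solves the (unperturbed) scheme, with terminal value `Y_N = Φ(X_N)`. -/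
structure IsSolution (D : FBSDE d) (S : Coeffs) (W : ℝ → Ω → E d) (μ : Measure Ω) (N : ℕ)
    (Y : ℕ → Ω → ℝ) (Z : ℕ → Ω → E d) : Prop
    extends IsPerturbedSolution D S W μ N 0 0 Y Z where
  terminal : Y N =ᵐ[μ] fun ω => D.Φ (D.euler W N N ω)

/-- `𝕃₂`-stability: the constant `C` depends neither on the number `N` of steps nor on the starting
values nor on the perturbations. Perturbed are the starting values of `Y` (among them the terminal
value) and the recursions for `Y` and `Z`; the starting values of `Z` are not perturbed. -/
def L2Stable (D : FBSDE d) (S : Coeffs) (W : ℝ → Ω → E d) (μ : Measure Ω) : Prop :=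
  ∃ C : ℝ, ∀ N : ℕ, S.m ≤ N →
    ∀ (εY : ℕ → Ω → ℝ) (εZ : ℕ → Ω → E d)
      (Y : ℕ → Ω → ℝ) (Z : ℕ → Ω → E d) (Y' : ℕ → Ω → ℝ) (Z' : ℕ → Ω → E d),
      (∀ i, i + S.m ≤ N →
        InL2 μ (natF W (D.t N i)) (εY i) ∧ InL2 μ (natF W (D.t N i)) (εZ i)) →
      IsSolution D S W μ N Y Z →
      IsPerturbedSolution D S W μ N εY εZ Y' Z' →
      (∀ k, N < k + S.m → k ≤ N → Z' k =ᵐ[μ] Z k) →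
      (⨆ i : Fin (N - S.m + 1), ∫ ω, |Y i ω - Y' i ω| ^ 2 ∂μ)
          + ∑ i ∈ Finset.range (N - S.m + 1), D.h N * ∫ ω, ‖Z i ω - Z' i ω‖ ^ 2 ∂μ
        ≤ C * ((⨆ k : Fin S.m,
                ∫ ω, |Y (N - S.m + 1 + k) ω - Y' (N - S.m + 1 + k) ω| ^ 2 ∂μ)
            + ∑ i ∈ Finset.range (N - S.m + 1),
                (D.h N * ∫ ω, ‖εZ i ω‖ ^ 2 ∂μ + 1 / D.h N * ∫ ω, |εY i ω| ^ 2 ∂μ))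

end Scheme

/-! ### The root condition -/

/-- The characteristic polynomial `ζ^m - α_1 ζ^(m-1) - … - α_m`. -/
def charPoly (S : Coeffs) : Polynomial ℂ :=
  Polynomial.X ^ S.m
    - ∑ j ∈ Finset.Icc 1 S.m, Polynomial.C (S.α j : ℂ) * Polynomial.X ^ (S.m - j)

/-- Dahlquist's root condition: all complex roots lie in the closed unit disc, and those on the
unit circle are simple. -/
def RootCondition (S : Coeffs) : Prop :=
  ∀ ζ : ℂ, (charPoly S).IsRoot ζ →
    ‖ζ‖ ≤ 1 ∧ (‖ζ‖ = 1 → (charPoly S).rootMultiplicity ζ = 1)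

end MultistepBSDE

end

/-! Sufficiency of the root condition. Let `y i` be the class of `Y i - Y' i` in complex `𝕃₂`, and
let `P i` be conditional expectation at time `t_i`, an orthogonal projection. Then `y i = ∑ α_j P_i
y_{i+j} + r_i`. By the Lipschitz property of the driver, `‖r_i‖²` is at most a constant times `h²`
times the nearby squared errors of `Y` and `Z`, plus a constant times `𝔼|εY_i|²`. Stacking `U_i =
(P_i y_i, …, P_i y_{i+m-1})` turns this into `U_i = A P_i U_{i+1} + (r_i, 0, …, 0)` with the
companion operator `A`.

The root condition makes `A` a contraction for an equivalent quadratic form `q(x) = ∑ ‖p(A) x‖²`,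
the sum running over finitely many polynomials (`exists_sumSq_contraction`). This shape of `q` is
essential. Each `p(A)` combines coordinates with scalars, so it commutes with `P_i`. Hence `q` obeys
Pythagoras (`sumSq_diagOp`), and every step backwards loses the energy `v_i = q(U_{i+1} - P_i
U_{i+1})`.

This loss pays for `Z`. Brownian increments are centered and independent of the past, so `h 𝔼|Z_i -
Z'_i|²` is bounded by the conditional variances `‖y_{i+j} - P_i y_{i+j}‖²`, up to the term in `εZ`
(`exists_integral_zStep_sub_sq_le`). The variances telescope into one-step increments controlled by
`v_i, …, v_{i+m-1}`. With weights `(1 + c h)^i` and `c` large, the `Z` terms and the lower order `Y`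
terms are absorbed; this is a discrete Gronwall argument (`exists_energy_bound`,
`exists_stability_bound`).

Necessity. If the root condition fails, the recursion `u_n = ∑ α_j u_{n-j}` has an unbounded real
solution. Fix `K`, and add the deterministic quantity `u_{N-k}` to `Y_k` at the last `K + 1` grid
points of a solution. The `Z` recursion does not see a deterministic shift, and the `Y` recursion
sees it only through `h f`, so the perturbations are of order `h` (`exists_shifted_solution`). Their
contribution `∑ 𝔼|εY_i|² / h` is then of order `h`, since at most `K + 1` of them are nonzero.
Letting `N` grow, stability would bound `u_K²` by a constant times the squares of the first `m`
values of `u`, uniformly in `K`, which is absurd. -/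

noncomputable section

namespace MultistepBSDE

/-! ### Lyapunov forms for operators annihilated by a polynomial satisfying the root condition -/

section PowerBounded

open Polynomial

variable {V : Type*} [NormedAddCommGroup V] [NormedSpace ℂ V]

/-- The quadratic form `x ↦ ∑ ‖p(A) x‖²`, the sum being over a list of polynomials `p`. -/
def sumSq (A : V →L[ℂ] V) (l : List ℂ[X]) (x : V) : ℝ :=
  (l.map fun p => ‖aeval A p x‖ ^ 2).sum

lemma sumSq_nil (A : V →L[ℂ] V) (x : V) : sumSq A [] x = 0 := rfl

lemma sumSq_cons (A : V →L[ℂ] V) (p : ℂ[X]) (l : List ℂ[X]) (x : V) :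
    sumSq A (p :: l) x = ‖aeval A p x‖ ^ 2 + sumSq A l x := by
  simp [sumSq]

lemma sumSq_append (A : V →L[ℂ] V) (l l' : List ℂ[X]) (x : V) :
    sumSq A (l ++ l') x = sumSq A l x + sumSq A l' x := by
  simp [sumSq]

lemma sumSq_nonneg (A : V →L[ℂ] V) (l : List ℂ[X]) (x : V) : 0 ≤ sumSq A l x := by
  induction l with
  | nil => simp [sumSq_nil]
  | cons p l ih => rw [sumSq_cons]; positivity

lemma sumSq_map_C_mul (A : V →L[ℂ] V) (c : ℝ) (l : List ℂ[X]) (x : V) :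
    sumSq A (l.map fun p => C (c : ℂ) * p) x = c ^ 2 * sumSq A l x := by
  induction l with
  | nil => simp [sumSq_nil]
  | cons p l ih =>
    rw [List.map_cons, sumSq_cons, sumSq_cons, ih]
    simp only [map_mul, aeval_C, mul_apply_eq_comp, Algebra.algebraMap_eq_smul_one,
      smul_apply, one_apply_eq_self, norm_smul, Complex.norm_real,
      mul_pow, Real.norm_eq_abs, sq_abs]
    ring

lemma norm_aeval_sq_le_sumSq (A : V →L[ℂ] V) {p : ℂ[X]} {l : List ℂ[X]} (hp : p ∈ l) (x : V) :
    ‖aeval A p x‖ ^ 2 ≤ sumSq A l x := by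
  induction l with
  | nil => simp at hp
  | cons r l ih =>
    rw [sumSq_cons]
    rcases List.mem_cons.1 hp with rfl | h
    · linarith [sumSq_nonneg A l x]
    · linarith [ih h, sq_nonneg ‖aeval A r x‖]

lemma exists_sumSq_le (A : V →L[ℂ] V) (l : List ℂ[X]) :
    ∃ K : ℝ, 0 ≤ K ∧ ∀ x, sumSq A l x ≤ K * ‖x‖ ^ 2 := by
  induction l with
  | nil => exact ⟨0, le_rfl, fun x => by simp [sumSq_nil]⟩
  | cons p l ih =>
    obtain ⟨K, hK, h⟩ := ih
    refine ⟨‖aeval A p‖ ^ 2 + K, by positivity, fun x => ?_⟩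
    rw [sumSq_cons, add_mul, ← mul_pow]
    have := (aeval A p).le_opNorm x
    gcongr
    exact h x

/-- The form is Hilbertian, so this is the triangle inequality followed by Young's inequality.
Keeping `θ` free matters: with `θ` proportional to the step size, one step costs only a factor `1 +
O(h)` on the main term. -/
lemma sumSq_add_le (A : V →L[ℂ] V) (l : List ℂ[X]) {θ : ℝ} (hθ : 0 < θ) (x y : V) :
    sumSq A l (x + y) ≤ (1 + θ) * sumSq A l x + (1 + 1 / θ) * sumSq A l y := by
  induction l with
  | nil => simp [sumSq_nil]
  | cons p l ih =>
    rw [sumSq_cons, sumSq_cons, sumSq_cons, map_add]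
    set a := aeval A p x
    set b := aeval A p y
    have h1 : ‖a + b‖ ^ 2 ≤ (‖a‖ + ‖b‖) ^ 2 := by gcongr; exact norm_add_le a b
    have h2 : (‖a‖ + ‖b‖) ^ 2 ≤ (1 + θ) * ‖a‖ ^ 2 + (1 + 1 / θ) * ‖b‖ ^ 2 := by
      have : (1 + θ) * ‖a‖ ^ 2 + (1 + 1 / θ) * ‖b‖ ^ 2 - (‖a‖ + ‖b‖) ^ 2
          = (θ * ‖a‖ - ‖b‖) ^ 2 / θ := by field_simp; ring
      have : 0 ≤ (θ * ‖a‖ - ‖b‖) ^ 2 / θ := by positivity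
      linarith
    nlinarith

/-- This is `p X = c p + p (X - c)`: on the range of `p(A)`, the operator acts as `c` up to an error
governed by the next factor `X - c`. -/
lemma aeval_mul_X_sub_C_apply (A : V →L[ℂ] V) (p : ℂ[X]) (c : ℂ) (x : V) :
    aeval A p (A x) = c • aeval A p x + aeval A (p * (X - C c)) x := by
  simp [mul_sub, Algebra.algebraMap_eq_smul_one]

/-- Strict Lyapunov functional on the range of `p(A)` if this range is annihilated by a product of
factors `A - λ` with `‖λ‖ < 1`. -/
lemma exists_sumSq_strict (A : V →L[ℂ] V) (s : List ℂ) (hs : ∀ c ∈ s, ‖c‖ < 1) (p : ℂ[X])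
    (hp : aeval A (p * (s.map fun c => X - C c).prod) = 0) :
    ∃ l : List ℂ[X], ∀ x, sumSq A l (A x) + ‖aeval A p x‖ ^ 2 ≤ sumSq A l x := by
  induction s generalizing p with
  | nil =>
    refine ⟨[], fun x => ?_⟩
    simp only [List.map_nil, List.prod_nil, mul_one] at hp
    simp [hp, sumSq_nil]
  | cons c s ih =>
    obtain ⟨l, hl⟩ := ih (fun c hc => hs c (List.mem_cons_of_mem _ hc)) (p * (X - C c)) (by
      rwa [List.map_cons, List.prod_cons, ← mul_assoc] at hp)
    have hc : ‖c‖ < 1 := hs c List.mem_cons_self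
    have hr : 0 < 1 - ‖c‖ := by linarith
    -- Rescaling the polynomials gives `‖p(A) x‖²` the weight `1 / (1 - ‖c‖)` and the inductive form
    -- the square of this weight. The square is what Young's inequality `h2` requires to absorb
    -- `‖v‖²`, and `‖c‖ + (1 - ‖c‖) = 1` leaves exactly one `‖p(A) x‖²` to spare.
    refine ⟨C ((√(1 / (1 - ‖c‖)) : ℝ) : ℂ) * p :: l.map fun p => C ((1 / (1 - ‖c‖) : ℝ) : ℂ) * p,
      fun x => ?_⟩
    have hone : ∀ x, ‖aeval A (C ((√(1 / (1 - ‖c‖)) : ℝ) : ℂ) * p) x‖ ^ 2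
        = 1 / (1 - ‖c‖) * ‖aeval A p x‖ ^ 2 := fun x => by
      have := sumSq_map_C_mul A (√(1 / (1 - ‖c‖))) [p] x
      rw [Real.sq_sqrt (by positivity)] at this
      simpa only [List.map_cons, List.map_nil, sumSq_cons, sumSq_nil, add_zero] using this
    rw [sumSq_cons, sumSq_cons, hone, hone, sumSq_map_C_mul, sumSq_map_C_mul,
      aeval_mul_X_sub_C_apply A p c x]
    set u := aeval A p x
    set v := aeval A (p * (X - C c)) x with hv
    have hlx := hl x
    rw [← hv] at hlx
    have h1 : ‖c • u + v‖ ^ 2 ≤ (‖c‖ * ‖u‖ + ‖v‖) ^ 2 := by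
      gcongr; exact (norm_add_le _ _).trans (by rw [norm_smul])
    have h2 : (‖c‖ * ‖u‖ + ‖v‖) ^ 2 ≤ ‖c‖ * ‖u‖ ^ 2 + 1 / (1 - ‖c‖) * ‖v‖ ^ 2 := by
      have : ‖c‖ * ‖u‖ ^ 2 + 1 / (1 - ‖c‖) * ‖v‖ ^ 2 - (‖c‖ * ‖u‖ + ‖v‖) ^ 2
          = ‖c‖ * ((1 - ‖c‖) * ‖u‖ - ‖v‖) ^ 2 / (1 - ‖c‖) := by field_simp; ring
      have : 0 ≤ ‖c‖ * ((1 - ‖c‖) * ‖u‖ - ‖v‖) ^ 2 / (1 - ‖c‖) := by positivity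
      linarith
    have h3 : 1 / (1 - ‖c‖) * ‖c • u + v‖ ^ 2
        ≤ 1 / (1 - ‖c‖) * (‖c‖ * ‖u‖ ^ 2 + 1 / (1 - ‖c‖) * ‖v‖ ^ 2) := by
      gcongr; exact h1.trans h2
    have h4 : (1 / (1 - ‖c‖)) ^ 2 * (sumSq A l (A x) + ‖v‖ ^ 2)
        ≤ (1 / (1 - ‖c‖)) ^ 2 * sumSq A l x := by gcongr
    have h5 : 1 / (1 - ‖c‖) * (‖c‖ * ‖u‖ ^ 2) + ‖u‖ ^ 2 = 1 / (1 - ‖c‖) * ‖u‖ ^ 2 := by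
      field_simp; ring
    nlinarith

/-- An operator annihilated by a product of factors `A - λ`, `‖λ‖ ≤ 1`, those with `‖λ‖ = 1` being
simple, is a contraction for an equivalent Hilbertian norm. -/
lemma exists_sumSq_contraction (A : V →L[ℂ] V) (s : List ℂ) (hs : ∀ c ∈ s, ‖c‖ < 1)
    (u : Finset ℂ) (hu : ∀ c ∈ u, ‖c‖ = 1)
    (hA : aeval A ((∏ c ∈ u, (X - C c)) * (s.map fun c => X - C c).prod) = 0) :
    ∃ (l : List ℂ[X]) (K : ℝ), 0 ≤ K ∧ (∀ x, sumSq A l (A x) ≤ sumSq A l x) ∧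
      ∀ x, ‖x‖ ^ 2 ≤ K * sumSq A l x := by
  classical
  set Pu : ℂ[X] := ∏ c ∈ u, (X - C c) with hPu
  set Ps : ℂ[X] := (s.map fun c => X - C c).prod with hPs
  obtain ⟨l₀, hl₀⟩ := exists_sumSq_strict A s hs Pu hA
  -- `g c` omits only the factor `X - c` from the annihilating polynomial, so `g c (A)` maps into
  -- the eigenspace of `c`. There `A` is multiplication by a number of modulus one, and `‖g c (A)
  -- x‖` is invariant.
  let g : ℂ → ℂ[X] := fun c => (∏ c' ∈ u \ {c}, (X - C c')) * Ps
  have hgc : ∀ c ∈ u, g c * (X - C c) = Pu * Ps := fun c hc => by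
    have : Pu = (∏ c' ∈ u \ {c}, (X - C c')) * (X - C c) := by
      rw [hPu, ← Finset.prod_sdiff (Finset.singleton_subset_iff.2 hc), Finset.prod_singleton]
    rw [this]
    simp only [g]
    ring
  have hg : ∀ c ∈ u, aeval A (g c * (X - C c)) = 0 := fun c hc => by rw [hgc c hc, hA]
  have hiso : ∀ c ∈ u, ∀ x, ‖aeval A (g c) (A x)‖ = ‖aeval A (g c) x‖ := fun c hc x => by
    rw [aeval_mul_X_sub_C_apply A (g c) c x, hg c hc]
    simp [norm_smul, hu c hc]
  have hcop : IsCoprime Pu Ps := by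
    refine IsCoprime.prod_left fun c hc => ?_
    have hlist : ∀ s : List ℂ, (∀ c' ∈ s, ‖c'‖ < 1) →
        IsCoprime (X - C c) (s.map fun c => (X - C c : ℂ[X])).prod := fun s => by
      induction s with
      | nil => intro _; simpa using isCoprime_one_right
      | cons c' s ih =>
        intro h
        rw [List.map_cons, List.prod_cons]
        refine IsCoprime.mul_right ?_ (ih fun d hd => h d (List.mem_cons_of_mem _ hd))
        refine isCoprime_X_sub_C_of_isUnit_sub (Ne.isUnit (sub_ne_zero.2 ?_))
        rintro rfl
        linarith [hu c hc, h c List.mem_cons_self]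
    exact hlist s hs
  obtain ⟨a, b, hab⟩ := hcop
  -- A Bézout identity recovers `x` from `Pu(A) x` and the `g c (A) x`, which makes the form
  -- equivalent to the norm. It combines coprimality of `Pu` and `Ps` with partial fractions for the
  -- simple roots in `u`. If `u` is empty, `Pu` is already `1`.
  have hbez : ∃ β : ℂ → ℂ[X], ∃ a' : ℂ[X], a' * Pu + ∑ c ∈ u, β c * g c = 1 := by
    rcases u.eq_empty_or_nonempty with rfl | hne
    · exact ⟨0, 1, by simp [hPu]⟩
    · obtain ⟨β, hβ⟩ := (exists_sum_eq_one_iff_pairwise_coprime (t := u)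
        (s := fun c : ℂ => (X - C c : ℂ[X])) hne).2 (by
          intro c c' hcc
          refine isCoprime_X_sub_C_of_isUnit_sub (Ne.isUnit (sub_ne_zero.2 fun h => hcc ?_))
          exact Subtype.ext h)
      refine ⟨fun c => b * β c, a, ?_⟩
      have : ∑ c ∈ u, b * β c * g c = b * Ps * ∑ c ∈ u, β c * ∏ c' ∈ u \ {c}, (X - C c') := by
        rw [Finset.mul_sum]
        exact Finset.sum_congr rfl fun c _ => by simp only [g]; ring
      rw [this, hβ, mul_one, hab]
  obtain ⟨β, a', hβ⟩ := hbez
  have hlist : ∀ x, sumSq A (u.toList.map g) x = ∑ c ∈ u, ‖aeval A (g c) x‖ ^ 2 := fun x => by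
    rw [sumSq, List.map_map, ← Finset.sum_map_toList]; rfl
  have hPu_le : ∀ x, ‖aeval A Pu x‖ ^ 2 ≤ sumSq A (l₀ ++ u.toList.map g) x := fun x => by
    rw [sumSq_append]
    linarith [hl₀ x, sumSq_nonneg A l₀ (A x), sumSq_nonneg A (u.toList.map g) x]
  have hg_le : ∀ c ∈ u, ∀ x, ‖aeval A (g c) x‖ ^ 2 ≤ sumSq A (l₀ ++ u.toList.map g) x :=
    fun c hc x => norm_aeval_sq_le_sumSq A (List.mem_append_right _
      (List.mem_map_of_mem (Finset.mem_toList.2 hc))) x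
  refine ⟨l₀ ++ u.toList.map g, (‖aeval A a'‖ + ∑ c ∈ u, ‖aeval A (β c)‖) ^ 2,
    by positivity, fun x => ?_, fun x => ?_⟩
  · rw [sumSq_append, sumSq_append, hlist, hlist,
      Finset.sum_congr rfl fun c hc => by rw [hiso c hc x]]
    linarith [hl₀ x, sq_nonneg ‖aeval A Pu x‖]
  · set q := sumSq A (l₀ ++ u.toList.map g) x with hq
    have hq0 : 0 ≤ q := sumSq_nonneg _ _ _
    have hx : x = aeval A a' (aeval A Pu x) + ∑ c ∈ u, aeval A (β c) (aeval A (g c) x) := by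
      have := congrArg (fun p : ℂ[X] => aeval A p x) hβ
      simpa using this.symm
    have h1 : ‖x‖ ≤ (‖aeval A a'‖ + ∑ c ∈ u, ‖aeval A (β c)‖) * √q := by
      rw [add_mul, Finset.sum_mul]
      conv_lhs => rw [hx]
      refine (norm_add_le _ _).trans (add_le_add ?_ ((norm_sum_le _ _).trans
        (Finset.sum_le_sum fun c hc => ?_)))
      · exact (ContinuousLinearMap.le_opNorm _ _).trans
          (by gcongr; exact Real.le_sqrt_of_sq_le (hPu_le x))
      · exact (ContinuousLinearMap.le_opNorm _ _).trans
          (by gcongr; exact Real.le_sqrt_of_sq_le (hg_le c hc x))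
    calc ‖x‖ ^ 2 ≤ ((‖aeval A a'‖ + ∑ c ∈ u, ‖aeval A (β c)‖) * √q) ^ 2 := by gcongr
      _ = _ := by rw [mul_pow, Real.sq_sqrt hq0]

end PowerBounded

/-! ### Discrete Gronwall estimate with absorption of the dissipation -/

section DiscreteEnergy

lemma sum_Ico_shift_le {g : ℕ → ℝ} (hg : ∀ i, 0 ≤ g i) (i n j : ℕ) (hin : i ≤ n) :
    ∑ l ∈ Finset.Ico i n, g (l + j)
      ≤ ∑ l ∈ Finset.Ico i n, g l + ∑ l ∈ Finset.Ico n (n + j), g l := by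
  rw [Finset.sum_Ico_consecutive _ hin (Nat.le_add_right n j),
    Finset.sum_Ico_add' (fun l => g l) i n j]
  exact Finset.sum_le_sum_of_subset_of_nonneg
    (Finset.Ico_subset_Ico_left (Nat.le_add_right i j)) fun l _ _ => hg l

/-- Sums of a shifted sequence weighted by an increasing sequence. -/
lemma sum_weight_shift_le {w x : ℕ → ℝ} (hw : Monotone w) (hw0 : ∀ i, 0 ≤ w i)
    (hx : ∀ i, 0 ≤ x i) {i n j : ℕ} (hin : i ≤ n) {R : ℝ}
    (hend : ∀ l, n ≤ l → l < n + j → w (l + 1) * x l ≤ R) :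
    ∑ l ∈ Finset.Ico i n, w (l + 1) * x (l + j)
      ≤ ∑ l ∈ Finset.Ico i n, w (l + 1) * x l + j * R := by
  have h1 : ∑ l ∈ Finset.Ico i n, w (l + 1) * x (l + j)
      ≤ ∑ l ∈ Finset.Ico i n, w (l + j + 1) * x (l + j) :=
    Finset.sum_le_sum fun l _ => mul_le_mul_of_nonneg_right (hw (by omega)) (hx _)
  have h2 := sum_Ico_shift_le (g := fun l => w (l + 1) * x l)
    (fun l => mul_nonneg (hw0 _) (hx l)) i n j hin
  have h3 : ∑ l ∈ Finset.Ico n (n + j), w (l + 1) * x l ≤ j * R := by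
    have := Finset.sum_le_card_nsmul (Finset.Ico n (n + j)) (fun l => w (l + 1) * x l) R
      fun l hl => hend l (Finset.mem_Ico.1 hl).1 (Finset.mem_Ico.1 hl).2
    simpa using this
  linarith

/-- The backward energy inequality telescoped with the weights `(1 + c h) ^ i`. -/
lemma telescoped_energy {m n : ℕ} {K h c : ℝ} (hK : 0 ≤ K) (hh : 0 < h) (hc : 0 < c)
    {e v z ρ b : ℕ → ℝ}
    (hE : ∀ i ≤ n, ∀ θ : ℝ, 0 < θ →
      e i ≤ (1 + θ) * (e (i + 1) - v i) + (1 + 1 / θ) * (K * ρ i))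
    (hρ : ∀ i ≤ n, ρ i ≤ K * (h ^ 2 * (∑ j ∈ Finset.Icc 1 m, (e (i + j) + z (i + j)) + z i) + b i))
    (i : ℕ) (hi : i ≤ n) :
    (1 + c * h) ^ i * e i + ∑ l ∈ Finset.Ico i (n + 1), (1 + c * h) ^ (l + 1) * v l
      ≤ (1 + c * h) ^ (n + 1) * e (n + 1) + K ^ 2 / c * ∑ l ∈ Finset.Ico i (n + 1),
        (1 + c * h) ^ (l + 1) *
          (h * (∑ j ∈ Finset.Icc 1 m, (e (l + j) + z (l + j)) + z l) + b l / h) := by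
  have hch : 0 < c * h := mul_pos hc hh
  have step : ∀ l ∈ Finset.Ico i (n + 1), (1 + c * h) ^ l * e l - (1 + c * h) ^ (l + 1) * e (l + 1)
      ≤ K ^ 2 / c * ((1 + c * h) ^ (l + 1) *
          (h * (∑ j ∈ Finset.Icc 1 m, (e (l + j) + z (l + j)) + z l) + b l / h))
        - (1 + c * h) ^ (l + 1) * v l := fun l hl => by
    have hl' : l ≤ n := by have := (Finset.mem_Ico.1 hl).2; omega
    set Q := ∑ j ∈ Finset.Icc 1 m, (e (l + j) + z (l + j)) + z l
    -- The choice `θ = c h` turns `1 + 1 / θ` into `(1 + c h) / (c h)`. One power of `h` in `h²` is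
    -- lost, and the factor `1 / c`, small for large `c`, is gained.
    have h1 := hE l hl' (c * h) hch
    have h2 : (1 + 1 / (c * h)) * (K * ρ l) ≤ (1 + 1 / (c * h)) * (K * (K * (h ^ 2 * Q + b l))) := by
      gcongr; exact hρ l hl'
    have h3 : (1 + 1 / (c * h)) * (K * (K * (h ^ 2 * Q + b l)))
        = (1 + c * h) * (K ^ 2 / c * (h * Q + b l / h)) := by field_simp; ring
    have h4 : e l ≤ (1 + c * h) * (e (l + 1) - v l + K ^ 2 / c * (h * Q + b l / h)) := by linarith
    have h5 : (1 + c * h) ^ l * e l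
        ≤ (1 + c * h) ^ l * ((1 + c * h) * (e (l + 1) - v l + K ^ 2 / c * (h * Q + b l / h))) := by
      gcongr
    rw [pow_succ]
    linarith
  have hsum := Finset.sum_le_sum step
  have htel : ∑ l ∈ Finset.Ico i (n + 1),
      ((1 + c * h) ^ l * e l - (1 + c * h) ^ (l + 1) * e (l + 1))
        = (1 + c * h) ^ i * e i - (1 + c * h) ^ (n + 1) * e (n + 1) := by
    have := Finset.sum_Ico_sub (fun l => (1 + c * h) ^ l * e l) (show i ≤ n + 1 by omega)
    rw [← neg_inj, ← Finset.sum_neg_distrib]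
    simpa using this
  rw [htel, Finset.sum_sub_distrib, ← Finset.mul_sum] at hsum
  linarith

/-- The discrete stability estimate behind the sufficiency of the root condition: `e` is an energy,
`v` the part of the energy that is lost by conditioning, which controls `z`. -/
lemma exists_energy_bound (m : ℕ) {K T : ℝ} (hK : 0 ≤ K) (hT : 0 < T) :
    ∃ C : ℝ, 0 ≤ C ∧ ∀ (n : ℕ) (h S : ℝ) (e v z ρ a b : ℕ → ℝ), 0 < h → (n + m + 1) * h ≤ T →
      0 ≤ S → (∀ i, 0 ≤ e i) → (∀ i, 0 ≤ v i) → (∀ i, 0 ≤ z i) → (∀ i, 0 ≤ a i) →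
      (∀ i, 0 ≤ b i) →
      (∀ i ≤ n, ∀ θ : ℝ, 0 < θ →
        e i ≤ (1 + θ) * (e (i + 1) - v i) + (1 + 1 / θ) * (K * ρ i)) →
      (∀ i ≤ n, ρ i
        ≤ K * (h ^ 2 * (∑ j ∈ Finset.Icc 1 m, (e (i + j) + z (i + j)) + z i) + b i)) →
      (∀ i ≤ n, h * z i ≤ K * (∑ k ∈ Finset.range m, v (i + k) + h * a i)) →
      (∀ i, n < i → z i = 0) → (∀ i, n < i → e i ≤ K * S) → (∀ i, n < i → v i ≤ K * S) →
      (∀ i ≤ n, e i ≤ C * (S + ∑ i ∈ Finset.range (n + 1), (h * a i + b i / h))) ∧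
      ∑ i ∈ Finset.range (n + 1), h * z i
        ≤ C * (S + ∑ i ∈ Finset.range (n + 1), (h * a i + b i / h)) := by
  -- `c` is so large that `κ = K² / c` satisfies `hκ1`, by which the `z` terms cost at most half of
  -- the dissipation, and `hκ2`, by which the energies on the right cost at most a quarter of their
  -- maximum.
  set c : ℝ := 1 + 2 * K ^ 2 * ((m + 1) * K * m + 2 * m * T) with hc
  have hc0 : 0 < c := by positivity
  set κ : ℝ := K ^ 2 / c with hκ
  have hκ0 : 0 ≤ κ := by positivity
  have hκ1 : κ * ((m + 1) * K * m) ≤ 1 / 2 := by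
    rw [hκ, div_mul_eq_mul_div, div_le_iff₀ hc0, hc]
    have : 0 ≤ K ^ 2 * (m * T) := by positivity
    nlinarith
  have hκ2 : κ * (m * T) ≤ 1 / 4 := by
    rw [hκ, div_mul_eq_mul_div, div_le_iff₀ hc0, hc]
    have : 0 ≤ K ^ 2 * ((m + 1) * K * m) := by positivity
    nlinarith
  set R : ℝ := Real.exp (c * T) with hR
  have hR1 : 1 ≤ R := Real.one_le_exp (by positivity)
  set β : ℝ := R * (K + κ * ((m + 1) * K * (m * m * K + 1) + 1)) with hβ
  have hβ0 : 0 ≤ β := by positivity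
  have hβK : R * K ≤ β := by
    rw [hβ]; gcongr; exact le_add_of_nonneg_right (by positivity)
  refine ⟨2 * β + K * (m * (3 * β + m * (R * K)) + R), by positivity, ?_⟩
  intro n h S e v z ρ a b hh hnh hS he hv hz ha hb hE hρ hzv hz0 heS hvS
  set G : ℝ := S + ∑ i ∈ Finset.range (n + 1), (h * a i + b i / h) with hG
  have hterm : ∀ i, 0 ≤ h * a i + b i / h := fun i =>
    add_nonneg (mul_nonneg hh.le (ha i)) (div_nonneg (hb i) hh.le)
  have hSG : S ≤ G := le_add_of_nonneg_right (Finset.sum_nonneg fun i _ => hterm i)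
  have hG0 : 0 ≤ G := hS.trans hSG
  have hIG : ∀ i, ∑ l ∈ Finset.Ico i (n + 1), (h * a l + b l / h) ≤ G := fun i => by
    refine le_trans (Finset.sum_le_sum_of_subset_of_nonneg (fun l hl => ?_) fun l _ _ => hterm l)
      (le_add_of_nonneg_left hS)
    exact Finset.mem_range.2 (Finset.mem_Ico.1 hl).2
  set w : ℕ → ℝ := fun i => (1 + c * h) ^ i with hw
  have hbase : 1 ≤ 1 + c * h := le_add_of_nonneg_right (by positivity)
  have hw1 : ∀ i, 1 ≤ w i := fun i => one_le_pow₀ hbase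
  have hw0 : ∀ i, 0 ≤ w i := fun i => zero_le_one.trans (hw1 i)
  have hwm : Monotone w := fun i j hij => pow_le_pow_right₀ hbase hij
  have hwR : ∀ i ≤ n + m + 1, w i ≤ R := fun i hi => by
    have h1 : w i ≤ Real.exp (c * h) ^ i := by
      refine pow_le_pow_left₀ (by linarith) ?_ i
      linarith [Real.add_one_le_exp (c * h)]
    refine h1.trans ?_
    rw [← Real.exp_nat_mul, hR]
    refine Real.exp_le_exp.2 ?_
    have : (i : ℝ) ≤ n + m + 1 := by exact_mod_cast hi
    nlinarith
  have htel' : ∀ i ≤ n, w i * e i + ∑ l ∈ Finset.Ico i (n + 1), w (l + 1) * v l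
      ≤ w (n + 1) * e (n + 1) + κ * ∑ l ∈ Finset.Ico i (n + 1), w (l + 1) *
          (h * (∑ j ∈ Finset.Icc 1 m, (e (l + j) + z (l + j)) + z l) + b l / h) :=
    fun i hi => telescoped_energy hK hh hc0 hE hρ i hi
  clear_value w R κ c G
  -- the sum of the weighted `z` is controlled by the sum of the weighted `v`
  have hZ : ∀ i ≤ n, ∑ l ∈ Finset.Ico i (n + 1), w (l + 1) * (h * z l)
      ≤ K * (m * (∑ l ∈ Finset.Ico i (n + 1), w (l + 1) * v l + m * (R * (K * S))) + R * G) := by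
    intro i hi
    have h1 : ∑ l ∈ Finset.Ico i (n + 1), w (l + 1) * (h * z l)
        ≤ ∑ l ∈ Finset.Ico i (n + 1),
          K * (∑ k ∈ Finset.range m, w (l + 1) * v (l + k) + w (l + 1) * (h * a l)) := by
      refine Finset.sum_le_sum fun l hl => ?_
      have hl' : l ≤ n := by have := (Finset.mem_Ico.1 hl).2; omega
      rw [← Finset.mul_sum]
      have := mul_le_mul_of_nonneg_left (hzv l hl') (hw0 (l + 1))
      linarith
    refine h1.trans ?_
    rw [← Finset.mul_sum, Finset.sum_add_distrib, Finset.sum_comm]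
    refine mul_le_mul_of_nonneg_left (add_le_add ?_ ?_) hK
    -- A shift by `k < m` pushes fewer than `m` terms beyond `n`. There `v` is bounded by the
    -- starting values and the weight by `R`.
    · have h2 : ∀ k ∈ Finset.range m, ∑ l ∈ Finset.Ico i (n + 1), w (l + 1) * v (l + k)
          ≤ ∑ l ∈ Finset.Ico i (n + 1), w (l + 1) * v l + m * (R * (K * S)) := fun k hk => by
        have hk' := Finset.mem_range.1 hk
        refine (sum_weight_shift_le hwm hw0 hv (by omega) (R := R * (K * S))
          fun l hl hl' => ?_).trans ?_
        · exact mul_le_mul (hwR _ (by omega)) (hvS l (by omega)) (hv l) (by positivity)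
        · have : (k : ℝ) ≤ m := by exact_mod_cast hk'.le
          gcongr
      have := Finset.sum_le_card_nsmul _ _ _ h2
      rwa [Finset.card_range, nsmul_eq_mul] at this
    · calc ∑ l ∈ Finset.Ico i (n + 1), w (l + 1) * (h * a l)
          ≤ ∑ l ∈ Finset.Ico i (n + 1), R * (h * a l + b l / h) := by
            refine Finset.sum_le_sum fun l hl => ?_
            have hl' := (Finset.mem_Ico.1 hl).2
            have : h * a l ≤ h * a l + b l / h := le_add_of_nonneg_right (div_nonneg (hb l) hh.le)
            exact mul_le_mul (hwR _ (by omega)) this (mul_nonneg hh.le (ha l)) (by positivity)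
        _ ≤ R * G := by rw [← Finset.mul_sum]; gcongr; exact hIG i
  -- the energy estimate, given a bound for later energies
  have key : ∀ i ≤ n, ∀ M : ℝ, (∀ l, i < l → l ≤ n + m → w l * e l ≤ M) → 0 ≤ M →
      w i * e i + (∑ l ∈ Finset.Ico i (n + 1), w (l + 1) * v l) / 2 ≤ β * G + M / 4 := by
    intro i hi M hM hM0
    have htel := htel' i hi
    set Vw := ∑ l ∈ Finset.Ico i (n + 1), w (l + 1) * v l
    set Zw := ∑ l ∈ Finset.Ico i (n + 1), w (l + 1) * (h * z l) with hZw
    have hsplit : ∑ l ∈ Finset.Ico i (n + 1), w (l + 1) *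
          (h * (∑ j ∈ Finset.Icc 1 m, (e (l + j) + z (l + j)) + z l) + b l / h)
        = ∑ j ∈ Finset.Icc 1 m, ∑ l ∈ Finset.Ico i (n + 1), h * (w (l + 1) * e (l + j))
          + ∑ j ∈ Finset.Icc 1 m, ∑ l ∈ Finset.Ico i (n + 1), w (l + 1) * (h * z (l + j))
          + Zw + ∑ l ∈ Finset.Ico i (n + 1), w (l + 1) * (b l / h) := by
      rw [Finset.sum_comm, Finset.sum_comm (s := Finset.Icc 1 m), hZw, ← Finset.sum_add_distrib,
        ← Finset.sum_add_distrib, ← Finset.sum_add_distrib]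
      refine Finset.sum_congr rfl fun l _ => ?_
      rw [← Finset.mul_sum, ← Finset.mul_sum, ← Finset.mul_sum, ← Finset.mul_sum,
        Finset.sum_add_distrib]
      ring
    -- Since `j ≥ 1`, only energies at indices greater than `i` occur, and their own weight `w (l +
    -- j)` dominates `w (l + 1)`. This makes a backward induction possible.
    have h1 : ∑ j ∈ Finset.Icc 1 m, ∑ l ∈ Finset.Ico i (n + 1), h * (w (l + 1) * e (l + j))
        ≤ m * T * M := by
      have : ∀ j ∈ Finset.Icc 1 m, ∑ l ∈ Finset.Ico i (n + 1), h * (w (l + 1) * e (l + j))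
          ≤ T * M := fun j hj => by
        obtain ⟨hj1, hj2⟩ := Finset.mem_Icc.1 hj
        have hle : ∀ l ∈ Finset.Ico i (n + 1), h * (w (l + 1) * e (l + j)) ≤ h * M :=
          fun l hl => by
            obtain ⟨hl1, hl2⟩ := Finset.mem_Ico.1 hl
            refine mul_le_mul_of_nonneg_left (le_trans ?_ (hM (l + j) (by omega) (by omega))) hh.le
            exact mul_le_mul_of_nonneg_right (hwm (by omega)) (he _)
        have hcard := Finset.sum_le_card_nsmul _ _ _ hle
        rw [Nat.card_Ico, nsmul_eq_mul] at hcard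
        refine hcard.trans ?_
        rw [← mul_assoc]
        refine mul_le_mul_of_nonneg_right (le_trans ?_ hnh) hM0
        refine mul_le_mul_of_nonneg_right ?_ hh.le
        have : ((n + 1 - i : ℕ) : ℝ) ≤ ((n + m + 1 : ℕ) : ℝ) := by exact_mod_cast (by omega)
        push_cast at this
        exact this
      have := Finset.sum_le_card_nsmul _ _ _ this
      simpa [mul_assoc] using this
    have h2 : ∑ j ∈ Finset.Icc 1 m, ∑ l ∈ Finset.Ico i (n + 1), w (l + 1) * (h * z (l + j))
        ≤ m * Zw := by
      have : ∀ j ∈ Finset.Icc 1 m, ∑ l ∈ Finset.Ico i (n + 1), w (l + 1) * (h * z (l + j))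
          ≤ Zw := fun j _ => by
        refine (sum_weight_shift_le (x := fun l => h * z l) hwm hw0
          (fun l => mul_nonneg hh.le (hz l)) (by omega) (R := 0) fun l hl _ => ?_).trans ?_
        · simp [hz0 l (by omega)]
        · simp [hZw]
      simpa using Finset.sum_le_card_nsmul _ _ _ this
    have h3 : ∑ l ∈ Finset.Ico i (n + 1), w (l + 1) * (b l / h) ≤ R * G := by
      calc ∑ l ∈ Finset.Ico i (n + 1), w (l + 1) * (b l / h)
          ≤ ∑ l ∈ Finset.Ico i (n + 1), R * (h * a l + b l / h) := by
            refine Finset.sum_le_sum fun l hl => ?_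
            have hl' := (Finset.mem_Ico.1 hl).2
            have : b l / h ≤ h * a l + b l / h := le_add_of_nonneg_left (mul_nonneg hh.le (ha l))
            exact mul_le_mul (hwR _ (by omega)) this (div_nonneg (hb l) hh.le) (by positivity)
        _ ≤ R * G := by rw [← Finset.mul_sum]; gcongr; exact hIG i
    have h4 : w (n + 1) * e (n + 1) ≤ R * (K * G) :=
      mul_le_mul (hwR _ (by omega)) ((heS _ (by omega)).trans (by gcongr)) (he _) (by positivity)
    have h5 : Zw ≤ K * (m * (Vw + m * (R * (K * G))) + R * G) :=
      (hZ i hi).trans (by gcongr)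
    have hVw : 0 ≤ Vw := Finset.sum_nonneg fun l _ => mul_nonneg (hw0 _) (hv l)
    rw [hsplit] at htel
    have h6 : κ * (∑ j ∈ Finset.Icc 1 m, ∑ l ∈ Finset.Ico i (n + 1), h * (w (l + 1) * e (l + j))
          + ∑ j ∈ Finset.Icc 1 m, ∑ l ∈ Finset.Ico i (n + 1), w (l + 1) * (h * z (l + j))
          + Zw + ∑ l ∈ Finset.Ico i (n + 1), w (l + 1) * (b l / h))
        ≤ κ * (m * T * M + (m + 1) * (K * (m * (Vw + m * (R * (K * G))) + R * G)) + R * G) := by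
      refine mul_le_mul_of_nonneg_left ?_ hκ0
      have : (m + 1 : ℝ) * Zw ≤ (m + 1) * (K * (m * (Vw + m * (R * (K * G))) + R * G)) := by gcongr
      linarith
    have h7 : κ * (m * T * M + (m + 1) * (K * (m * (Vw + m * (R * (K * G))) + R * G)) + R * G)
        = κ * (m * T) * M + κ * ((m + 1) * K * m) * Vw + (β * G - R * (K * G)) := by
      rw [hβ]; ring
    have h8 : κ * (m * T) * M ≤ 1 / 4 * M := by gcongr
    have h9 : κ * ((m + 1) * K * m) * Vw ≤ 1 / 2 * Vw := by gcongr
    linarith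
  have hM0 : 0 ≤ 2 * (β * G) := by positivity
  have hlate : ∀ l, n < l → l ≤ n + m → w l * e l ≤ 2 * (β * G) := fun l hl hl' => by
    have : w l * e l ≤ R * (K * G) :=
      mul_le_mul (hwR _ (by omega)) ((heS _ hl).trans (by gcongr)) (he _) (by positivity)
    have : R * K * G ≤ β * G := by gcongr
    nlinarith [mul_nonneg hβ0 hG0]
  -- The bound `M = 2 β G` reproduces itself under `key`, because `β G + M / 4 ≤ M`. The induction
  -- runs backwards from `n`.
  have hall : ∀ k, ∀ i, n - i ≤ k → i ≤ n → w i * e i ≤ 2 * (β * G) := by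
    intro k
    induction k with
    | zero =>
      intro i hi hin
      have := key i hin (2 * (β * G)) (fun l hl hl' => hlate l (by omega) hl') hM0
      have hVw : 0 ≤ ∑ l ∈ Finset.Ico i (n + 1), w (l + 1) * v l :=
        Finset.sum_nonneg fun l _ => mul_nonneg (hw0 _) (hv l)
      linarith
    | succ k ih =>
      intro i hi hin
      have := key i hin (2 * (β * G)) (fun l hl hl' => by
        rcases le_or_gt l n with h | h
        · exact ih l (by omega) h
        · exact hlate l h hl') hM0
      have hVw : 0 ≤ ∑ l ∈ Finset.Ico i (n + 1), w (l + 1) * v l :=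
        Finset.sum_nonneg fun l _ => mul_nonneg (hw0 _) (hv l)
      linarith
  have hKterm : 0 ≤ K * (m * (3 * β + m * (R * K)) + R) * G := by positivity
  constructor
  · intro i hi
    have h1 : e i ≤ w i * e i := le_mul_of_one_le_left (he i) (hw1 i)
    have h2 := hall n i (by omega) hi
    linarith
  · have h0 := key 0 (Nat.zero_le n) (2 * (β * G)) (fun l hl hl' => by
        rcases le_or_gt l n with h | h
        · exact hall n l (by omega) h
        · exact hlate l h hl') hM0
    have hz' := hZ 0 (Nat.zero_le n)
    rw [← Finset.range_eq_Ico] at h0 hz'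
    set Vw := ∑ l ∈ Finset.range (n + 1), w (l + 1) * v l
    -- From `key` at `i = 0` with `M = 2 β G`: half of `Vw` is at most `β G + β G / 2`.
    have hVw : Vw ≤ 3 * (β * G) := by
      have := mul_nonneg (hw0 0) (he 0)
      linarith
    have h1 : ∑ l ∈ Finset.range (n + 1), h * z l
        ≤ ∑ l ∈ Finset.range (n + 1), w (l + 1) * (h * z l) :=
      Finset.sum_le_sum fun l _ => le_mul_of_one_le_left (mul_nonneg hh.le (hz l)) (hw1 _)
    have h2 : K * (m * (Vw + m * (R * (K * S))) + R * G)
        ≤ K * (m * (3 * (β * G) + m * (R * (K * G))) + R * G) := by gcongr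
    have h3 : K * (m * (3 * (β * G) + m * (R * (K * G))) + R * G)
        ≤ (2 * β + K * (m * (3 * β + m * (R * K)) + R)) * G := by
      have : 0 ≤ 2 * β * G := by positivity
      linarith
    exact h1.trans (hz'.trans (h2.trans h3))

end DiscreteEnergy

/-! ### The companion operator of the scheme on `H^m` -/

section Companion

open Polynomial

lemma charPoly_monic (S : Coeffs) : (charPoly S).Monic := by
  refine monic_X_pow_sub (mem_degreeLT.1 (Submodule.sum_mem _ fun j hj => mem_degreeLT.2 ?_))
  obtain ⟨h1, h2⟩ := Finset.mem_Icc.1 hj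
  refine (degree_C_mul_X_pow_le _ _).trans_lt ?_
  exact_mod_cast (by omega : S.m - j < S.m)

/-- Under the root condition the characteristic polynomial is a product of distinct linear factors
with roots on the unit circle and of linear factors with roots in the open unit disc. -/
lemma RootCondition.exists_factorization {S : Coeffs} (hS : RootCondition S) :
    ∃ (s : List ℂ) (u : Finset ℂ), (∀ c ∈ s, ‖c‖ < 1) ∧ (∀ c ∈ u, ‖c‖ = 1) ∧
      charPoly S = (∏ c ∈ u, (X - C c)) * (s.map fun c => X - C c).prod := by
  classical
  have hne : charPoly S ≠ 0 := (charPoly_monic S).ne_zero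
  set R := (charPoly S).roots with hR
  refine ⟨(R.filter fun c => ¬ ‖c‖ = 1).toList, (R.filter fun c => ‖c‖ = 1).toFinset, ?_, ?_, ?_⟩
  · intro c hc
    obtain ⟨h1, h2⟩ := Multiset.mem_filter.1 (Multiset.mem_toList.1 hc)
    exact lt_of_le_of_ne (hS c ((mem_roots hne).1 h1)).1 h2
  · intro c hc
    exact (Multiset.mem_filter.1 (Multiset.mem_toFinset.1 hc)).2
  -- Simplicity on the unit circle lets the finset `u` keep all the roots there without losing
  -- multiplicity.
  · have hnodup : (R.filter fun c => ‖c‖ = 1).Nodup := by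
      refine Multiset.nodup_iff_count_le_one.2 fun c => ?_
      by_cases hc : c ∈ R.filter fun c => ‖c‖ = 1
      · obtain ⟨h1, h2⟩ := Multiset.mem_filter.1 hc
        rw [Multiset.count_filter_of_pos (p := fun c : ℂ => ‖c‖ = 1) h2, hR, count_roots]
        exact ((hS c ((mem_roots hne).1 h1)).2 h2).le
      · rw [Multiset.count_eq_zero_of_notMem hc]; exact zero_le_one
    have h1 : ∏ c ∈ (R.filter fun c => ‖c‖ = 1).toFinset, (X - C c : ℂ[X])
        = ((R.filter fun c => ‖c‖ = 1).map fun c => X - C c).prod := by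
      rw [Finset.prod, Multiset.toFinset_val, hnodup.dedup]
    have h2 : ((R.filter fun c => ¬ ‖c‖ = 1).toList.map fun c => (X - C c : ℂ[X])).prod
        = ((R.filter fun c => ¬ ‖c‖ = 1).map fun c => X - C c).prod := by
      rw [← Multiset.prod_coe, ← Multiset.map_coe, Multiset.coe_toList]
    rw [h1, h2, ← Multiset.prod_add, ← Multiset.map_add, Multiset.filter_add_not]
    exact (IsAlgClosed.splits _).eq_prod_roots_of_monic (charPoly_monic S)

variable {H : Type*} [NormedAddCommGroup H] [NormedSpace ℂ H]

/-- The companion operator `x ↦ (∑ α_j x_{j-1}, x_0, …, x_{m-2})` on `H^m`. -/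
def companion (S : Coeffs) (H : Type*) [NormedAddCommGroup H] [NormedSpace ℂ H] :
    PiLp 2 (fun _ : Fin S.m => H) →L[ℂ] PiLp 2 (fun _ : Fin S.m => H) :=
  (PiLp.continuousLinearEquiv 2 ℂ (fun _ : Fin S.m => H)).symm.toContinuousLinearMap.comp
    (ContinuousLinearMap.pi fun l : Fin S.m =>
      if (l : ℕ) = 0 then ∑ j : Fin S.m, (S.α (j + 1) : ℂ) • PiLp.proj 2 (fun _ : Fin S.m => H) j
      else PiLp.proj 2 (fun _ : Fin S.m => H) ⟨l - 1, by omega⟩)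

lemma companion_apply_zero (S : Coeffs) (hm : 0 < S.m) (x : PiLp 2 (fun _ : Fin S.m => H)) :
    companion S H x ⟨0, hm⟩ = ∑ j : Fin S.m, (S.α (j + 1) : ℂ) • x j := by
  simp [companion]

lemma companion_apply_succ (S : Coeffs) {l : ℕ} (hl : l + 1 < S.m)
    (x : PiLp 2 (fun _ : Fin S.m => H)) :
    companion S H x ⟨l + 1, hl⟩ = x ⟨l, by omega⟩ := by
  simp [companion]

/-- Outside its first row the companion operator is a shift, so a power of it moves coordinates as
long as the first row is not reached. -/
lemma companion_pow_apply (S : Coeffs) (k : ℕ) (i i' : Fin S.m) (hi : (i : ℕ) = i' + k)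
    (x : PiLp 2 (fun _ : Fin S.m => H)) : (companion S H ^ k) x i = x i' := by
  induction k generalizing i x with
  | zero => rw [Fin.ext hi]; simp
  | succ k ih =>
    obtain ⟨i, hi'⟩ := i
    obtain rfl : i = i' + k + 1 := hi
    rw [pow_succ', mul_apply_eq_comp, companion_apply_succ, ih _ rfl]

lemma sum_Icc_one_eq_sum_fin {M : Type*} [AddCommMonoid M] (m : ℕ) (g : ℕ → M) :
    ∑ j ∈ Finset.Icc 1 m, g j = ∑ j : Fin m, g (j + 1) := by
  rw [Fin.sum_univ_eq_sum_range (fun j => g (j + 1)), Finset.range_eq_Ico,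
    Finset.sum_Ico_add' g 0 m 1, zero_add]
  rfl

/-- Cayley–Hamilton without determinants. In the last coordinate, the powers `A^(m-j)` read off
`x_{j-1}` and `A^m` reads off `∑ α_j x_{j-1}`, so `P(A) x` vanishes there. Coordinate `i` of `P(A)
x` is the last coordinate of `A^(m-1-i) P(A) x`, and the two operators commute. -/
lemma aeval_charPoly_companion (S : Coeffs) (hm : 0 < S.m) :
    aeval (companion S H) (charPoly S) = 0 := by
  set A := companion S H with hA
  have hlast : ∀ (x : PiLp 2 (fun _ : Fin S.m => H)) (i : Fin S.m), (i : ℕ) = S.m - 1 →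
      aeval A (charPoly S) x i = 0 := fun x i hi => by
    have htop : (A ^ S.m) x i = ∑ j : Fin S.m, (S.α (j + 1) : ℂ) • x j := by
      have h1 : A ^ S.m = A ^ (S.m - 1) * A := by rw [← pow_succ]; congr 1; omega
      rw [h1, mul_apply_eq_comp, companion_pow_apply S _ i ⟨0, hm⟩ (by simp [hi]),
        companion_apply_zero]
    have hexp : aeval A (charPoly S) x
        = (A ^ S.m) x - ∑ j : Fin S.m, (S.α (j + 1) : ℂ) • (A ^ (S.m - (j + 1))) x := by
      rw [← sum_Icc_one_eq_sum_fin S.m fun j => (S.α j : ℂ) • (A ^ (S.m - j)) x]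
      simp [charPoly, Algebra.algebraMap_eq_smul_one]
    rw [hexp, PiLp.sub_apply, htop, sub_eq_zero, ← PiLp.proj_apply (𝕜 := ℂ), map_sum]
    refine Finset.sum_congr rfl fun j _ => ?_
    rw [map_smul, PiLp.proj_apply, companion_pow_apply S _ i j (by have := j.2; omega)]
  ext x i
  have h1 := hlast ((A ^ (S.m - 1 - i)) x) ⟨S.m - 1, by omega⟩ rfl
  have hcomm : aeval A (charPoly S) ((A ^ (S.m - 1 - i)) x)
      = (A ^ (S.m - 1 - i)) (aeval A (charPoly S) x) := by
    have h : aeval A (charPoly S * X ^ (S.m - 1 - i)) = aeval A (X ^ (S.m - 1 - i) * charPoly S) := by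
      rw [mul_comm]
    simpa using congrArg (fun B : _ →L[ℂ] _ => B x) h
  rw [hcomm, companion_pow_apply S _ _ i (by have := i.2; simp only; omega)] at h1
  simpa using h1

/-- The componentwise action of an operator on `H^m`. -/
def diagOp (m : ℕ) (P : H →L[ℂ] H) :
    PiLp 2 (fun _ : Fin m => H) →L[ℂ] PiLp 2 (fun _ : Fin m => H) :=
  (PiLp.continuousLinearEquiv 2 ℂ (fun _ : Fin m => H)).symm.toContinuousLinearMap.comp
    (ContinuousLinearMap.pi fun l : Fin m => P.comp (PiLp.proj 2 (fun _ : Fin m => H) l))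

lemma diagOp_apply (m : ℕ) (P : H →L[ℂ] H) (x : PiLp 2 (fun _ : Fin m => H)) (l : Fin m) :
    diagOp m P x l = P (x l) := by
  simp [diagOp]

/-- The companion operator forms scalar combinations of the coordinates, and these are preserved by
any linear operator applied in each coordinate. -/
lemma companion_diagOp (S : Coeffs) (P : H →L[ℂ] H) (x : PiLp 2 (fun _ : Fin S.m => H)) :
    companion S H (diagOp S.m P x) = diagOp S.m P (companion S H x) := by
  ext l
  obtain ⟨l, hl⟩ := l
  rw [diagOp_apply]
  rcases l with _ | l
  · rw [companion_apply_zero, companion_apply_zero, map_sum]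
    simp [diagOp_apply]
  · rw [companion_apply_succ, companion_apply_succ, diagOp_apply]

lemma aeval_companion_diagOp (S : Coeffs) (P : H →L[ℂ] H) (p : ℂ[X])
    (x : PiLp 2 (fun _ : Fin S.m => H)) :
    aeval (companion S H) p (diagOp S.m P x) = diagOp S.m P (aeval (companion S H) p x) := by
  induction p using Polynomial.induction_on generalizing x with
  | C a => simp [Algebra.algebraMap_eq_smul_one]
  | add p q hp hq => simp [hp, hq]
  | monomial n a h =>
    rw [pow_succ, ← mul_assoc, map_mul, aeval_X, mul_apply_eq_comp, mul_apply_eq_comp,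
      companion_diagOp, h]

/-- Pythagoras' theorem for the quadratic forms `sumSq` of the companion operator. -/
lemma sumSq_diagOp (S : Coeffs) {P : H →L[ℂ] H}
    (hP : ∀ x, ‖P x‖ ^ 2 + ‖x - P x‖ ^ 2 = ‖x‖ ^ 2) (l : List ℂ[X])
    (x : PiLp 2 (fun _ : Fin S.m => H)) :
    sumSq (companion S H) l (diagOp S.m P x) + sumSq (companion S H) l (x - diagOp S.m P x)
      = sumSq (companion S H) l x := by
  have hV : ∀ x : PiLp 2 (fun _ : Fin S.m => H),
      ‖diagOp S.m P x‖ ^ 2 + ‖x - diagOp S.m P x‖ ^ 2 = ‖x‖ ^ 2 := fun x => by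
    rw [PiLp.norm_sq_eq_of_L2, PiLp.norm_sq_eq_of_L2, PiLp.norm_sq_eq_of_L2,
      ← Finset.sum_add_distrib]
    exact Finset.sum_congr rfl fun l _ => by rw [PiLp.sub_apply, diagOp_apply, hP]
  induction l with
  | nil => simp [sumSq_nil]
  | cons p l ih =>
    -- As `p(A)` commutes with the componentwise projection, Pythagoras in `H^m` applies to `p(A)
    -- x`, one polynomial at a time.
    rw [sumSq_cons, sumSq_cons, sumSq_cons, map_sub, aeval_companion_diagOp,
      ← hV (aeval (companion S H) p x), ← ih]
    ring

end Companion

/-! ### Stability of multistep recursions driven by projections -/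

section AbstractStability

lemma norm_sq_apply_le {H : Type*} [NormedAddCommGroup H] {m : ℕ}
    (x : PiLp 2 (fun _ : Fin m => H)) (l : Fin m) :
    ‖x l‖ ^ 2 ≤ ‖x‖ ^ 2 := by
  rw [PiLp.norm_sq_eq_of_L2]
  exact Finset.single_le_sum (f := fun l => ‖x l‖ ^ 2) (fun l _ => sq_nonneg _)
    (Finset.mem_univ l)

variable {H : Type*} [NormedAddCommGroup H] [NormedSpace ℂ H]

/-- The vector `(P y_i, P y_{i+1}, …, P y_{i+m-1})`. -/
def window (m : ℕ) (P : ℕ → H →L[ℂ] H) (y : ℕ → H) (i : ℕ) : PiLp 2 (fun _ : Fin m => H) :=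
  WithLp.toLp 2 fun l : Fin m => P i (y (i + l))

lemma window_apply (m : ℕ) (P : ℕ → H →L[ℂ] H) (y : ℕ → H) (i : ℕ) (l : Fin m) :
    window m P y i l = P i (y (i + l)) := rfl

/-- Telescoping along `P (i + k)` and Cauchy–Schwarz. It splits the conditional variance over `j`
steps into one-step increments, which are what the energy loses in each step. -/
lemma norm_sub_le_sum_increments (P : ℕ → H →L[ℂ] H) (x : H) (i j : ℕ)
    (hx : P (i + j) x = x) :
    ‖x - P i x‖ ^ 2 ≤ j * ∑ k ∈ Finset.range j, ‖P (i + k + 1) x - P (i + k) x‖ ^ 2 := by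
  have h1 : x - P i x = ∑ k ∈ Finset.range j, (P (i + k + 1) x - P (i + k) x) := by
    have := Finset.sum_range_sub (fun k => P (i + k) x) j
    simp only [hx, add_zero] at this
    exact this.symm
  have h2 : ‖x - P i x‖ ≤ ∑ k ∈ Finset.range j, ‖P (i + k + 1) x - P (i + k) x‖ := by
    rw [h1]; exact norm_sum_le _ _
  have h3 := sq_sum_le_card_mul_sum_sq (s := Finset.range j)
    (f := fun k => ‖P (i + k + 1) x - P (i + k) x‖)
  rw [Finset.card_range] at h3
  exact (pow_le_pow_left₀ (norm_nonneg _) h2 2).trans h3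

/-- Stability of a multistep recursion `y_i = ∑ α_j P_i y_{i+j} + r_i` driven by a decreasing
family of orthogonal projections. -/
theorem exists_stability_bound (S : Coeffs) (hm : 1 ≤ S.m) (hS : RootCondition S)
    (H : Type*) [NormedAddCommGroup H] [NormedSpace ℂ H] {K T : ℝ} (hK : 0 ≤ K) (hT : 0 < T) :
    ∃ C : ℝ, 0 ≤ C ∧ ∀ (n : ℕ) (h s : ℝ) (P : ℕ → H →L[ℂ] H) (y : ℕ → H) (z a b : ℕ → ℝ),
      0 < h → (n + S.m + 1) * h ≤ T → 0 ≤ s → (∀ i, 0 ≤ z i) → (∀ i, 0 ≤ a i) → (∀ i, 0 ≤ b i) →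
      (∀ i x, ‖P i x‖ ^ 2 + ‖x - P i x‖ ^ 2 = ‖x‖ ^ 2) → (∀ i x, P i (P (i + 1) x) = P i x) →
      (∀ i, P i (y i) = y i) →
      (∀ i ≤ n, ‖y i - ∑ j ∈ Finset.Icc 1 S.m, (S.α j : ℂ) • P i (y (i + j))‖ ^ 2
        ≤ K * (h ^ 2 * (∑ j ∈ Finset.Icc 1 S.m, (‖y (i + j)‖ ^ 2 + z (i + j)) + z i) + b i)) →
      (∀ i ≤ n, h * z i
        ≤ K * (∑ j ∈ Finset.Icc 1 S.m, ‖y (i + j) - P i (y (i + j))‖ ^ 2 + h * a i)) →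
      (∀ i, n < i → z i = 0) → (∀ i, n < i → ‖y i‖ ^ 2 ≤ s) →
      (∀ i ≤ n, ‖y i‖ ^ 2 ≤ C * (s + ∑ i ∈ Finset.range (n + 1), (h * a i + b i / h))) ∧
      ∑ i ∈ Finset.range (n + 1), h * z i
        ≤ C * (s + ∑ i ∈ Finset.range (n + 1), (h * a i + b i / h)) := by
  obtain ⟨r, u, hr, hu, hfac⟩ := hS.exists_factorization
  set A := companion S H with hA
  obtain ⟨q, K₁, hK₁, hcontr, hlow⟩ := exists_sumSq_contraction A r hr u hu
    (by rw [← hfac]; exact aeval_charPoly_companion S hm)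
  obtain ⟨K₂, hK₂, hup⟩ := exists_sumSq_le A q
  set K' : ℝ := K * ((1 + K₁) * (1 + S.m * S.m)) + K₂ * S.m + K₂ with hK'
  have hK'0 : 0 ≤ K' := by positivity
  obtain ⟨C, hC, hmain⟩ := exists_energy_bound S.m hK'0 hT
  refine ⟨(1 + K₁) * C, by positivity, ?_⟩
  intro n h s P y z a b hh hnh hs hz ha hb hP htow hy hrec hzrec hz0 hys
  set U := window S.m P y with hU
  set Q := fun i => diagOp S.m (P i) with hQ
  have hPle : ∀ i x, ‖P i x‖ ^ 2 ≤ ‖x‖ ^ 2 := fun i x => by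
    linarith [hP i x, sq_nonneg ‖x - P i x‖]
  have hyU : ∀ i, ‖y i‖ ^ 2 ≤ K₁ * sumSq A q (U i) := fun i => by
    have := norm_sq_apply_le (U i) ⟨0, hm⟩
    rw [hU, window_apply] at this
    simp only [add_zero, hy] at this
    exact this.trans (hlow _)
  -- Coordinate `l` of `U (i + 1) - Q i (U (i + 1))` is, by the tower property, the one-step
  -- increment of `y (i + 1 + l)`.
  have hvar : ∀ i (l : ℕ), l < S.m → ‖P (i + 1) (y (i + 1 + l)) - P i (y (i + 1 + l))‖ ^ 2
      ≤ K₁ * sumSq A q (U (i + 1) - Q i (U (i + 1))) := fun i l hl => by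
    have := norm_sq_apply_le (U (i + 1) - Q i (U (i + 1))) ⟨l, hl⟩
    rw [PiLp.sub_apply, hQ, diagOp_apply, hU, window_apply, htow] at this
    exact this.trans (hlow _)
  have hstart : ∀ i, n < i → sumSq A q (U i) ≤ K' * s := fun i hi => by
    have h1 : ‖U i‖ ^ 2 ≤ S.m * s := by
      rw [PiLp.norm_sq_eq_of_L2]
      have : ∀ l ∈ (Finset.univ : Finset (Fin S.m)), ‖U i l‖ ^ 2 ≤ s := fun l _ => by
        rw [hU, window_apply]
        exact (hPle _ _).trans (hys _ (by omega))
      simpa using Finset.sum_le_card_nsmul _ _ _ this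
    calc sumSq A q (U i) ≤ K₂ * (S.m * s) := (hup _).trans (by gcongr)
      _ = K₂ * S.m * s := by ring
      _ ≤ K' * s := by
        refine mul_le_mul_of_nonneg_right ?_ hs
        have : 0 ≤ K * ((1 + K₁) * (1 + S.m * S.m)) := by positivity
        linarith
  have hKle : ∀ x : ℝ, 0 ≤ x → K * ((1 + K₁) * ((1 + S.m * S.m) * x)) ≤ K' * x := fun x hx => by
    have : 0 ≤ (K₂ * S.m + K₂) * x := by positivity
    rw [hK']; linarith
  -- Only the first coordinate carries a residual. In the other rows the companion shift reproduces
  -- the window exactly, by the tower property.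
  have hrest : ∀ i, U i - A (Q i (U (i + 1)))
      = WithLp.toLp 2 (Pi.single ⟨0, hm⟩
        (y i - ∑ j ∈ Finset.Icc 1 S.m, (S.α j : ℂ) • P i (y (i + j)))) := fun i => by
    ext l
    obtain ⟨l, hl⟩ := l
    rw [PiLp.sub_apply]
    rcases l with _ | l
    · rw [hA, companion_apply_zero, sum_Icc_one_eq_sum_fin S.m
        fun j => (S.α j : ℂ) • P i (y (i + j))]
      simp only [hU, window_apply, hQ, diagOp_apply, add_zero, hy, htow, Pi.single_eq_same]
      congr 1
      exact Finset.sum_congr rfl fun j _ => by rw [show i + 1 + (j : ℕ) = i + (j + 1) by ring]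
    · rw [hA, companion_apply_succ]
      simp only [hU, window_apply, hQ, diagOp_apply, htow]
      rw [show i + 1 + l = i + (l + 1) by ring, sub_self, Pi.single_eq_of_ne]
      simp
  have hG : 0 ≤ s + ∑ i ∈ Finset.range (n + 1), (h * a i + b i / h) :=
    add_nonneg hs (Finset.sum_nonneg fun i _ =>
      add_nonneg (mul_nonneg hh.le (ha i)) (div_nonneg (hb i) hh.le))
  have hCG := mul_nonneg hC hG
  have hKCG := mul_nonneg hK₁ hCG
  refine And.imp (fun h1 i hi => ?_) (fun h2 => h2.trans (by linarith)) (hmain n h s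
    (fun i => sumSq A q (U i)) (fun i => sumSq A q (U (i + 1) - Q i (U (i + 1)))) z
    (fun i => ‖y i - ∑ j ∈ Finset.Icc 1 S.m, (S.α j : ℂ) • P i (y (i + j))‖ ^ 2) a b hh hnh hs
    (fun i => sumSq_nonneg _ _ _) (fun i => sumSq_nonneg _ _ _) hz ha hb ?_ ?_ ?_ hz0 hstart ?_)
  · have h3 := mul_le_mul_of_nonneg_left (h1 i hi) hK₁
    linarith [hyU i]
  · intro i hi θ hθ
    have h1 : U i = A (Q i (U (i + 1))) + (U i - A (Q i (U (i + 1)))) := by abel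
    have h2 := sumSq_add_le A q hθ (A (Q i (U (i + 1)))) (U i - A (Q i (U (i + 1))))
    rw [← h1] at h2
    -- Contractivity of `A` followed by Pythagoras: the projection removes exactly the energy of `U
    -- (i + 1) - Q i (U (i + 1))`.
    have h3 : sumSq A q (A (Q i (U (i + 1))))
        ≤ sumSq A q (U (i + 1)) - sumSq A q (U (i + 1) - Q i (U (i + 1))) := by
      have := sumSq_diagOp S (hP i) q (U (i + 1))
      linarith [hcontr (Q i (U (i + 1)))]
    have h4 : sumSq A q (U i - A (Q i (U (i + 1))))
        ≤ K' * ‖y i - ∑ j ∈ Finset.Icc 1 S.m, (S.α j : ℂ) • P i (y (i + j))‖ ^ 2 := by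
      refine (hup _).trans ?_
      have hn : ‖U i - A (Q i (U (i + 1)))‖
          = ‖y i - ∑ j ∈ Finset.Icc 1 S.m, (S.α j : ℂ) • P i (y (i + j))‖ := by
        rw [hrest i]
        exact PiLp.norm_single 2 (fun _ : Fin S.m => H) ⟨0, hm⟩ _
      rw [hn]
      gcongr
      rw [hK']
      exact le_add_of_nonneg_left (by positivity)
    refine h2.trans ?_
    gcongr
  · intro i hi
    refine (hrec i hi).trans ?_
    set E' := ∑ j ∈ Finset.Icc 1 S.m, (sumSq A q (U (i + j)) + z (i + j)) + z i with hE'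
    have hE0 : 0 ≤ E' := add_nonneg (Finset.sum_nonneg fun j _ =>
      add_nonneg (sumSq_nonneg _ _ _) (hz _)) (hz _)
    have h1 : ∑ j ∈ Finset.Icc 1 S.m, (‖y (i + j)‖ ^ 2 + z (i + j)) + z i ≤ (1 + K₁) * E' := by
      rw [hE', mul_add, Finset.mul_sum]
      refine add_le_add (Finset.sum_le_sum fun j _ => ?_) ?_
      · have := mul_nonneg hK₁ (hz (i + j))
        have := sumSq_nonneg A q (U (i + j))
        linarith [hyU (i + j)]
      · exact le_mul_of_one_le_left (hz i) (by linarith)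
    refine le_trans ?_ (hKle _ (add_nonneg (mul_nonneg (sq_nonneg h) hE0) (hb i)))
    refine mul_le_mul_of_nonneg_left ?_ hK
    have h2 : h ^ 2 * (∑ j ∈ Finset.Icc 1 S.m, (‖y (i + j)‖ ^ 2 + z (i + j)) + z i)
        ≤ h ^ 2 * ((1 + K₁) * E') := by gcongr
    have h3 : b i ≤ (1 + K₁) * b i := le_mul_of_one_le_left (hb i) (by linarith)
    have h4 : (h ^ 2 * E' + b i) ≤ (1 + S.m * S.m) * (h ^ 2 * E' + b i) :=
      le_mul_of_one_le_left (add_nonneg (mul_nonneg (sq_nonneg h) hE0) (hb i))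
        (le_add_of_nonneg_right (by positivity))
    have h5 := mul_le_mul_of_nonneg_left h4 (show 0 ≤ 1 + K₁ by linarith)
    linarith
  · intro i hi
    refine (hzrec i hi).trans ?_
    set Vs := ∑ k ∈ Finset.range S.m, sumSq A q (U (i + k + 1) - Q (i + k) (U (i + k + 1))) with hVs
    have hVs0 : 0 ≤ Vs := Finset.sum_nonneg fun k _ => sumSq_nonneg _ _ _
    have h1 : ∀ j ∈ Finset.Icc 1 S.m, ‖y (i + j) - P i (y (i + j))‖ ^ 2 ≤ S.m * (K₁ * Vs) := by
      intro j hj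
      obtain ⟨hj1, hj2⟩ := Finset.mem_Icc.1 hj
      refine (norm_sub_le_sum_increments P _ i j (hy _)).trans ?_
      refine mul_le_mul (by exact_mod_cast hj2) ?_ (by positivity) (by positivity)
      rw [hVs, Finset.mul_sum]
      refine le_trans (Finset.sum_le_sum fun k hk => ?_)
        (Finset.sum_le_sum_of_subset_of_nonneg (Finset.range_mono hj2) fun k _ _ =>
          mul_nonneg hK₁ (sumSq_nonneg _ _ _))
      have hk' := Finset.mem_range.1 hk
      -- Seen from the window starting at `i + k + 1`, the vector `y (i + j)` is coordinate `j - k -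
      -- 1`.
      have := hvar (i + k) (j - k - 1) (by omega)
      rwa [show i + k + 1 + (j - k - 1) = i + j by omega] at this
    have h2 : ∑ j ∈ Finset.Icc 1 S.m, ‖y (i + j) - P i (y (i + j))‖ ^ 2
        ≤ S.m * (S.m * (K₁ * Vs)) := by
      simpa using Finset.sum_le_card_nsmul _ _ _ h1
    have hha := mul_nonneg hh.le (ha i)
    refine le_trans ?_ (hKle _ (add_nonneg hVs0 hha))
    refine mul_le_mul_of_nonneg_left ?_ hK
    have h3 : 0 ≤ (1 + S.m * S.m + K₁) * Vs := by positivity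
    have h4 : 0 ≤ (S.m * S.m + K₁ + K₁ * (S.m * S.m)) * (h * a i) := by positivity
    linarith
  · intro i hi
    refine le_trans ?_ (hstart (i + 1) (by omega))
    have := sumSq_diagOp S (hP i) q (U (i + 1))
    linarith [sumSq_nonneg A q (diagOp S.m (P i) (U (i + 1)))]

end AbstractStability

/-! ### Conditional expectations of products with independent factors -/

section ConditionalCauchySchwarz

variable {Ω : Type*} {m mΩ : MeasurableSpace Ω} {μ : Measure Ω} {d : ℕ}

/-- Contraction property of the conditional expectation in `𝕃₂`. -/
lemma integral_condExp_sq_le {ξ : Ω → ℝ} (hξ : MemLp ξ 2 μ) :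
    ∫ ω, (μ[ξ | m] ω) ^ 2 ∂μ ≤ ∫ ω, ξ ω ^ 2 ∂μ := by
  have h1 : ∀ {g : Ω → ℝ}, MemLp g 2 μ → ∫ ω, g ω ^ 2 ∂μ = (eLpNorm g 2 μ).toReal ^ 2 :=
    fun {g} hg => by
      have hint : 0 ≤ ∫ ω, g ω ^ 2 ∂μ := integral_nonneg fun ω => sq_nonneg _
      rw [hg.eLpNorm_eq_integral_rpow_norm (by norm_num) (by norm_num),
        ENNReal.toReal_ofReal (by positivity)]
      simp only [ENNReal.toReal_ofNat, Real.rpow_ofNat, Real.norm_eq_abs, sq_abs]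
      rw [← Real.rpow_natCast, ← Real.rpow_mul hint]
      simp
  rw [h1 hξ, h1 (hξ.condExp one_le_two)]
  gcongr
  · exact hξ.2.ne
  · exact eLpNorm_condExp_le_eLpNorm ξ one_le_two

lemma integral_norm_sq_eq_sum {F : Ω → E d} (hF : MemLp F 2 μ) :
    ∫ ω, ‖F ω‖ ^ 2 ∂μ = ∑ a, ∫ ω, (F ω a) ^ 2 ∂μ := by
  simp_rw [EuclideanSpace.real_norm_sq_eq]
  exact integral_finsetSum _ fun a _ => (hF.eval_piLp a).integrable_sq

variable [IsProbabilityMeasure μ]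

/-- Conditional Cauchy-Schwarz inequality, one of the factors being independent of the
conditioning. -/
lemma condExp_mul_sq_le (hm : m ≤ mΩ) {ξ G : Ω → ℝ} (hξ : MemLp ξ 2 μ) (hG : MemLp G 2 μ)
    (hGm : Measurable G) (hind : Indep (MeasurableSpace.comap G inferInstance) m μ) :
    ∀ᵐ ω ∂μ, (μ[fun ω => ξ ω * G ω | m] ω) ^ 2
      ≤ (∫ ω, G ω ^ 2 ∂μ) * μ[fun ω => ξ ω ^ 2 | m] ω := by
  have hGG : μ[fun ω => G ω ^ 2 | m] =ᵐ[μ] fun _ => ∫ ω, G ω ^ 2 ∂μ :=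
    condExp_indep_eq hGm.comap_le hm
      (((comap_measurable G).pow_const 2).stronglyMeasurable) hind
  have hξ2 : Integrable (fun ω => ξ ω ^ 2) μ := hξ.integrable_sq
  have hG2 : Integrable (fun ω => G ω ^ 2) μ := hG.integrable_sq
  have hξG : Integrable (fun ω => ξ ω * G ω) μ := hξ.integrable_mul hG
  -- `𝔼[(ξ + q G)² | m] ≥ 0` is a quadratic polynomial in `q`, and its discriminant gives the claim.
  -- The null set depends on `q`, so rational `q` come first and continuity supplies the real ones.
  have hq : ∀ q : ℚ, ∀ᵐ ω ∂μ, 0 ≤ (∫ ω, G ω ^ 2 ∂μ) * ((q : ℝ) * q)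
      + 2 * μ[fun ω => ξ ω * G ω | m] ω * q + μ[fun ω => ξ ω ^ 2 | m] ω := fun q => by
    have hnn : 0 ≤ᵐ[μ] μ[fun ω => (ξ ω + q * G ω) ^ 2 | m] :=
      condExp_nonneg (Filter.Eventually.of_forall fun ω => sq_nonneg _)
    have hexp : (fun ω => (ξ ω + q * G ω) ^ 2)
        = (fun ω => ξ ω ^ 2) + ((2 * (q : ℝ)) • (fun ω => ξ ω * G ω)
          + ((q : ℝ) * q) • fun ω => G ω ^ 2) := by
      funext ω
      simp only [Pi.add_apply, Pi.smul_apply, smul_eq_mul]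
      ring
    rw [hexp] at hnn
    filter_upwards [hnn, hGG, condExp_add hξ2 ((hξG.smul (2 * (q : ℝ))).add (hG2.smul ((q : ℝ) * q))) m,
      condExp_add (hξG.smul (2 * (q : ℝ))) (hG2.smul ((q : ℝ) * q)) m,
      condExp_smul (2 * (q : ℝ)) (fun ω => ξ ω * G ω) m (μ := μ),
      condExp_smul ((q : ℝ) * q) (fun ω => G ω ^ 2) m (μ := μ)] with ω h1 h2 h3 h4 h5 h6
    rw [h3, Pi.add_apply, h4, Pi.add_apply, h5, h6, Pi.smul_apply, Pi.smul_apply, h2] at h1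
    simp only [Pi.zero_apply, smul_eq_mul] at h1
    linarith
  filter_upwards [ae_all_iff.2 hq] with ω hω
  have hall : ∀ x : ℝ, 0 ≤ (∫ ω, G ω ^ 2 ∂μ) * (x * x)
      + 2 * μ[fun ω => ξ ω * G ω | m] ω * x + μ[fun ω => ξ ω ^ 2 | m] ω := fun x => by
    refine Rat.denseRange_cast.induction_on (p := fun x : ℝ => 0 ≤ (∫ ω, G ω ^ 2 ∂μ) * (x * x)
      + 2 * μ[fun ω => ξ ω * G ω | m] ω * x + μ[fun ω => ξ ω ^ 2 | m] ω) x ?_ hω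
    exact isClosed_le continuous_const (by fun_prop)
  have := discrim_le_zero hall
  rw [discrim] at this
  nlinarith

/-- `𝕃₂` bound for `𝔼[ξ G | m]` if `G` is independent of `m`. -/
lemma memLp_condExp_mul_of_indep (hm : m ≤ mΩ) {ξ G : Ω → ℝ} (hξ : MemLp ξ 2 μ) (hG : MemLp G 2 μ)
    (hGm : Measurable G) (hind : Indep (MeasurableSpace.comap G inferInstance) m μ) :
    MemLp (μ[fun ω => ξ ω * G ω | m]) 2 μ ∧
      ∫ ω, (μ[fun ω => ξ ω * G ω | m] ω) ^ 2 ∂μ ≤ (∫ ω, G ω ^ 2 ∂μ) * ∫ ω, ξ ω ^ 2 ∂μ := by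
  have hcs := condExp_mul_sq_le hm hξ hG hGm hind
  have hdom : Integrable (fun ω => (∫ ω, G ω ^ 2 ∂μ) * μ[fun ω => ξ ω ^ 2 | m] ω) μ :=
    integrable_condExp.const_mul _
  have hmeas : AEStronglyMeasurable (μ[fun ω => ξ ω * G ω | m]) μ :=
    integrable_condExp.aestronglyMeasurable
  have hint : Integrable (fun ω => (μ[fun ω => ξ ω * G ω | m] ω) ^ 2) μ := by
    refine hdom.mono (hmeas.pow 2) ?_
    filter_upwards [hcs] with ω hω
    rw [Real.norm_of_nonneg (sq_nonneg _)]
    exact hω.trans (le_abs_self _)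
  refine ⟨(memLp_two_iff_integrable_sq hmeas).2 hint, ?_⟩
  refine (integral_mono_ae hint hdom hcs).trans ?_
  rw [integral_const_mul, integral_condExp hm]

/-- `𝕃₂` bound for `𝔼[ξ G | m]` if the vector `G` is independent of `m`. -/
lemma memLp_condExp_smul_of_indep (hm : m ≤ mΩ) {ξ : Ω → ℝ} {G : Ω → E d} (hξ : MemLp ξ 2 μ)
    (hG : MemLp G 2 μ) (hGm : Measurable G)
    (hind : Indep (MeasurableSpace.comap G inferInstance) m μ) :
    MemLp (μ[fun ω => ξ ω • G ω | m]) 2 μ ∧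
      ∫ ω, ‖μ[fun ω => ξ ω • G ω | m] ω‖ ^ 2 ∂μ ≤ (∫ ω, ‖G ω‖ ^ 2 ∂μ) * ∫ ω, ξ ω ^ 2 ∂μ := by
  have hint : Integrable (fun ω => ξ ω • G ω) μ := memLp_one_iff_integrable.1 (hG.smul hξ)
  have hcoord : ∀ a : Fin d, (fun ω => μ[fun ω => ξ ω • G ω | m] ω a)
      =ᵐ[μ] μ[fun ω => ξ ω * G ω a | m] := fun a =>
    (EuclideanSpace.proj (𝕜 := ℝ) a).comp_condExp_comm hint
  have hinda : ∀ a : Fin d,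
      Indep (MeasurableSpace.comap (fun ω => G ω a) inferInstance) m μ := fun a => by
    refine indep_of_indep_of_le_left hind ?_
    have : Measurable fun x : E d => x a := by fun_prop
    have h2 : (fun ω => G ω a) = (fun x : E d => x a) ∘ G := rfl
    rw [h2, ← MeasurableSpace.comap_comp]
    exact MeasurableSpace.comap_mono this.comap_le
  have hbd := fun a : Fin d => memLp_condExp_mul_of_indep hm hξ (hG.eval_piLp a)
    (show Measurable fun ω => G ω a by fun_prop) (hinda a)
  have hmem : MemLp (μ[fun ω => ξ ω • G ω | m]) 2 μ :=
    MemLp.of_eval_piLp fun a => (memLp_congr_ae (hcoord a)).2 (hbd a).1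
  refine ⟨hmem, ?_⟩
  rw [integral_norm_sq_eq_sum hmem, integral_norm_sq_eq_sum hG, Finset.sum_mul]
  refine Finset.sum_le_sum fun a _ => le_trans (le_of_eq ?_) (hbd a).2
  refine integral_congr_ae ?_
  filter_upwards [hcoord a] with ω hω
  rw [hω]

/-- If `G` is centered and independent of `m`, then `ξ` may be centered in `𝔼[ξ G | m]`. -/
lemma condExp_smul_center (hm : m ≤ mΩ) {ξ : Ω → ℝ} {G : Ω → E d} (hξ : MemLp ξ 2 μ)
    (hG : MemLp G 2 μ) (hGm : Measurable G)
    (hind : Indep (MeasurableSpace.comap G inferInstance) m μ) (hG0 : ∫ ω, G ω ∂μ = 0) :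
    μ[fun ω => ξ ω • G ω | m] =ᵐ[μ] μ[fun ω => (ξ ω - μ[ξ | m] ω) • G ω | m] := by
  have hξ' : MemLp (μ[ξ | m]) 2 μ := hξ.condExp one_le_two
  have hint : Integrable (fun ω => ξ ω • G ω) μ := memLp_one_iff_integrable.1 (hG.smul hξ)
  have hint' : Integrable (μ[ξ | m] • G) μ := memLp_one_iff_integrable.1 (hG.smul hξ')
  have hGc : μ[G | m] =ᵐ[μ] fun _ => ∫ ω, G ω ∂μ :=
    condExp_indep_eq hGm.comap_le hm (comap_measurable G).stronglyMeasurable hind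
  have h1 : μ[μ[ξ | m] • G | m] =ᵐ[μ] μ[ξ | m] • μ[G | m] :=
    condExp_smul_of_aestronglyMeasurable_left stronglyMeasurable_condExp.aestronglyMeasurable hint'
      (hG.integrable one_le_two)
  have h2 : (fun ω => (ξ ω - μ[ξ | m] ω) • G ω) = (fun ω => ξ ω • G ω) - μ[ξ | m] • G := by
    funext ω
    simp [sub_smul]
  rw [h2]
  filter_upwards [condExp_sub hint hint' m, h1, hGc] with ω h3 h4 h5
  rw [h3, Pi.sub_apply, h4, Pi.smul_apply', h5, hG0, smul_zero, sub_zero]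

end ConditionalCauchySchwarz

/-! ### Moments and measurability of Brownian increments -/

section Brownian

lemma natF_mono {Ω : Type*} {d : ℕ} (W : ℝ → Ω → E d) {s t : ℝ} (hst : s ≤ t) : natF W s ≤ natF W t :=
  biSup_mono fun _ hr => ⟨hr.1, hr.2.trans hst⟩

variable {Ω : Type*} [mΩ : MeasurableSpace Ω] {μ : Measure Ω} {d : ℕ}
  {T : ℝ} {W : ℝ → Ω → E d}

namespace IsBrownianMotion

lemma natF_le (hW : IsBrownianMotion T W μ) {t : ℝ} (ht : t ≤ T) : natF W t ≤ mΩ :=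
  iSup₂_le fun s hs => (hW.measurable s ⟨hs.1, hs.2.trans ht⟩).comap_le

lemma measurable_increment (hW : IsBrownianMotion T W μ) {s t : ℝ} (hs : 0 ≤ s) (hst : s ≤ t)
    (ht : t ≤ T) : Measurable fun ω => W t ω - W s ω :=
  (hW.measurable t ⟨hs.trans hst, ht⟩).sub (hW.measurable s ⟨hs, hst.trans ht⟩)

lemma memLp_increment (hW : IsBrownianMotion T W μ) {s t : ℝ} (hs : 0 ≤ s) (hst : s ≤ t)
    (ht : t ≤ T) : MemLp (fun ω => W t ω - W s ω) 2 μ := by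
  have hlaw := hW.law s t hs hst ht
  have h := IsGaussian.memLp_two_id
    (μ := multivariateGaussian (0 : E d) ((t - s) • (1 : Matrix (Fin d) (Fin d) ℝ)))
  rw [← hlaw.map_eq, memLp_map_measure_iff aestronglyMeasurable_id hlaw.aemeasurable] at h
  exact h

lemma integral_increment (hW : IsBrownianMotion T W μ) {s t : ℝ} (hs : 0 ≤ s) (hst : s ≤ t)
    (ht : t ≤ T) : ∫ ω, (W t ω - W s ω) ∂μ = 0 := by
  rw [(hW.law s t hs hst ht).integral_eq, integral_id_multivariateGaussian]

lemma integral_norm_increment_sq (hW : IsBrownianMotion T W μ) {s t : ℝ} (hs : 0 ≤ s)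
    (hst : s ≤ t) (ht : t ≤ T) : ∫ ω, ‖W t ω - W s ω‖ ^ 2 ∂μ = d * (t - s) := by
  have hlaw := hW.law s t hs hst ht
  have hps : ((t - s) • (1 : Matrix (Fin d) (Fin d) ℝ)).PosSemidef :=
    Matrix.PosSemidef.one.smul (sub_nonneg.2 hst)
  rw [integral_norm_sq_eq_sum (hW.memLp_increment hs hst ht)]
  have hcoord : ∀ a : Fin d, ∫ ω, ((W t ω - W s ω) a) ^ 2 ∂μ = t - s := fun a => by
    have hv := variance_eval_multivariateGaussian (μ := (0 : E d)) hps a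
    have hmean : ∫ x : E d, x a
        ∂(multivariateGaussian (0 : E d) ((t - s) • (1 : Matrix (Fin d) (Fin d) ℝ))) = 0 := by
      have := (EuclideanSpace.proj (𝕜 := ℝ) a).integral_comp_comm (IsGaussian.integrable_id
        (μ := multivariateGaussian (0 : E d) ((t - s) • (1 : Matrix (Fin d) (Fin d) ℝ))))
      simpa using this
    rw [variance_of_integral_eq_zero (by fun_prop) hmean] at hv
    have hc := hlaw.integral_comp (f := fun x : E d => (x a) ^ 2) (by fun_prop)
    rw [hv] at hc
    simpa using hc
  rw [Finset.sum_congr rfl fun a _ => hcoord a, Finset.sum_const, Finset.card_univ,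
    Fintype.card_fin, nsmul_eq_mul]

end IsBrownianMotion

end Brownian

/-! ### Standing assumptions, Euler scheme and driver -/

/-- The standing assumptions on the data, with the Lipschitz constants `L` and `Lf`. -/
structure Assumptions {Ω : Type*} [MeasurableSpace Ω] {d : ℕ} (D : FBSDE d) (W : ℝ → Ω → E d)
    (μ : Measure Ω) (L Lf : ℝ) : Prop where
  T_pos : 0 < D.T
  bm : IsBrownianMotion D.T W μ
  lip : ∀ t ∈ Set.Icc (0 : ℝ) D.T, ∀ x₁ x₂ : E d,
    ‖D.b t x₁ - D.b t x₂‖ + ‖D.σ t x₁ - D.σ t x₂‖ ≤ L * ‖x₁ - x₂‖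
  Lf_nonneg : 0 ≤ Lf
  lipf : ∀ t₁ ∈ Set.Icc (0 : ℝ) D.T, ∀ t₂ ∈ Set.Icc (0 : ℝ) D.T,
    ∀ (x₁ x₂ : E d) (y₁ y₂ : ℝ) (z₁ z₂ : E d),
      |D.f t₁ x₁ y₁ z₁ - D.f t₂ x₂ y₂ z₂|
        ≤ Lf * (√|t₁ - t₂| + ‖x₁ - x₂‖ + |y₁ - y₂| + ‖z₁ - z₂‖)

section Grid

variable {d : ℕ} {D : FBSDE d} {N : ℕ}

lemma FBSDE.h_pos (hT : 0 < D.T) (hN : 0 < N) : 0 < D.h N :=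
  div_pos hT (by exact_mod_cast hN)

lemma FBSDE.h_nonneg (hT : 0 < D.T) (N : ℕ) : 0 ≤ D.h N := div_nonneg hT.le (Nat.cast_nonneg N)

lemma FBSDE.h_le (hT : 0 < D.T) (hN : 0 < N) : D.h N ≤ D.T :=
  div_le_self hT.le (by exact_mod_cast hN)

lemma FBSDE.nat_mul_h (hN : 0 < N) : N * D.h N = D.T :=
  mul_div_cancel₀ D.T (by positivity)

lemma FBSDE.t_mono (hT : 0 < D.T) (N : ℕ) : Monotone (D.t N) := fun i j hij =>
  mul_le_mul_of_nonneg_right (by exact_mod_cast hij) (FBSDE.h_nonneg hT N)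

lemma FBSDE.t_nonneg (hT : 0 < D.T) (N i : ℕ) : 0 ≤ D.t N i :=
  mul_nonneg (Nat.cast_nonneg i) (FBSDE.h_nonneg hT N)

lemma FBSDE.t_le (hT : 0 < D.T) (hN : 0 < N) {i : ℕ} (hi : i ≤ N) : D.t N i ≤ D.T :=
  (FBSDE.t_mono hT N hi).trans_eq (FBSDE.nat_mul_h hN)

lemma FBSDE.t_mem (hT : 0 < D.T) (hN : 0 < N) {i : ℕ} (hi : i ≤ N) :
    D.t N i ∈ Set.Icc (0 : ℝ) D.T :=
  ⟨FBSDE.t_nonneg hT N i, FBSDE.t_le hT hN hi⟩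

end Grid

lemma stronglyMeasurable_W {Ω : Type*} {d : ℕ} {W : ℝ → Ω → E d} {t s : ℝ} (hs : 0 ≤ s) (hst : s ≤ t) :
    StronglyMeasurable[natF W t] (W s) := by
  have : Measurable[natF W t] (W s) := by
    rw [measurable_iff_comap_le]
    exact le_biSup (fun s => MeasurableSpace.comap (W s) inferInstance)
      (show s ∈ Set.Icc (0 : ℝ) t from ⟨hs, hst⟩)
  exact this.stronglyMeasurable

namespace Assumptions

variable {Ω : Type*} [mΩ : MeasurableSpace Ω] {d : ℕ} {D : FBSDE d} {W : ℝ → Ω → E d}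
  {μ : Measure Ω} {L Lf : ℝ} {N : ℕ}

lemma natF_le (A : Assumptions D W μ L Lf) (hN : 0 < N) {i : ℕ} (hi : i ≤ N) :
    natF W (D.t N i) ≤ mΩ :=
  A.bm.natF_le (FBSDE.t_le A.T_pos hN hi)

lemma continuous_b (A : Assumptions D W μ L Lf) {t : ℝ} (ht : t ∈ Set.Icc (0 : ℝ) D.T) :
    Continuous (D.b t) := by
  refine (LipschitzWith.of_dist_le' (K := L) fun x y => ?_).continuous
  rw [dist_eq_norm, dist_eq_norm]
  linarith [A.lip t ht x y, norm_nonneg (D.σ t x - D.σ t y)]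

lemma continuous_sigma (A : Assumptions D W μ L Lf) {t : ℝ} (ht : t ∈ Set.Icc (0 : ℝ) D.T) :
    Continuous (D.σ t) := by
  refine (LipschitzWith.of_dist_le' (K := L) fun x y => ?_).continuous
  rw [dist_eq_norm, dist_eq_norm]
  linarith [A.lip t ht x y, norm_nonneg (D.b t x - D.b t y)]

lemma continuous_f (A : Assumptions D W μ L Lf) {t : ℝ} (ht : t ∈ Set.Icc (0 : ℝ) D.T) :
    Continuous fun p : E d × ℝ × E d => D.f t p.1 p.2.1 p.2.2 := by
  refine (LipschitzWith.of_dist_le' (K := Lf * 3) fun p q => ?_).continuous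
  have h := A.lipf t ht t ht p.1 q.1 p.2.1 q.2.1 p.2.2 q.2.2
  rw [Real.dist_eq]
  refine h.trans ?_
  rw [sub_self, abs_zero, Real.sqrt_zero, zero_add, mul_assoc]
  refine mul_le_mul_of_nonneg_left ?_ A.Lf_nonneg
  have h1 : ‖p.1 - q.1‖ ≤ dist p q := by
    rw [← dist_eq_norm]; exact le_max_left _ _
  have h2 : |p.2.1 - q.2.1| ≤ dist p q := by
    rw [← Real.dist_eq]; exact (le_max_left _ _).trans (le_max_right _ _)
  have h3 : ‖p.2.2 - q.2.2‖ ≤ dist p q := by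
    rw [← dist_eq_norm]; exact (le_max_right _ _).trans (le_max_right _ _)
  linarith

lemma stronglyMeasurable_euler (A : Assumptions D W μ L Lf) (hN : 0 < N) (i : ℕ) (hi : i ≤ N) :
    StronglyMeasurable[natF W (D.t N i)] (D.euler W N i) := by
  induction i with
  | zero => exact stronglyMeasurable_const
  | succ i ih =>
    have ht := FBSDE.t_mem A.T_pos hN (show i ≤ N by omega)
    have hmono := FBSDE.t_mono A.T_pos N (Nat.le_succ i)
    have hX := (ih (by omega)).mono (natF_mono W hmono)
    have hσ := (A.continuous_sigma ht).comp_stronglyMeasurable hX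
    have hb := (A.continuous_b ht).comp_stronglyMeasurable hX
    have hΔ := (stronglyMeasurable_W (W := W) (FBSDE.t_nonneg A.T_pos N (i + 1)) le_rfl).sub
      (stronglyMeasurable_W (W := W) (FBSDE.t_nonneg A.T_pos N i) hmono)
    have hev : Continuous fun p : (E d →L[ℝ] E d) × E d => p.1 p.2 := by fun_prop
    exact (hX.add (hb.const_smul (D.h N))).add (hev.comp_stronglyMeasurable (hσ.prodMk hΔ))

/-- Both drivers are evaluated at the same time and along the same Euler path, so only the
increments in `y` and `z` survive in the Lipschitz bound. -/
lemma abs_driver_sub_le (A : Assumptions D W μ L Lf) (hN : 0 < N) {i : ℕ} (hi : i ≤ N)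
    (y y' : Ω → ℝ) (z z' : Ω → E d) (ω : Ω) :
    |D.driver W N i y z ω - D.driver W N i y' z' ω| ≤ Lf * (|y ω - y' ω| + ‖z ω - z' ω‖) := by
  have ht := FBSDE.t_mem A.T_pos hN hi
  have h := A.lipf _ ht _ ht (D.euler W N i ω) (D.euler W N i ω) (y ω) (y' ω) (z ω) (z' ω)
  simpa [FBSDE.driver] using h

variable [IsProbabilityMeasure μ]

/-- The delicate term is the stochastic one, a product of two square integrable factors. It stays in
`𝕃₂` because `σ(t_i, X_i)` is measurable at time `t_i` and the increment is independent of that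
past, so the product of the squared norms is integrable. -/
lemma memLp_euler (A : Assumptions D W μ L Lf) (hN : 0 < N) (i : ℕ) (hi : i ≤ N) :
    MemLp (D.euler W N i) 2 μ := by
  induction i with
  | zero => exact memLp_const _
  | succ i ih =>
    have hX := ih (by omega)
    have hle := A.natF_le (W := W) (μ := μ) hN (show i ≤ N by omega)
    have ht := FBSDE.t_mem A.T_pos hN (show i ≤ N by omega)
    have hmono := FBSDE.t_mono A.T_pos N (Nat.le_succ i)
    have ht' := FBSDE.t_le A.T_pos hN hi
    have hXm := A.stronglyMeasurable_euler hN i (by omega)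
    have hlin : ∀ {F : Type _} [NormedAddCommGroup F] (g : E d → F), Continuous g →
        (∀ x y, ‖g x - g y‖ ≤ L * ‖x - y‖) → MemLp (fun ω => g (D.euler W N i ω)) 2 μ := by
      intro F _ g hg hL
      have h1 : MemLp (fun ω => g (D.euler W N i ω) - g 0) 2 μ := by
        refine hX.of_le_mul (c := L) ?_ (Filter.Eventually.of_forall fun ω => ?_)
        · exact (hg.comp_aestronglyMeasurable hX.1).sub aestronglyMeasurable_const
        · simpa using hL (D.euler W N i ω) 0
      exact (h1.add (memLp_const (g 0))).ae_eq (Filter.Eventually.of_forall fun ω => by simp)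
    have hb := hlin (D.b (D.t N i)) (A.continuous_b ht) fun x y => by
      linarith [A.lip _ ht x y, norm_nonneg (D.σ (D.t N i) x - D.σ (D.t N i) y)]
    have hσ := hlin (D.σ (D.t N i)) (A.continuous_sigma ht) fun x y => by
      linarith [A.lip _ ht x y, norm_nonneg (D.b (D.t N i) x - D.b (D.t N i) y)]
    have hΔ := A.bm.memLp_increment (FBSDE.t_nonneg A.T_pos N i) hmono ht'
    have hind := A.bm.indep _ _ (FBSDE.t_nonneg A.T_pos N i) hmono ht'
    have hσm : Measurable[natF W (D.t N i)]
        (fun ω => ‖D.σ (D.t N i) (D.euler W N i ω)‖ ^ 2) :=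
      (((A.continuous_sigma ht).comp_stronglyMeasurable hXm).norm.pow 2).measurable
    have hindep : IndepFun (fun ω => ‖D.σ (D.t N i) (D.euler W N i ω)‖ ^ 2)
        (fun ω => ‖W (D.t N (i + 1)) ω - W (D.t N i) ω‖ ^ 2) μ := by
      refine indep_of_indep_of_le_left (indep_of_indep_of_le_right hind.symm ?_) hσm.comap_le
      have : Measurable fun x : E d => ‖x‖ ^ 2 := by fun_prop
      rw [show (fun ω => ‖W (D.t N (i + 1)) ω - W (D.t N i) ω‖ ^ 2) = (fun x : E d => ‖x‖ ^ 2) ∘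
        (fun ω => W (D.t N (i + 1)) ω - W (D.t N i) ω) from rfl, ← MeasurableSpace.comap_comp]
      exact MeasurableSpace.comap_mono this.comap_le
    have hev : Continuous fun p : (E d →L[ℝ] E d) × E d => p.1 p.2 := by fun_prop
    have hprod : MemLp (fun ω => D.σ (D.t N i) (D.euler W N i ω)
        (W (D.t N (i + 1)) ω - W (D.t N i) ω)) 2 μ := by
      have hmeas : AEStronglyMeasurable (fun ω => D.σ (D.t N i) (D.euler W N i ω)
          (W (D.t N (i + 1)) ω - W (D.t N i) ω)) μ :=
        hev.comp_aestronglyMeasurable (hσ.1.prodMk hΔ.1)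
      rw [memLp_two_iff_integrable_sq_norm hmeas]
      refine (hindep.integrable_mul ((memLp_two_iff_integrable_sq_norm hσ.1).1 hσ)
        ((memLp_two_iff_integrable_sq_norm hΔ.1).1 hΔ)).mono (hmeas.norm.pow 2)
        (Filter.Eventually.of_forall fun ω => ?_)
      rw [Pi.mul_apply, ← mul_pow, norm_pow, norm_pow, norm_norm]
      gcongr
      exact (ContinuousLinearMap.le_opNorm _ _).trans (le_abs_self _)
    exact (hX.add (hb.const_smul (D.h N))).add hprod

/-- The driver maps square integrable random variables to square integrable ones. -/
lemma memLp_driver (A : Assumptions D W μ L Lf) (hN : 0 < N) {i : ℕ} (hi : i ≤ N)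
    {y : Ω → ℝ} {z : Ω → E d} (hy : MemLp y 2 μ) (hz : MemLp z 2 μ) :
    MemLp (D.driver W N i y z) 2 μ := by
  have ht := FBSDE.t_mem A.T_pos hN hi
  have hX := A.memLp_euler hN i hi
  change MemLp (fun ω => D.f (D.t N i) (D.euler W N i ω) (y ω) (z ω)) 2 μ
  generalize D.euler W N i = X at hX ⊢
  have hmeas : AEStronglyMeasurable (fun ω => D.f (D.t N i) (X ω) (y ω) (z ω)) μ :=
    (A.continuous_f ht).comp_aestronglyMeasurable (hX.1.prodMk (hy.1.prodMk hz.1))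
  have hdom : MemLp (fun ω => |D.f (D.t N i) 0 0 0| + Lf * (‖X ω‖ + ‖y ω‖ + ‖z ω‖)) 2 μ := by
    have h1 := (hX.norm.add hy.norm).add hz.norm
    have h2 := h1.const_mul Lf
    exact (memLp_const |D.f (D.t N i) 0 0 0|).add h2
  refine hdom.mono hmeas (Filter.Eventually.of_forall fun ω => ?_)
  have h := A.lipf _ ht _ ht (X ω) 0 (y ω) 0 (z ω) 0
  simp only [sub_self, abs_zero, Real.sqrt_zero, zero_add, sub_zero] at h
  refine le_trans ?_ (le_abs_self _)
  have h2 := abs_sub_abs_le_abs_sub (D.f (D.t N i) (X ω) (y ω) (z ω)) (D.f (D.t N i) 0 0 0)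
  rw [Real.norm_eq_abs, Real.norm_eq_abs]
  linarith

end Assumptions

/-! ### Error propagation in predictor and corrector -/

section SumsOfSquares

lemma sum_abs_add_sq_le {ι : Type*} (s : Finset ι) (x y : ι → ℝ) :
    (∑ j ∈ s, (x j + y j)) ^ 2 ≤ 2 * s.card * ∑ j ∈ s, (x j ^ 2 + y j ^ 2) := by
  refine (sq_sum_le_card_mul_sum_sq (s := s) (f := fun j => x j + y j)).trans ?_
  have h : ∑ j ∈ s, (x j + y j) ^ 2 ≤ 2 * ∑ j ∈ s, (x j ^ 2 + y j ^ 2) := by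
    rw [Finset.mul_sum]
    exact Finset.sum_le_sum fun j _ => by linarith [sq_nonneg (x j - y j)]
  have := mul_le_mul_of_nonneg_left h (Nat.cast_nonneg (α := ℝ) s.card)
  linarith

end SumsOfSquares

lemma condExp_sum_const_mul {Ω ι : Type*} {m mΩ : MeasurableSpace Ω} {μ : Measure Ω} (s : Finset ι)
    (c : ι → ℝ) {f : ι → Ω → ℝ} (hf : ∀ j ∈ s, Integrable (f j) μ) :
    μ[fun ω => ∑ j ∈ s, c j * f j ω | m] =ᵐ[μ] fun ω => ∑ j ∈ s, c j * μ[f j | m] ω := by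
  have h1 := condExp_finsetSum (f := fun j => c j • f j) (fun j hj => (hf j hj).smul (c j)) m
  have h2 : (∑ j ∈ s, c j • f j) = fun ω => ∑ j ∈ s, c j * f j ω := by
    funext ω; simp
  rw [h2] at h1
  have h3 : ∀ᵐ ω ∂μ, ∀ j ∈ s, μ[c j • f j | m] ω = c j * μ[f j | m] ω :=
    (Finset.eventually_all _).2 fun j _ => condExp_smul (c j) _ m
  filter_upwards [h1, h3] with ω h4 h5
  rw [h4, Finset.sum_apply]
  exact Finset.sum_congr rfl h5

namespace Assumptions

variable {Ω : Type*} [mΩ : MeasurableSpace Ω] {d : ℕ} {D : FBSDE d} {W : ℝ → Ω → E d}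
  {μ : Measure Ω} {L Lf : ℝ} {N : ℕ} {S : Coeffs}
  {Y Y' : ℕ → Ω → ℝ} {Z Z' : ℕ → Ω → E d} {i : ℕ}

lemma memLp_sum_const_mul (c : ℕ → ℝ) (hY : ∀ j ∈ Finset.Icc 1 S.m, MemLp (Y (i + j)) 2 μ) :
    MemLp (fun ω => ∑ j ∈ Finset.Icc 1 S.m, c j * Y (i + j) ω) 2 μ :=
  memLp_finsetSum _ fun j hj => (hY j hj).const_mul (c j)

variable [IsProbabilityMeasure μ]

lemma memLp_sum_driver (A : Assumptions D W μ L Lf) (hN : 0 < N) (hi : i + S.m ≤ N) (c : ℕ → ℝ)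
    (hY : ∀ j ∈ Finset.Icc 1 S.m, MemLp (Y (i + j)) 2 μ)
    (hZ : ∀ j ∈ Finset.Icc 1 S.m, MemLp (Z (i + j)) 2 μ) :
    MemLp (fun ω => ∑ j ∈ Finset.Icc 1 S.m,
      c j * D.h N * D.driver W N (i + j) (Y (i + j)) (Z (i + j)) ω) 2 μ :=
  memLp_finsetSum _ fun j hj => (A.memLp_driver hN
    (by have := (Finset.mem_Icc.1 hj).2; omega) (hY j hj) (hZ j hj)).const_mul (c j * D.h N)

lemma memLp_predictor (A : Assumptions D W μ L Lf) (hN : 0 < N) (hi : i + S.m ≤ N)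
    (hY : ∀ j ∈ Finset.Icc 1 S.m, MemLp (Y (i + j)) 2 μ)
    (hZ : ∀ j ∈ Finset.Icc 1 S.m, MemLp (Z (i + j)) 2 μ) :
    MemLp (predictor D S W μ N Y Z i) 2 μ := by
  have h1 := memLp_sum_const_mul S.α' hY
  have h2 := A.memLp_sum_driver hN hi S.γ' hY hZ
  exact (h1.add h2).condExp one_le_two

lemma memLp_corrector_arg (A : Assumptions D W μ L Lf) (hN : 0 < N) (hi : i + S.m ≤ N)
    (hY : ∀ j ∈ Finset.Icc 1 S.m, MemLp (Y (i + j)) 2 μ)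
    (hZ : ∀ j ∈ Finset.Icc 1 S.m, MemLp (Z (i + j)) 2 μ) (hZi : MemLp (Z i) 2 μ) :
    MemLp (fun ω => ∑ j ∈ Finset.Icc 1 S.m, S.α j * Y (i + j) ω
      + S.γ 0 * D.h N * D.driver W N i (predictor D S W μ N Y Z i) (Z i) ω
      + ∑ j ∈ Finset.Icc 1 S.m,
        S.γ j * D.h N * D.driver W N (i + j) (Y (i + j)) (Z (i + j)) ω) 2 μ := by
  have h1 := memLp_sum_const_mul S.α hY
  have h2 := A.memLp_sum_driver hN hi S.γ hY hZ
  have h3 := (A.memLp_driver hN (show i ≤ N by omega) (A.memLp_predictor hN hi hY hZ)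
    hZi).const_mul (S.γ 0 * D.h N)
  exact (h1.add h3).add h2

lemma memLp_corrector (A : Assumptions D W μ L Lf) (hN : 0 < N) (hi : i + S.m ≤ N)
    (hY : ∀ j ∈ Finset.Icc 1 S.m, MemLp (Y (i + j)) 2 μ)
    (hZ : ∀ j ∈ Finset.Icc 1 S.m, MemLp (Z (i + j)) 2 μ) (hZi : MemLp (Z i) 2 μ) :
    MemLp (corrector D S W μ N Y Z i) 2 μ :=
  (A.memLp_corrector_arg hN hi hY hZ hZi).condExp one_le_two

/-- The difference of two predicted values. -/
lemma integral_predictor_sub_sq_le (A : Assumptions D W μ L Lf) (hN : 0 < N) (hi : i + S.m ≤ N)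
    {c : ℝ} (hα : ∀ j ∈ Finset.Icc 1 S.m, |S.α' j| ≤ c) (hγ : ∀ j ∈ Finset.Icc 1 S.m, |S.γ' j| ≤ c)
    (hc : 0 ≤ c)
    (hY : ∀ j ∈ Finset.Icc 1 S.m, MemLp (Y (i + j)) 2 μ)
    (hZ : ∀ j ∈ Finset.Icc 1 S.m, MemLp (Z (i + j)) 2 μ)
    (hY' : ∀ j ∈ Finset.Icc 1 S.m, MemLp (Y' (i + j)) 2 μ)
    (hZ' : ∀ j ∈ Finset.Icc 1 S.m, MemLp (Z' (i + j)) 2 μ) :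
    ∫ ω, (predictor D S W μ N Y Z i ω - predictor D S W μ N Y' Z' i ω) ^ 2 ∂μ
      ≤ (c * (1 + D.T * Lf)) ^ 2 * (2 * S.m) * ∑ j ∈ Finset.Icc 1 S.m,
        (∫ ω, (Y (i + j) ω - Y' (i + j) ω) ^ 2 ∂μ + ∫ ω, ‖Z (i + j) ω - Z' (i + j) ω‖ ^ 2 ∂μ) := by
  have hg := (memLp_sum_const_mul S.α' hY).add (A.memLp_sum_driver hN hi S.γ' hY hZ)
  have hg' := (memLp_sum_const_mul S.α' hY').add (A.memLp_sum_driver hN hi S.γ' hY' hZ')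
  have hsub := condExp_sub (hg.integrable one_le_two) (hg'.integrable one_le_two)
    (natF W (D.t N i))
  have hint : ∀ j ∈ Finset.Icc 1 S.m, Integrable (fun ω => (Y (i + j) ω - Y' (i + j) ω) ^ 2
      + ‖Z (i + j) ω - Z' (i + j) ω‖ ^ 2) μ := fun j hj =>
    (((hY j hj).sub (hY' j hj)).integrable_sq).add
      (((hZ j hj).sub (hZ' j hj)).norm.integrable_sq)
  have hdrop : ∀ j ∈ Finset.Icc 1 S.m, ∫ ω, (Y (i + j) ω - Y' (i + j) ω) ^ 2 ∂μ
      + ∫ ω, ‖Z (i + j) ω - Z' (i + j) ω‖ ^ 2 ∂μ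
      = ∫ ω, ((Y (i + j) ω - Y' (i + j) ω) ^ 2 + ‖Z (i + j) ω - Z' (i + j) ω‖ ^ 2) ∂μ :=
    fun j hj => (integral_add ((hY j hj).sub (hY' j hj)).integrable_sq
      ((hZ j hj).sub (hZ' j hj)).norm.integrable_sq).symm
  rw [Finset.sum_congr rfl hdrop, ← integral_finsetSum _ hint, ← integral_const_mul]
  refine le_trans (le_of_eq (integral_congr_ae ?_)) ((integral_condExp_sq_le (m := natF W (D.t N i))
    (hg.sub hg')).trans (integral_mono (hg.sub hg').integrable_sq
      ((integrable_finsetSum _ hint).const_mul _) fun ω => ?_))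
  · filter_upwards [hsub] with ω hω
    rw [hω]
    rfl
  · have hLf := A.Lf_nonneg
    have hTp := A.T_pos
    have hh0 := FBSDE.h_nonneg A.T_pos N
    -- No power of `h` has to be gained here: the predictor enters the corrector only through `γ 0 *
    -- h * f`, so `h ≤ T` suffices.
    have hhT := FBSDE.h_le A.T_pos hN
    have habs : |∑ j ∈ Finset.Icc 1 S.m, S.α' j * Y (i + j) ω
        + ∑ j ∈ Finset.Icc 1 S.m, S.γ' j * D.h N * D.driver W N (i + j) (Y (i + j)) (Z (i + j)) ω
        - (∑ j ∈ Finset.Icc 1 S.m, S.α' j * Y' (i + j) ω + ∑ j ∈ Finset.Icc 1 S.m,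
            S.γ' j * D.h N * D.driver W N (i + j) (Y' (i + j)) (Z' (i + j)) ω)|
        ≤ c * (1 + D.T * Lf) * ∑ j ∈ Finset.Icc 1 S.m,
          (|Y (i + j) ω - Y' (i + j) ω| + ‖Z (i + j) ω - Z' (i + j) ω‖) := by
      rw [add_sub_add_comm, ← Finset.sum_sub_distrib, ← Finset.sum_sub_distrib,
        ← Finset.sum_add_distrib, Finset.mul_sum]
      refine (Finset.abs_sum_le_sum_abs _ _).trans (Finset.sum_le_sum fun j hj => ?_)
      have hd := A.abs_driver_sub_le hN (i := i + j) (by have := (Finset.mem_Icc.1 hj).2; omega)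
        (Y (i + j)) (Y' (i + j)) (Z (i + j)) (Z' (i + j)) ω
      rw [← mul_sub, ← mul_sub]
      refine (abs_add_le _ _).trans ?_
      rw [abs_mul, abs_mul, abs_mul, abs_of_nonneg hh0]
      have h1 : |S.α' j| * |Y (i + j) ω - Y' (i + j) ω|
          ≤ c * (|Y (i + j) ω - Y' (i + j) ω| + ‖Z (i + j) ω - Z' (i + j) ω‖) :=
        mul_le_mul (hα j hj) (le_add_of_nonneg_right (norm_nonneg _)) (abs_nonneg _) hc
      have h2 : |S.γ' j| * D.h N
            * |D.driver W N (i + j) (Y (i + j)) (Z (i + j)) ω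
              - D.driver W N (i + j) (Y' (i + j)) (Z' (i + j)) ω|
          ≤ c * D.T * (Lf * (|Y (i + j) ω - Y' (i + j) ω| + ‖Z (i + j) ω - Z' (i + j) ω‖)) :=
        mul_le_mul (mul_le_mul (hγ j hj) hhT hh0 hc) hd (abs_nonneg _) (by positivity)
      linarith
    change (∑ j ∈ Finset.Icc 1 S.m, S.α' j * Y (i + j) ω
        + ∑ j ∈ Finset.Icc 1 S.m, S.γ' j * D.h N * D.driver W N (i + j) (Y (i + j)) (Z (i + j)) ω
        - (∑ j ∈ Finset.Icc 1 S.m, S.α' j * Y' (i + j) ω + ∑ j ∈ Finset.Icc 1 S.m,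
            S.γ' j * D.h N * D.driver W N (i + j) (Y' (i + j)) (Z' (i + j)) ω)) ^ 2 ≤ _
    rw [← sq_abs]
    refine (pow_le_pow_left₀ (abs_nonneg _) habs 2).trans ?_
    rw [mul_pow, mul_assoc]
    refine mul_le_mul_of_nonneg_left ?_ (sq_nonneg _)
    have := sum_abs_add_sq_le (Finset.Icc 1 S.m) (fun j => |Y (i + j) ω - Y' (i + j) ω|)
      fun j => ‖Z (i + j) ω - Z' (i + j) ω‖
    simpa using this

/-- The difference of two corrected values, up to the linear part. -/
lemma exists_integral_corrector_sub_sq_le (A : Assumptions D W μ L Lf) (S : Coeffs) :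
    ∃ K : ℝ, 0 ≤ K ∧ ∀ (N : ℕ), 0 < N → ∀ (i : ℕ), i + S.m ≤ N →
      ∀ (Y Y' : ℕ → Ω → ℝ) (Z Z' : ℕ → Ω → E d),
      (∀ j ∈ Finset.Icc 1 S.m, MemLp (Y (i + j)) 2 μ) →
      (∀ j ∈ Finset.Icc 1 S.m, MemLp (Z (i + j)) 2 μ) → MemLp (Z i) 2 μ →
      (∀ j ∈ Finset.Icc 1 S.m, MemLp (Y' (i + j)) 2 μ) →
      (∀ j ∈ Finset.Icc 1 S.m, MemLp (Z' (i + j)) 2 μ) → MemLp (Z' i) 2 μ →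
      ∫ ω, (corrector D S W μ N Y Z i ω - corrector D S W μ N Y' Z' i ω
          - ∑ j ∈ Finset.Icc 1 S.m,
            S.α j * μ[fun ω => Y (i + j) ω - Y' (i + j) ω | natF W (D.t N i)] ω) ^ 2 ∂μ
        ≤ K * (D.h N ^ 2 * (∑ j ∈ Finset.Icc 1 S.m,
          (∫ ω, (Y (i + j) ω - Y' (i + j) ω) ^ 2 ∂μ + ∫ ω, ‖Z (i + j) ω - Z' (i + j) ω‖ ^ 2 ∂μ)
            + ∫ ω, ‖Z i ω - Z' i ω‖ ^ 2 ∂μ)) := by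
  obtain ⟨c, hc, hα, hγ', hγ0, hγ⟩ : ∃ c : ℝ, 0 ≤ c ∧ (∀ j ∈ Finset.Icc 1 S.m, |S.α' j| ≤ c) ∧
      (∀ j ∈ Finset.Icc 1 S.m, |S.γ' j| ≤ c) ∧ |S.γ 0| ≤ c ∧
      ∀ j ∈ Finset.Icc 1 S.m, |S.γ j| ≤ c := by
    have h0 : ∀ g : ℕ → ℝ, 0 ≤ ∑ j ∈ Finset.Icc 1 S.m, |g j| := fun g =>
      Finset.sum_nonneg fun j _ => abs_nonneg _
    have h1 : ∀ (g : ℕ → ℝ), ∀ j ∈ Finset.Icc 1 S.m, |g j| ≤ ∑ j ∈ Finset.Icc 1 S.m, |g j| :=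
      fun g j hj => Finset.single_le_sum (f := fun j => |g j|) (fun j _ => abs_nonneg _) hj
    refine ⟨∑ j ∈ Finset.Icc 1 S.m, |S.α' j| + ∑ j ∈ Finset.Icc 1 S.m, |S.γ' j| + |S.γ 0|
      + ∑ j ∈ Finset.Icc 1 S.m, |S.γ j|, ?_, ?_, ?_, ?_, ?_⟩
    · have := abs_nonneg (S.γ 0)
      linarith [h0 S.α', h0 S.γ', h0 S.γ]
    · intro j hj
      linarith [h1 S.α' j hj, h0 S.γ', h0 S.γ, abs_nonneg (S.γ 0)]
    · intro j hj
      linarith [h1 S.γ' j hj, h0 S.α', h0 S.γ, abs_nonneg (S.γ 0)]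
    · linarith [h0 S.α', h0 S.γ', h0 S.γ]
    · intro j hj
      linarith [h1 S.γ j hj, h0 S.γ', h0 S.α', abs_nonneg (S.γ 0)]
  have hLf := A.Lf_nonneg
  have hTp := A.T_pos
  set K₀ : ℝ := (c * (1 + D.T * Lf)) ^ 2 * (2 * S.m) with hK₀
  have hK₀0 : 0 ≤ K₀ := by positivity
  refine ⟨(c * Lf) ^ 2 * (3 * (K₀ + 2 * S.m + 1)), by positivity, ?_⟩
  intro N hN i hi Y Y' Z Z' hY hZ hZi hY' hZ' hZi'
  have hh0 := FBSDE.h_nonneg A.T_pos N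
  have hP := A.memLp_predictor hN hi hY hZ
  have hP' := A.memLp_predictor hN hi hY' hZ'
  have hG := A.memLp_corrector_arg hN hi hY hZ hZi
  have hG' := A.memLp_corrector_arg hN hi hY' hZ' hZi'
  have hpred := A.integral_predictor_sub_sq_le hN hi hα hγ' hc hY hZ hY' hZ'
  rw [← hK₀] at hpred
  set p := predictor D S W μ N Y Z i with hp
  set p' := predictor D S W μ N Y' Z' i with hp'
  -- the nonlinear part of the difference
  set g : Ω → ℝ := fun ω =>
    S.γ 0 * D.h N * (D.driver W N i p (Z i) ω - D.driver W N i p' (Z' i) ω)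
      + ∑ j ∈ Finset.Icc 1 S.m, S.γ j * D.h N *
        (D.driver W N (i + j) (Y (i + j)) (Z (i + j)) ω
          - D.driver W N (i + j) (Y' (i + j)) (Z' (i + j)) ω) with hg
  have hδ : ∀ j ∈ Finset.Icc 1 S.m, MemLp (fun ω => Y (i + j) ω - Y' (i + j) ω) 2 μ :=
    fun j hj => (hY j hj).sub (hY' j hj)
  have hδZ : ∀ j ∈ Finset.Icc 1 S.m, MemLp (fun ω => Z (i + j) ω - Z' (i + j) ω) 2 μ :=
    fun j hj => (hZ j hj).sub (hZ' j hj)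
  have hlin : MemLp (fun ω => ∑ j ∈ Finset.Icc 1 S.m, S.α j * (Y (i + j) ω - Y' (i + j) ω)) 2 μ :=
    memLp_finsetSum _ fun j hj => (hδ j hj).const_mul (S.α j)
  have hgm : MemLp g 2 μ := by
    have h1 := (A.memLp_driver hN (show i ≤ N by omega) hP hZi).sub
      (A.memLp_driver hN (show i ≤ N by omega) hP' hZi')
    have h2 : MemLp (fun ω => ∑ j ∈ Finset.Icc 1 S.m, S.γ j * D.h N *
        (D.driver W N (i + j) (Y (i + j)) (Z (i + j)) ω
          - D.driver W N (i + j) (Y' (i + j)) (Z' (i + j)) ω)) 2 μ :=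
      memLp_finsetSum _ fun j hj => by
        have hj' : i + j ≤ N := by have := (Finset.mem_Icc.1 hj).2; omega
        exact ((A.memLp_driver hN hj' (hY j hj) (hZ j hj)).sub
          (A.memLp_driver hN hj' (hY' j hj) (hZ' j hj))).const_mul _
    exact (h1.const_mul (S.γ 0 * D.h N)).add h2
  -- By linearity, subtracting `∑ α_j 𝔼_i[Y_{i+j} - Y'_{i+j}]` removes the linear part of the
  -- correctors and leaves the conditional expectation of the driver part `g`, which carries a
  -- factor `h`.
  have hae : (fun ω => corrector D S W μ N Y Z i ω - corrector D S W μ N Y' Z' i ω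
      - ∑ j ∈ Finset.Icc 1 S.m,
        S.α j * μ[fun ω => Y (i + j) ω - Y' (i + j) ω | natF W (D.t N i)] ω)
      =ᵐ[μ] μ[g | natF W (D.t N i)] := by
    have h1 := condExp_sub (hG.integrable one_le_two) (hG'.integrable one_le_two)
      (natF W (D.t N i))
    have h2 := condExp_sum_const_mul (m := natF W (D.t N i)) (Finset.Icc 1 S.m) S.α
      fun j hj => (hδ j hj).integrable one_le_two
    have h3 := condExp_sub ((hG.sub hG').integrable one_le_two) (hlin.integrable one_le_two)
      (natF W (D.t N i))
    refine Filter.EventuallyEq.trans ?_ (h3.symm.trans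
      (condExp_congr_ae (Filter.Eventually.of_forall fun ω => ?_)))
    · filter_upwards [h1, h2] with ω k1 k2
      rw [Pi.sub_apply, k1, k2]
      rfl
    · simp only [hg, Pi.sub_apply, mul_sub, Finset.sum_sub_distrib]
      ring
  have hint : ∀ j ∈ Finset.Icc 1 S.m, Integrable (fun ω => (Y (i + j) ω - Y' (i + j) ω) ^ 2
      + ‖Z (i + j) ω - Z' (i + j) ω‖ ^ 2) μ := fun j hj =>
    (hδ j hj).integrable_sq.add (hδZ j hj).norm.integrable_sq
  have hdrop : ∀ j ∈ Finset.Icc 1 S.m, ∫ ω, (Y (i + j) ω - Y' (i + j) ω) ^ 2 ∂μ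
      + ∫ ω, ‖Z (i + j) ω - Z' (i + j) ω‖ ^ 2 ∂μ
      = ∫ ω, ((Y (i + j) ω - Y' (i + j) ω) ^ 2 + ‖Z (i + j) ω - Z' (i + j) ω‖ ^ 2) ∂μ :=
    fun j hj => (integral_add (hδ j hj).integrable_sq (hδZ j hj).norm.integrable_sq).symm
  rw [Finset.sum_congr rfl hdrop, ← integral_finsetSum _ hint] at hpred ⊢
  set V : Ω → ℝ := fun ω => ∑ j ∈ Finset.Icc 1 S.m,
    ((Y (i + j) ω - Y' (i + j) ω) ^ 2 + ‖Z (i + j) ω - Z' (i + j) ω‖ ^ 2) with hV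
  have hVint : Integrable V μ := integrable_finsetSum _ hint
  have hpint : Integrable (fun ω => (p ω - p' ω) ^ 2) μ := (hP.sub hP').integrable_sq
  have hZint : Integrable (fun ω => ‖Z i ω - Z' i ω‖ ^ 2) μ := (hZi.sub hZi').norm.integrable_sq
  have hpz : Integrable (fun ω => (p ω - p' ω) ^ 2 + ‖Z i ω - Z' i ω‖ ^ 2) μ := hpint.add hZint
  have hgle : ∀ ω, g ω ^ 2 ≤ (c * Lf * D.h N) ^ 2 * 3 *
      ((p ω - p' ω) ^ 2 + ‖Z i ω - Z' i ω‖ ^ 2 + 2 * S.m * V ω) := fun ω => by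
    set Q := ∑ j ∈ Finset.Icc 1 S.m,
      (|Y (i + j) ω - Y' (i + j) ω| + ‖Z (i + j) ω - Z' (i + j) ω‖) with hQ
    have habs : |g ω| ≤ c * Lf * D.h N * (|p ω - p' ω| + ‖Z i ω - Z' i ω‖ + Q) := by
      rw [mul_add _ _ Q, hQ, Finset.mul_sum]
      refine (abs_add_le _ _).trans (add_le_add ?_ ((Finset.abs_sum_le_sum_abs _ _).trans
        (Finset.sum_le_sum fun j hj => ?_)))
      · have hd := A.abs_driver_sub_le hN (show i ≤ N by omega) p p' (Z i) (Z' i) ω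
        rw [abs_mul, abs_mul, abs_of_nonneg hh0]
        have := mul_le_mul (mul_le_mul_of_nonneg_right hγ0 hh0) hd (abs_nonneg _) (by positivity)
        linarith
      · have hd := A.abs_driver_sub_le hN (i := i + j)
          (by have := (Finset.mem_Icc.1 hj).2; omega) (Y (i + j)) (Y' (i + j)) (Z (i + j))
          (Z' (i + j)) ω
        rw [abs_mul, abs_mul, abs_of_nonneg hh0]
        have := mul_le_mul (mul_le_mul_of_nonneg_right (hγ j hj) hh0) hd (abs_nonneg _)
          (by positivity)
        linarith
    have hQ2 : Q ^ 2 ≤ 2 * S.m * V ω := by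
      have := sum_abs_add_sq_le (Finset.Icc 1 S.m) (fun j => |Y (i + j) ω - Y' (i + j) ω|)
        fun j => ‖Z (i + j) ω - Z' (i + j) ω‖
      simpa using this
    have h3 : (|p ω - p' ω| + ‖Z i ω - Z' i ω‖ + Q) ^ 2
        ≤ 3 * ((p ω - p' ω) ^ 2 + ‖Z i ω - Z' i ω‖ ^ 2 + 2 * S.m * V ω) := by
      rw [← sq_abs (p ω - p' ω)]
      nlinarith [sq_nonneg (|p ω - p' ω| - ‖Z i ω - Z' i ω‖), sq_nonneg (|p ω - p' ω| - Q),
        sq_nonneg (‖Z i ω - Z' i ω‖ - Q)]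
    rw [← sq_abs (g ω)]
    refine (pow_le_pow_left₀ (abs_nonneg _) habs 2).trans ?_
    rw [mul_pow, mul_assoc ((c * Lf * D.h N) ^ 2)]
    exact mul_le_mul_of_nonneg_left h3 (sq_nonneg _)
  have hV0 : 0 ≤ ∫ ω, V ω ∂μ := integral_nonneg fun ω =>
    Finset.sum_nonneg fun j _ => by positivity
  have hZ0 : 0 ≤ ∫ ω, ‖Z i ω - Z' i ω‖ ^ 2 ∂μ := integral_nonneg fun ω => by positivity
  calc ∫ ω, (corrector D S W μ N Y Z i ω - corrector D S W μ N Y' Z' i ω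
          - ∑ j ∈ Finset.Icc 1 S.m,
            S.α j * μ[fun ω => Y (i + j) ω - Y' (i + j) ω | natF W (D.t N i)] ω) ^ 2 ∂μ
      = ∫ ω, (μ[g | natF W (D.t N i)] ω) ^ 2 ∂μ := by
        refine integral_congr_ae ?_
        filter_upwards [hae] with ω hω
        rw [← hω]
    _ ≤ ∫ ω, g ω ^ 2 ∂μ := integral_condExp_sq_le hgm
    _ ≤ ∫ ω, (c * Lf * D.h N) ^ 2 * 3 *
          ((p ω - p' ω) ^ 2 + ‖Z i ω - Z' i ω‖ ^ 2 + 2 * S.m * V ω) ∂μ :=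
        integral_mono hgm.integrable_sq
          ((hpz.add (hVint.const_mul _)).const_mul _) hgle
    _ = (c * Lf * D.h N) ^ 2 * 3 * (∫ ω, (p ω - p' ω) ^ 2 ∂μ + ∫ ω, ‖Z i ω - Z' i ω‖ ^ 2 ∂μ
          + 2 * S.m * ∫ ω, V ω ∂μ) := by
        rw [integral_const_mul, integral_add hpz (hVint.const_mul _),
          integral_add hpint hZint, integral_const_mul]
    _ ≤ (c * Lf * D.h N) ^ 2 * 3 * ((K₀ + 2 * S.m + 1) * (∫ ω, V ω ∂μ
          + ∫ ω, ‖Z i ω - Z' i ω‖ ^ 2 ∂μ)) := by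
        refine mul_le_mul_of_nonneg_left ?_ (by positivity)
        have : 0 ≤ (K₀ + 2 * S.m) * ∫ ω, ‖Z i ω - Z' i ω‖ ^ 2 ∂μ := by positivity
        linarith
    _ = _ := by ring

end Assumptions

/-! ### Error propagation in the `Z` recursion -/

lemma norm_sum_sq_le {ι F : Type*} [SeminormedAddCommGroup F] (s : Finset ι) (x : ι → F) :
    ‖∑ j ∈ s, x j‖ ^ 2 ≤ s.card * ∑ j ∈ s, ‖x j‖ ^ 2 :=
  (pow_le_pow_left₀ (norm_nonneg _) (norm_sum_le _ _) 2).trans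
    (sq_sum_le_card_mul_sum_sq (s := s) (f := fun j => ‖x j‖))

/-- Conditional centering commutes with scaling. This pulls the square of the weight `λ_{m,j}` out
of the conditional variance. -/
lemma integral_smul_center_sq {Ω : Type*} {m mΩ : MeasurableSpace Ω} {μ : Measure Ω} (c : ℝ)
    (ξ : Ω → ℝ) :
    ∫ ω, (c * ξ ω - μ[fun ω => c * ξ ω | m] ω) ^ 2 ∂μ
      = c ^ 2 * ∫ ω, (ξ ω - μ[ξ | m] ω) ^ 2 ∂μ := by
  rw [← integral_const_mul]
  refine integral_congr_ae ?_
  have h : μ[fun ω => c * ξ ω | m] =ᵐ[μ] c • μ[ξ | m] := condExp_smul c ξ m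
  filter_upwards [h] with ω hω
  rw [hω, Pi.smul_apply, smul_eq_mul]
  ring

/-- The weights `h λ_{m,n}` do not depend on `h`. -/
lemma exists_lam_eq (m : ℕ) : ∃ (l : ℕ → ℝ) (K : ℝ), 0 ≤ K ∧ (∀ h n, lam m h n = h⁻¹ * l n) ∧
    ∀ n ∈ Finset.Icc 1 m, l n ^ 2 ≤ K := by
  refine ⟨fun n => (Polynomial.derivative
    (Lagrange.basis (Finset.range (m + 1)) (fun k : ℕ => (k : ℝ)) n)).eval 0,
    ∑ n ∈ Finset.Icc 1 m, ((Polynomial.derivative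
      (Lagrange.basis (Finset.range (m + 1)) (fun k : ℕ => (k : ℝ)) n)).eval 0) ^ 2,
    Finset.sum_nonneg fun n _ => sq_nonneg _, fun h n => rfl, fun n hn => ?_⟩
  exact Finset.single_le_sum (f := fun n => ((Polynomial.derivative
      (Lagrange.basis (Finset.range (m + 1)) (fun k : ℕ => (k : ℝ)) n)).eval 0) ^ 2)
    (fun n _ => sq_nonneg _) hn

namespace Assumptions

variable {Ω : Type*} [mΩ : MeasurableSpace Ω] {d : ℕ} {D : FBSDE d} {W : ℝ → Ω → E d}
  {μ : Measure Ω} {L Lf : ℝ} {N : ℕ} {S : Coeffs}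
  {Y Y' : ℕ → Ω → ℝ} {Z Z' : ℕ → Ω → E d} {i : ℕ}

lemma integrable_zStep_arg (A : Assumptions D W μ L Lf) (hN : 0 < N) (hi : i + S.m ≤ N)
    (hY : ∀ j ∈ Finset.Icc 1 S.m, MemLp (Y (i + j)) 2 μ) :
    ∀ j ∈ Finset.Icc 1 S.m, Integrable (fun ω => (lam S.m (D.h N) j * Y (i + j) ω) •
      (W (D.t N (i + j)) ω - W (D.t N i) ω)) μ := fun j hj => by
  have hj' : i + j ≤ N := by have := (Finset.mem_Icc.1 hj).2; omega
  have h1 := A.bm.memLp_increment (FBSDE.t_nonneg A.T_pos N i)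
    (FBSDE.t_mono A.T_pos N (Nat.le_add_right i j)) (FBSDE.t_le A.T_pos hN hj')
  exact memLp_one_iff_integrable.1 (h1.smul ((hY j hj).const_mul (lam S.m (D.h N) j)))

lemma zStep_ae_eq_sum (A : Assumptions D W μ L Lf) (hN : 0 < N) (hi : i + S.m ≤ N)
    (hY : ∀ j ∈ Finset.Icc 1 S.m, MemLp (Y (i + j)) 2 μ) :
    zStep D S W μ N Y i =ᵐ[μ] fun ω => ∑ j ∈ Finset.Icc 1 S.m,
      μ[fun ω => (lam S.m (D.h N) j * Y (i + j) ω) • (W (D.t N (i + j)) ω - W (D.t N i) ω) |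
        natF W (D.t N i)] ω := by
  have h := condExp_finsetSum (A.integrable_zStep_arg hN hi hY) (natF W (D.t N i))
  rw [zStep]
  convert h using 1
  · congr 1
    funext ω
    rw [Finset.sum_apply]
  · funext ω
    rw [Finset.sum_apply]

lemma zStep_sub (A : Assumptions D W μ L Lf) (hN : 0 < N) (hi : i + S.m ≤ N)
    (hY : ∀ j ∈ Finset.Icc 1 S.m, MemLp (Y (i + j)) 2 μ)
    (hY' : ∀ j ∈ Finset.Icc 1 S.m, MemLp (Y' (i + j)) 2 μ) :
    zStep D S W μ N (fun k ω => Y k ω - Y' k ω) i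
      =ᵐ[μ] fun ω => zStep D S W μ N Y i ω - zStep D S W μ N Y' i ω := by
  have h := condExp_sub (integrable_finsetSum _ (A.integrable_zStep_arg hN hi hY))
    (integrable_finsetSum _ (A.integrable_zStep_arg hN hi hY')) (natF W (D.t N i))
  refine Filter.EventuallyEq.trans (condExp_congr_ae (Filter.Eventually.of_forall fun ω => ?_)) h
  simp only [Pi.sub_apply, mul_sub, sub_smul, Finset.sum_sub_distrib]

variable [IsProbabilityMeasure μ]

/-- Integrability and `𝕃₂` bound for the summands of `zStep`. -/
lemma memLp_zStep_summand (A : Assumptions D W μ L Lf) (hN : 0 < N) {j : ℕ} (hj : i + j ≤ N)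
    {ξ : Ω → ℝ} (hξ : MemLp ξ 2 μ) :
    MemLp (μ[fun ω => ξ ω • (W (D.t N (i + j)) ω - W (D.t N i) ω) | natF W (D.t N i)]) 2 μ ∧
      ∫ ω, ‖μ[fun ω => ξ ω • (W (D.t N (i + j)) ω - W (D.t N i) ω) | natF W (D.t N i)] ω‖ ^ 2 ∂μ
        ≤ d * (j * D.h N) * ∫ ω, (ξ ω - μ[ξ | natF W (D.t N i)] ω) ^ 2 ∂μ := by
  have h0 := FBSDE.t_nonneg A.T_pos N i
  have hmono := FBSDE.t_mono A.T_pos N (Nat.le_add_right i j)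
  have hle := FBSDE.t_le A.T_pos hN hj
  have hF := A.natF_le (W := W) (μ := μ) hN (show i ≤ N by omega)
  have hG := A.bm.memLp_increment h0 hmono hle
  have hGm := A.bm.measurable_increment h0 hmono hle
  have hind := A.bm.indep _ _ h0 hmono hle
  have hG2 := A.bm.integral_norm_increment_sq h0 hmono hle
  have hξ' : MemLp (fun ω => ξ ω - μ[ξ | natF W (D.t N i)] ω) 2 μ :=
    hξ.sub (hξ.condExp one_le_two)
  refine ⟨(memLp_condExp_smul_of_indep hF hξ hG hGm hind).1, ?_⟩
  -- Centering `ξ` costs nothing because the increment has conditional mean zero. It replaces the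
  -- second moment of `ξ` by its conditional variance, the quantity the energy estimate can absorb.
  have hc := condExp_smul_center hF hξ hG hGm hind (A.bm.integral_increment h0 hmono hle)
  have hb := (memLp_condExp_smul_of_indep hF hξ' hG hGm hind).2
  rw [hG2, show D.t N (i + j) - D.t N i = j * D.h N by simp only [FBSDE.t]; push_cast; ring] at hb
  refine le_trans (le_of_eq (integral_congr_ae ?_)) hb
  filter_upwards [hc] with ω hω
  rw [hω]

lemma memLp_zStep (A : Assumptions D W μ L Lf) (hN : 0 < N) (hi : i + S.m ≤ N)
    (hY : ∀ j ∈ Finset.Icc 1 S.m, MemLp (Y (i + j)) 2 μ) : MemLp (zStep D S W μ N Y i) 2 μ := by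
  refine (memLp_congr_ae (A.zStep_ae_eq_sum hN hi hY)).2 (memLp_finsetSum _ fun j hj => ?_)
  exact (A.memLp_zStep_summand hN (by have := (Finset.mem_Icc.1 hj).2; omega)
    ((hY j hj).const_mul _)).1

/-- `zStep` is controlled by the conditional variances of its arguments. -/
lemma exists_integral_zStep_sub_sq_le (A : Assumptions D W μ L Lf) (S : Coeffs) :
    ∃ K : ℝ, 0 ≤ K ∧ ∀ (N : ℕ), 0 < N → ∀ (i : ℕ), i + S.m ≤ N → ∀ (Y Y' : ℕ → Ω → ℝ),
      (∀ j ∈ Finset.Icc 1 S.m, MemLp (Y (i + j)) 2 μ) →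
      (∀ j ∈ Finset.Icc 1 S.m, MemLp (Y' (i + j)) 2 μ) →
      D.h N * ∫ ω, ‖zStep D S W μ N Y i ω - zStep D S W μ N Y' i ω‖ ^ 2 ∂μ
        ≤ K * ∑ j ∈ Finset.Icc 1 S.m, ∫ ω, (Y (i + j) ω - Y' (i + j) ω
          - μ[fun ω => Y (i + j) ω - Y' (i + j) ω | natF W (D.t N i)] ω) ^ 2 ∂μ := by
  obtain ⟨l, K, hK, hl, hlK⟩ := exists_lam_eq S.m
  refine ⟨S.m * (K * (d * S.m)), by positivity, ?_⟩
  intro N hN i hi Y Y' hY hY'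
  have hh := FBSDE.h_pos A.T_pos hN
  have hδ : ∀ j ∈ Finset.Icc 1 S.m, MemLp (fun ω => Y (i + j) ω - Y' (i + j) ω) 2 μ :=
    fun j hj => (hY j hj).sub (hY' j hj)
  have hsub := A.zStep_sub hN hi hY hY'
  have hsum := A.zStep_ae_eq_sum (Y := fun k ω => Y k ω - Y' k ω) hN hi hδ
  have hj' : ∀ j ∈ Finset.Icc 1 S.m, i + j ≤ N := fun j hj => by
    have := (Finset.mem_Icc.1 hj).2; omega
  have hbd := fun j (hj : j ∈ Finset.Icc 1 S.m) => A.memLp_zStep_summand (i := i) hN (hj' j hj)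
    ((hδ j hj).const_mul (lam S.m (D.h N) j))
  set v : ℕ → Ω → E d := fun j => μ[fun ω => (lam S.m (D.h N) j * (Y (i + j) ω - Y' (i + j) ω)) •
    (W (D.t N (i + j)) ω - W (D.t N i) ω) | natF W (D.t N i)] with hv
  have hint : ∀ j ∈ Finset.Icc 1 S.m, Integrable (fun ω => ‖v j ω‖ ^ 2) μ :=
    fun j hj => (hbd j hj).1.norm.integrable_sq
  have h1 : ∫ ω, ‖zStep D S W μ N Y i ω - zStep D S W μ N Y' i ω‖ ^ 2 ∂μ
      ≤ S.m * ∑ j ∈ Finset.Icc 1 S.m, ∫ ω, ‖v j ω‖ ^ 2 ∂μ := by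
    calc ∫ ω, ‖zStep D S W μ N Y i ω - zStep D S W μ N Y' i ω‖ ^ 2 ∂μ
        = ∫ ω, ‖∑ j ∈ Finset.Icc 1 S.m, v j ω‖ ^ 2 ∂μ := by
          refine integral_congr_ae ?_
          filter_upwards [hsub, hsum] with ω h1 h2
          rw [← h1, h2]
      _ ≤ ∫ ω, S.m * ∑ j ∈ Finset.Icc 1 S.m, ‖v j ω‖ ^ 2 ∂μ := by
          refine integral_mono
            (memLp_finsetSum (Finset.Icc 1 S.m) fun j hj => (hbd j hj).1).norm.integrable_sq
            ((integrable_finsetSum _ hint).const_mul _) fun ω => ?_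
          simpa using norm_sum_sq_le (Finset.Icc 1 S.m) fun j => v j ω
      _ = _ := by rw [integral_const_mul, integral_finsetSum _ hint]
  have h2 : ∀ j ∈ Finset.Icc 1 S.m, D.h N * ∫ ω, ‖v j ω‖ ^ 2 ∂μ
      ≤ K * (d * S.m) * ∫ ω, (Y (i + j) ω - Y' (i + j) ω
          - μ[fun ω => Y (i + j) ω - Y' (i + j) ω | natF W (D.t N i)] ω) ^ 2 ∂μ := fun j hj => by
    have h3 := (hbd j hj).2
    rw [integral_smul_center_sq (lam S.m (D.h N) j)] at h3
    set I := ∫ ω, (Y (i + j) ω - Y' (i + j) ω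
          - μ[fun ω => Y (i + j) ω - Y' (i + j) ω | natF W (D.t N i)] ω) ^ 2 ∂μ with hI
    have hI0 : 0 ≤ I := integral_nonneg fun ω => sq_nonneg _
    have hjm : (j : ℝ) ≤ S.m := by exact_mod_cast (Finset.mem_Icc.1 hj).2
    calc D.h N * ∫ ω, ‖v j ω‖ ^ 2 ∂μ
        ≤ D.h N * (d * (j * D.h N) * (lam S.m (D.h N) j ^ 2 * I)) := by gcongr
      -- All powers of `h` cancel: one from the left side, one from the variance of the increment,
      -- and `h⁻²` from the squared weight.
      _ = l j ^ 2 * (d * j) * I := by rw [hl]; field_simp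
      _ ≤ K * (d * S.m) * I := by
        have := hlK j hj
        gcongr
  calc D.h N * ∫ ω, ‖zStep D S W μ N Y i ω - zStep D S W μ N Y' i ω‖ ^ 2 ∂μ
      ≤ D.h N * (S.m * ∑ j ∈ Finset.Icc 1 S.m, ∫ ω, ‖v j ω‖ ^ 2 ∂μ) := by gcongr
    _ = S.m * ∑ j ∈ Finset.Icc 1 S.m, D.h N * ∫ ω, ‖v j ω‖ ^ 2 ∂μ := by
        rw [← Finset.mul_sum]; ring
    _ ≤ S.m * ∑ j ∈ Finset.Icc 1 S.m, K * (d * S.m) * ∫ ω, (Y (i + j) ω - Y' (i + j) ω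
          - μ[fun ω => Y (i + j) ω - Y' (i + j) ω | natF W (D.t N i)] ω) ^ 2 ∂μ := by
        exact mul_le_mul_of_nonneg_left (Finset.sum_le_sum h2) (Nat.cast_nonneg _)
    _ = _ := by rw [← Finset.mul_sum]; ring

/-- Solutions of the perturbed scheme are adapted and square integrable. -/
lemma inL2_of_isPerturbedSolution (A : Assumptions D W μ L Lf) (hN : 0 < N)
    {εY : ℕ → Ω → ℝ} {εZ : ℕ → Ω → E d}
    (hε : ∀ i, i + S.m ≤ N →
      InL2 μ (natF W (D.t N i)) (εY i) ∧ InL2 μ (natF W (D.t N i)) (εZ i))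
    (hsol : IsPerturbedSolution D S W μ N εY εZ Y Z) (k : ℕ) (hk : k ≤ N) :
    InL2 μ (natF W (D.t N k)) (Y k) ∧ InL2 μ (natF W (D.t N k)) (Z k) := by
  induction hn : N - k using Nat.strong_induction_on generalizing k with
  | _ n ih =>
    rcases lt_or_ge N (k + S.m) with h | h
    · exact ⟨hsol.startY k h hk, hsol.startZ k h hk⟩
    · have hprev : ∀ j ∈ Finset.Icc 1 S.m, MemLp (Y (k + j)) 2 μ ∧ MemLp (Z (k + j)) 2 μ :=
        fun j hj => by
          obtain ⟨hj1, hj2⟩ := Finset.mem_Icc.1 hj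
          have := ih (N - (k + j)) (by omega) (k + j) (by omega) rfl
          exact ⟨this.1.2, this.2.2⟩
      obtain ⟨hεY, hεZ⟩ := hε k h
      -- `Z k` comes before `Y k`, because the corrector evaluates the driver at `Z k`.
      have hZ : InL2 μ (natF W (D.t N k)) (Z k) := by
        have hz := A.memLp_zStep hN h fun j hj => (hprev j hj).1
        exact ⟨(stronglyMeasurable_condExp.aestronglyMeasurable.add hεZ.1).congr
          (hsol.stepZ k h).symm, (memLp_congr_ae (hsol.stepZ k h)).2 (hz.add hεZ.2)⟩
      refine ⟨?_, hZ⟩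
      have hy := A.memLp_corrector hN h (fun j hj => (hprev j hj).1) (fun j hj => (hprev j hj).2)
        hZ.2
      exact ⟨(stronglyMeasurable_condExp.aestronglyMeasurable.add hεY.1).congr
          (hsol.stepY k h).symm, (memLp_congr_ae (hsol.stepY k h)).2 (hy.add hεY.2)⟩

end Assumptions

lemma inL2_const {Ω F : Type*} (ℱ : MeasurableSpace Ω) [MeasurableSpace Ω] (μ : Measure Ω)
    [IsFiniteMeasure μ] [NormedAddCommGroup F] (c : F) : InL2 μ ℱ (fun _ => c) :=
  ⟨stronglyMeasurable_const.aestronglyMeasurable, memLp_const c⟩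

/-! ### Complex `𝕃₂` and conditional expectation as orthogonal projection -/

section ToL2

variable {Ω : Type*} {mΩ : MeasurableSpace Ω} {μ : Measure Ω}

open Classical in
/-- The class of `X` in the complex `𝕃₂` space, `0` if `X` is not square integrable. -/
def toL2 (μ : Measure Ω) (X : Ω → ℝ) : Lp ℂ 2 μ :=
  if h : MemLp X 2 μ then h.ofReal.toLp else 0

lemma toL2_of_memLp {X : Ω → ℝ} (hX : MemLp X 2 μ) : toL2 μ X = hX.ofReal.toLp :=
  dif_pos hX

lemma norm_toL2_sq {X : Ω → ℝ} (hX : MemLp X 2 μ) : ‖toL2 μ X‖ ^ 2 = ∫ ω, X ω ^ 2 ∂μ := by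
  have hint : 0 ≤ ∫ ω, X ω ^ 2 ∂μ := integral_nonneg fun ω => sq_nonneg _
  rw [toL2_of_memLp hX, Lp.norm_toLp, (hX.ofReal (K := ℂ)).eLpNorm_eq_integral_rpow_norm
    (by norm_num) (by norm_num), ENNReal.toReal_ofReal (by positivity)]
  simp only [ENNReal.toReal_ofNat, Real.rpow_ofNat, RCLike.norm_ofReal, sq_abs]
  rw [← Real.rpow_natCast, ← Real.rpow_mul hint]
  simp

lemma toL2_congr {X X' : Ω → ℝ} (hX : MemLp X 2 μ) (h : X =ᵐ[μ] X') : toL2 μ X = toL2 μ X' := by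
  have hX' := (memLp_congr_ae h).1 hX
  rw [toL2_of_memLp hX, toL2_of_memLp hX']
  refine MemLp.toLp_congr _ _ ?_
  filter_upwards [h] with ω hω
  rw [hω]

lemma toL2_sub {X X' : Ω → ℝ} (hX : MemLp X 2 μ) (hX' : MemLp X' 2 μ) :
    toL2 μ (fun ω => X ω - X' ω) = toL2 μ X - toL2 μ X' := by
  rw [toL2_of_memLp hX, toL2_of_memLp hX',
    toL2_of_memLp (X := fun ω => X ω - X' ω) (hX.sub hX'), ← MemLp.toLp_sub]
  exact MemLp.toLp_congr _ _ (Filter.Eventually.of_forall fun ω => by simp)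

lemma toL2_const_mul {X : Ω → ℝ} (c : ℝ) (hX : MemLp X 2 μ) :
    toL2 μ (fun ω => c * X ω) = (c : ℂ) • toL2 μ X := by
  rw [toL2_of_memLp hX, toL2_of_memLp (hX.const_mul c), ← MemLp.toLp_const_smul]
  exact MemLp.toLp_congr _ _ (Filter.Eventually.of_forall fun ω => by simp)

lemma toL2_add {X X' : Ω → ℝ} (hX : MemLp X 2 μ) (hX' : MemLp X' 2 μ) :
    toL2 μ (fun ω => X ω + X' ω) = toL2 μ X + toL2 μ X' := by
  rw [toL2_of_memLp hX, toL2_of_memLp hX',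
    toL2_of_memLp (X := fun ω => X ω + X' ω) (hX.add hX'), ← MemLp.toLp_add]
  exact MemLp.toLp_congr _ _ (Filter.Eventually.of_forall fun ω => by simp)

lemma toL2_sum_const_mul {ι : Type*} (s : Finset ι) (c : ι → ℝ) {X : ι → Ω → ℝ}
    (hX : ∀ j ∈ s, MemLp (X j) 2 μ) :
    toL2 μ (fun ω => ∑ j ∈ s, c j * X j ω) = ∑ j ∈ s, (c j : ℂ) • toL2 μ (X j) := by
  classical
  induction s using Finset.induction_on with
  | empty =>
    have h := toL2_const_mul (μ := μ) (X := fun _ => 0) 0 MemLp.zero'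
    simpa using h
  | insert j s hj ih =>
    have h1 := hX j (Finset.mem_insert_self j s)
    have h2 : ∀ k ∈ s, MemLp (X k) 2 μ := fun k hk => hX k (Finset.mem_insert_of_mem hk)
    have h3 : MemLp (fun ω => ∑ k ∈ s, c k * X k ω) 2 μ :=
      memLp_finsetSum _ fun k hk => (h2 k hk).const_mul (c k)
    rw [Finset.sum_insert hj, ← ih h2, ← toL2_const_mul _ h1, ← toL2_add (h1.const_mul _) h3]
    simp only [Finset.sum_insert hj]

end ToL2

section CondProj

open Classical in
/-- The orthogonal projection onto the `m`-measurable functions in `𝕃₂`, the identity if `m` is not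
a sub-`σ`-algebra. -/
def condProj {Ω : Type*} (m : MeasurableSpace Ω) {mΩ : MeasurableSpace Ω} (μ : Measure Ω) :
    Lp ℂ 2 μ →L[ℂ] Lp ℂ 2 μ :=
  if h : m ≤ mΩ then
    haveI : Fact (m ≤ mΩ) := ⟨h⟩
    (lpMeas ℂ ℂ m 2 μ).starProjection
  else ContinuousLinearMap.id ℂ _

/-- The default value, the identity, satisfies Pythagoras as well. The abstract bound asks for it at
every index, also beyond `N`, where `natF` need not be a sub-`σ`-algebra. -/
lemma norm_condProj_sq_add {Ω : Type*} (m : MeasurableSpace Ω) {mΩ : MeasurableSpace Ω}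
    {μ : Measure Ω} (x : Lp ℂ 2 μ) :
    ‖condProj m μ x‖ ^ 2 + ‖x - condProj m μ x‖ ^ 2 = ‖x‖ ^ 2 := by
  by_cases h : m ≤ mΩ
  · have : Fact (m ≤ mΩ) := ⟨h⟩
    rw [condProj, dif_pos h, (lpMeas ℂ ℂ m 2 μ).norm_sq_eq_add_norm_sq_starProjection x,
      Submodule.starProjection_orthogonal_val]
  · simp [condProj, h]

lemma condProj_condProj_of_le {Ω : Type*} {m₁ m₂ mΩ : MeasurableSpace Ω} {μ : Measure Ω}
    (h : m₁ ≤ m₂) (x : Lp ℂ 2 μ) :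
    condProj m₁ μ (condProj m₂ μ x) = condProj m₁ μ x := by
  by_cases h2 : m₂ ≤ mΩ
  · have h1 := h.trans h2
    have : Fact (m₁ ≤ mΩ) := ⟨h1⟩
    have : Fact (m₂ ≤ mΩ) := ⟨h2⟩
    rw [condProj, dif_pos h1, condProj, dif_pos h2]
    have hle : lpMeas ℂ ℂ m₁ 2 μ ≤ lpMeas ℂ ℂ m₂ 2 μ := fun f hf =>
      mem_lpMeas_iff_aestronglyMeasurable.2
        ((mem_lpMeas_iff_aestronglyMeasurable.1 hf).mono h)
    exact congrArg (fun B : Lp ℂ 2 μ →L[ℂ] Lp ℂ 2 μ => B x)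
      (Submodule.starProjection_comp_starProjection_of_le hle)
  · have : condProj m₂ μ x = x := by simp [condProj, h2]
    rw [this]

/-- Conditional expectation in `𝕃₂` is the orthogonal projection onto the `m`-measurable classes,
and it commutes with the continuous linear embedding of `ℝ` in `ℂ`. -/
lemma condProj_toL2 {Ω : Type*} {m mΩ : MeasurableSpace Ω} {μ : Measure Ω} [IsFiniteMeasure μ]
    (hm : m ≤ mΩ) {X : Ω → ℝ}
    (hX : MemLp X 2 μ) : condProj m μ (toL2 μ X) = toL2 μ (μ[X | m]) := by
  have : Fact (m ≤ mΩ) := ⟨hm⟩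
  have hX' : MemLp (μ[X | m]) 2 μ := hX.condExp one_le_two
  rw [condProj, dif_pos hm, toL2_of_memLp hX, toL2_of_memLp hX']
  have h1 := (hX.ofReal (K := ℂ)).condExpL2_ae_eq_condExp (𝕜 := ℂ) hm
  have h2 := Complex.ofRealCLM.comp_condExp_comm (m := m) (hX.integrable one_le_two)
  refine Lp.ext ?_
  refine Filter.EventuallyEq.trans ?_ (MemLp.coeFn_toLp hX'.ofReal).symm
  exact h1.trans h2.symm

end CondProj

/-! ### The error recursion and sufficiency of the root condition -/

namespace Assumptions

variable {Ω : Type*} [mΩ : MeasurableSpace Ω] {d : ℕ} {D : FBSDE d} {W : ℝ → Ω → E d}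
  {μ : Measure Ω} [IsProbabilityMeasure μ] {L Lf : ℝ} {S : Coeffs}

/-- The recursion satisfied by the difference of a solution and of a perturbed solution. -/
lemma exists_error_recursion (A : Assumptions D W μ L Lf) (S : Coeffs) :
    ∃ K : ℝ, 0 ≤ K ∧ ∀ (N : ℕ), 0 < N → ∀ (εY : ℕ → Ω → ℝ) (εZ : ℕ → Ω → E d)
      (Y : ℕ → Ω → ℝ) (Z : ℕ → Ω → E d) (Y' : ℕ → Ω → ℝ) (Z' : ℕ → Ω → E d),
      (∀ i, i + S.m ≤ N →
        InL2 μ (natF W (D.t N i)) (εY i) ∧ InL2 μ (natF W (D.t N i)) (εZ i)) →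
      IsPerturbedSolution D S W μ N 0 0 Y Z →
      IsPerturbedSolution D S W μ N εY εZ Y' Z' → ∀ i, i + S.m ≤ N →
      ∫ ω, (Y i ω - Y' i ω - ∑ j ∈ Finset.Icc 1 S.m,
            S.α j * μ[fun ω => Y (i + j) ω - Y' (i + j) ω | natF W (D.t N i)] ω) ^ 2 ∂μ
          ≤ K * (D.h N ^ 2 * (∑ j ∈ Finset.Icc 1 S.m, (∫ ω, (Y (i + j) ω - Y' (i + j) ω) ^ 2 ∂μ
            + ∫ ω, ‖Z (i + j) ω - Z' (i + j) ω‖ ^ 2 ∂μ) + ∫ ω, ‖Z i ω - Z' i ω‖ ^ 2 ∂μ)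
            + ∫ ω, |εY i ω| ^ 2 ∂μ) ∧
      D.h N * ∫ ω, ‖Z i ω - Z' i ω‖ ^ 2 ∂μ
          ≤ K * (∑ j ∈ Finset.Icc 1 S.m, ∫ ω, (Y (i + j) ω - Y' (i + j) ω
            - μ[fun ω => Y (i + j) ω - Y' (i + j) ω | natF W (D.t N i)] ω) ^ 2 ∂μ
            + D.h N * ∫ ω, ‖εZ i ω‖ ^ 2 ∂μ) := by
  obtain ⟨K₁, hK₁, hcorr⟩ := A.exists_integral_corrector_sub_sq_le S
  obtain ⟨K₂, hK₂, hzst⟩ := A.exists_integral_zStep_sub_sq_le S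
  refine ⟨2 * K₁ + 2 * K₂ + 2, by positivity, ?_⟩
  intro N hN εY εZ Y Z Y' Z' hε hsol hsol' i hi
  have hL2 := A.inL2_of_isPerturbedSolution hN
    (fun i _ => ⟨inL2_const _ μ (0 : ℝ), inL2_const _ μ (0 : E d)⟩) hsol
  have hL2' := A.inL2_of_isPerturbedSolution hN hε hsol'
  have hj : ∀ j ∈ Finset.Icc 1 S.m, i + j ≤ N := fun j hj => by
    have := (Finset.mem_Icc.1 hj).2; omega
  have hY : ∀ j ∈ Finset.Icc 1 S.m, MemLp (Y (i + j)) 2 μ := fun j h => (hL2 _ (hj j h)).1.2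
  have hY' : ∀ j ∈ Finset.Icc 1 S.m, MemLp (Y' (i + j)) 2 μ := fun j h => (hL2' _ (hj j h)).1.2
  have hZ : ∀ j ∈ Finset.Icc 1 S.m, MemLp (Z (i + j)) 2 μ := fun j h => (hL2 _ (hj j h)).2.2
  have hZ' : ∀ j ∈ Finset.Icc 1 S.m, MemLp (Z' (i + j)) 2 μ := fun j h => (hL2' _ (hj j h)).2.2
  have hZi := (hL2 i (by omega)).2.2
  have hZi' := (hL2' i (by omega)).2.2
  obtain ⟨hεY, hεZ⟩ := hε i hi
  have hh := FBSDE.h_pos A.T_pos hN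
  constructor
  · have hc := hcorr N hN i hi Y Y' Z Z' hY hZ hZi hY' hZ' hZi'
    set X : Ω → ℝ := fun ω => corrector D S W μ N Y Z i ω - corrector D S W μ N Y' Z' i ω
      - ∑ j ∈ Finset.Icc 1 S.m,
        S.α j * μ[fun ω => Y (i + j) ω - Y' (i + j) ω | natF W (D.t N i)] ω with hX
    have hXm : MemLp X 2 μ := by
      have h1 := (A.memLp_corrector hN hi hY hZ hZi).sub (A.memLp_corrector hN hi hY' hZ' hZi')
      have h2 : MemLp (fun ω => ∑ j ∈ Finset.Icc 1 S.m,
          S.α j * μ[fun ω => Y (i + j) ω - Y' (i + j) ω | natF W (D.t N i)] ω) 2 μ :=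
        memLp_finsetSum _ fun j hj =>
          ((((hY j hj).sub (hY' j hj)).condExp one_le_two).const_mul (S.α j))
      exact h1.sub h2
    have hae : (fun ω => (Y i ω - Y' i ω - ∑ j ∈ Finset.Icc 1 S.m,
        S.α j * μ[fun ω => Y (i + j) ω - Y' (i + j) ω | natF W (D.t N i)] ω) ^ 2)
        =ᵐ[μ] fun ω => (X ω - εY i ω) ^ 2 := by
      filter_upwards [hsol.stepY i hi, hsol'.stepY i hi] with ω h1 h2
      rw [h1, h2]
      simp only [Pi.add_apply, Pi.zero_apply, hX]
      ring
    have hεsq : Integrable (fun ω => |εY i ω| ^ 2) μ := by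
      simpa only [sq_abs] using hεY.2.integrable_sq
    have hV0 : 0 ≤ D.h N ^ 2 * (∑ j ∈ Finset.Icc 1 S.m,
        (∫ ω, (Y (i + j) ω - Y' (i + j) ω) ^ 2 ∂μ + ∫ ω, ‖Z (i + j) ω - Z' (i + j) ω‖ ^ 2 ∂μ)
          + ∫ ω, ‖Z i ω - Z' i ω‖ ^ 2 ∂μ) :=
      mul_nonneg (sq_nonneg _) (add_nonneg (Finset.sum_nonneg fun j _ => add_nonneg
        (integral_nonneg fun ω => sq_nonneg _) (integral_nonneg fun ω => sq_nonneg _))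
        (integral_nonneg fun ω => sq_nonneg _))
    have hε0 : 0 ≤ ∫ ω, |εY i ω| ^ 2 ∂μ := integral_nonneg fun ω => sq_nonneg _
    rw [integral_congr_ae hae]
    calc ∫ ω, (X ω - εY i ω) ^ 2 ∂μ ≤ ∫ ω, (2 * X ω ^ 2 + 2 * |εY i ω| ^ 2) ∂μ := by
          refine integral_mono (hXm.sub hεY.2).integrable_sq
            ((hXm.integrable_sq.const_mul 2).add (hεsq.const_mul 2)) fun ω => ?_
          simp only [sq_abs]
          nlinarith [sq_nonneg (X ω + εY i ω)]
      _ = 2 * ∫ ω, X ω ^ 2 ∂μ + 2 * ∫ ω, |εY i ω| ^ 2 ∂μ := by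
          rw [integral_add (hXm.integrable_sq.const_mul 2) (hεsq.const_mul 2),
            integral_const_mul, integral_const_mul]
      _ ≤ _ := by nlinarith [mul_nonneg hK₁ hε0, mul_nonneg hK₂ hε0, mul_nonneg hK₂ hV0]
  · have hz := hzst N hN i hi Y Y' hY hY'
    set X : Ω → E d := fun ω => zStep D S W μ N Y i ω - zStep D S W μ N Y' i ω with hX
    have hXm : MemLp X 2 μ := (A.memLp_zStep hN hi hY).sub (A.memLp_zStep hN hi hY')
    have hae : (fun ω => ‖Z i ω - Z' i ω‖ ^ 2) =ᵐ[μ] fun ω => ‖X ω - εZ i ω‖ ^ 2 := by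
      filter_upwards [hsol.stepZ i hi, hsol'.stepZ i hi] with ω h1 h2
      rw [h1, h2]
      simp only [Pi.add_apply, Pi.zero_apply, hX, add_zero, sub_add_eq_sub_sub]
    have hεsq : Integrable (fun ω => ‖εZ i ω‖ ^ 2) μ := hεZ.2.norm.integrable_sq
    have hXsq : Integrable (fun ω => ‖X ω‖ ^ 2) μ := hXm.norm.integrable_sq
    have hV0 : 0 ≤ ∑ j ∈ Finset.Icc 1 S.m, ∫ ω, (Y (i + j) ω - Y' (i + j) ω
        - μ[fun ω => Y (i + j) ω - Y' (i + j) ω | natF W (D.t N i)] ω) ^ 2 ∂μ :=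
      Finset.sum_nonneg fun j _ => integral_nonneg fun ω => sq_nonneg _
    have hε0 : 0 ≤ D.h N * ∫ ω, ‖εZ i ω‖ ^ 2 ∂μ :=
      mul_nonneg hh.le (integral_nonneg fun ω => sq_nonneg _)
    have h1 : ∫ ω, ‖Z i ω - Z' i ω‖ ^ 2 ∂μ ≤ 2 * ∫ ω, ‖X ω‖ ^ 2 ∂μ + 2 * ∫ ω, ‖εZ i ω‖ ^ 2 ∂μ := by
      rw [integral_congr_ae hae]
      calc ∫ ω, ‖X ω - εZ i ω‖ ^ 2 ∂μ ≤ ∫ ω, (2 * ‖X ω‖ ^ 2 + 2 * ‖εZ i ω‖ ^ 2) ∂μ := by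
            refine integral_mono (hXm.sub hεZ.2).norm.integrable_sq
              ((hXsq.const_mul 2).add (hεsq.const_mul 2)) fun ω => ?_
            have := pow_le_pow_left₀ (norm_nonneg _) (norm_sub_le (X ω) (εZ i ω)) 2
            simp only
            nlinarith [sq_nonneg (‖X ω‖ - ‖εZ i ω‖)]
        _ = _ := by
            rw [integral_add (hXsq.const_mul 2) (hεsq.const_mul 2), integral_const_mul,
              integral_const_mul]
    have h2 := mul_le_mul_of_nonneg_left h1 hh.le
    nlinarith [mul_nonneg hK₁ hε0, mul_nonneg hK₂ hε0, mul_nonneg hK₁ hV0]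

/-- The root condition implies stability. -/
theorem l2Stable_of_rootCondition (A : Assumptions D W μ L Lf) (hm : 1 ≤ S.m)
    (hS : RootCondition S) : L2Stable D S W μ := by
  obtain ⟨K, hK, hrec⟩ := A.exists_error_recursion S
  -- The abstract bound needs a horizon for `n + m + 1 = N + 1` steps, and `(N + 1) h = T + h ≤ 2
  -- T`.
  have hT2 : 0 < 2 * D.T := by linarith [A.T_pos]
  obtain ⟨C, hC, hmain⟩ := exists_stability_bound S hm hS (Lp ℂ 2 μ) hK hT2
  refine ⟨2 * C, ?_⟩
  intro N hmN εY εZ Y Z Y' Z' hε hsol hsol' hZZ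
  have hN : 0 < N := by omega
  have hh := FBSDE.h_pos A.T_pos hN
  have hNh := FBSDE.nat_mul_h (D := D) hN
  have hL2 := A.inL2_of_isPerturbedSolution hN
    (fun i _ => ⟨inL2_const _ μ (0 : ℝ), inL2_const _ μ (0 : E d)⟩) hsol.toIsPerturbedSolution
  have hL2' := A.inL2_of_isPerturbedSolution hN hε hsol'
  have hδ : ∀ k ≤ N, MemLp (fun ω => Y k ω - Y' k ω) 2 μ := fun k hk =>
    (hL2 k hk).1.2.sub (hL2' k hk).1.2
  have hF : ∀ k ≤ N, natF W (D.t N k) ≤ mΩ := fun k hk => A.natF_le hN hk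
  set n := N - S.m with hn
  set s := ⨆ k : Fin S.m, ∫ ω, |Y (n + 1 + k) ω - Y' (n + 1 + k) ω| ^ 2 ∂μ with hs
  have hs_le : ∀ k, n < k → k ≤ N → ∫ ω, (Y k ω - Y' k ω) ^ 2 ∂μ ≤ s := fun k hk hkN => by
    have h1 := le_ciSup (f := fun k : Fin S.m => ∫ ω, |Y (n + 1 + k) ω - Y' (n + 1 + k) ω| ^ 2 ∂μ)
      (Set.finite_range _).bddAbove ⟨k - (n + 1), by omega⟩
    simp only [sq_abs] at h1
    rw [show n + 1 + (k - (n + 1)) = k by omega] at h1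
    simpa only [hs, sq_abs] using h1
  have hs0 : 0 ≤ s := Real.iSup_nonneg fun k => integral_nonneg fun ω => sq_nonneg _
  -- The sequence is extended by zero beyond `N`, since the abstract bound requires adaptedness and
  -- the bound by `s` at all indices.
  set y : ℕ → Lp ℂ 2 μ := fun k => if k ≤ N then toL2 μ (fun ω => Y k ω - Y' k ω) else 0 with hy
  have hy_of : ∀ k ≤ N, y k = toL2 μ (fun ω => Y k ω - Y' k ω) := fun k hk => if_pos hk
  have hy_norm : ∀ k ≤ N, ‖y k‖ ^ 2 = ∫ ω, (Y k ω - Y' k ω) ^ 2 ∂μ := fun k hk => by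
    rw [hy_of k hk, norm_toL2_sq (hδ k hk)]
  -- Setting `z` to zero beyond `n` agrees with the true errors up to `N`, because the starting
  -- values of `Z` are not perturbed.
  set z : ℕ → ℝ := fun k => if k ≤ n then ∫ ω, ‖Z k ω - Z' k ω‖ ^ 2 ∂μ else 0 with hz
  have hz_of : ∀ k ≤ N, z k = ∫ ω, ‖Z k ω - Z' k ω‖ ^ 2 ∂μ := fun k hk => by
    by_cases h : k ≤ n
    · exact if_pos h
    · rw [hz]
      simp only [h, if_false]
      refine ((integral_congr_ae ?_).trans (integral_zero' Ω ℝ)).symm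
      filter_upwards [hZZ k (by omega) hk] with ω hω
      simp [hω]
  have hcond : ∀ i ≤ N, ∀ k ≤ N, condProj (natF W (D.t N i)) μ (y k)
      = toL2 μ (μ[fun ω => Y k ω - Y' k ω | natF W (D.t N i)]) := fun i hi k hk => by
    rw [hy_of k hk, condProj_toL2 (hF i hi) (hδ k hk)]
  have hj : ∀ i ≤ n, ∀ j ∈ Finset.Icc 1 S.m, i + j ≤ N := fun i hi j hj => by
    have := (Finset.mem_Icc.1 hj).2; omega
  obtain ⟨h1, h2⟩ := hmain n (D.h N) s (fun i => condProj (natF W (D.t N i)) μ) y z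
    (fun i => ∫ ω, ‖εZ i ω‖ ^ 2 ∂μ) (fun i => ∫ ω, |εY i ω| ^ 2 ∂μ) hh
    (by
      have h1 : (n : ℝ) + S.m = N := by exact_mod_cast (by omega : n + S.m = N)
      have h2 := FBSDE.h_le A.T_pos hN
      rw [h1]
      linarith)
    hs0
    (fun i => by
      simp only [hz]
      split_ifs
      · exact integral_nonneg fun ω => sq_nonneg _
      · exact le_rfl)
    (fun i => integral_nonneg fun ω => sq_nonneg _) (fun i => integral_nonneg fun ω => sq_nonneg _)
    (fun i x => norm_condProj_sq_add _ x)
    (fun i x => condProj_condProj_of_le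
      (natF_mono W (FBSDE.t_mono A.T_pos N (Nat.le_succ i))) x)
    (fun i => by
      by_cases hi : i ≤ N
      · rw [hcond i hi i hi, hy_of i hi]
        exact (toL2_congr (hδ i hi) (condExp_of_aestronglyMeasurable' (hF i hi)
          ((hL2 i hi).1.1.sub (hL2' i hi).1.1) ((hδ i hi).integrable one_le_two)).symm).symm
      · simp [hy, hi])
    (fun i hi => by
      have h := (hrec N hN εY εZ Y Z Y' Z' hε hsol.toIsPerturbedSolution hsol' i (by omega)).1
      have hδm : ∀ j ∈ Finset.Icc 1 S.m,
          MemLp (μ[fun ω => Y (i + j) ω - Y' (i + j) ω | natF W (D.t N i)]) 2 μ :=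
        fun j hj' => (hδ _ (hj i hi j hj')).condExp one_le_two
      have e1 : y i - ∑ j ∈ Finset.Icc 1 S.m, (S.α j : ℂ) • condProj (natF W (D.t N i)) μ (y (i + j))
          = toL2 μ (fun ω => Y i ω - Y' i ω - ∑ j ∈ Finset.Icc 1 S.m,
            S.α j * μ[fun ω => Y (i + j) ω - Y' (i + j) ω | natF W (D.t N i)] ω) := by
        rw [toL2_sub (hδ i (by omega)) (memLp_finsetSum _ fun j hj' => (hδm j hj').const_mul _),
          toL2_sum_const_mul _ _ hδm, hy_of i (by omega)]
        congr 1
        exact Finset.sum_congr rfl fun j hj' => by rw [hcond i (by omega) _ (hj i hi j hj')]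
      have hm' : MemLp (fun ω => Y i ω - Y' i ω - ∑ j ∈ Finset.Icc 1 S.m,
          S.α j * μ[fun ω => Y (i + j) ω - Y' (i + j) ω | natF W (D.t N i)] ω) 2 μ :=
        (hδ i (by omega)).sub (memLp_finsetSum _ fun j hj' => (hδm j hj').const_mul _)
      rw [e1, norm_toL2_sq hm', hz_of i (by omega),
        Finset.sum_congr rfl fun j hj' => by
          rw [hy_norm _ (hj i hi j hj'), hz_of _ (hj i hi j hj')]]
      exact h)
    (fun i hi => by
      have h := (hrec N hN εY εZ Y Z Y' Z' hε hsol.toIsPerturbedSolution hsol' i (by omega)).2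
      have hm' : ∀ j ∈ Finset.Icc 1 S.m, MemLp (fun ω => Y (i + j) ω - Y' (i + j) ω
          - μ[fun ω => Y (i + j) ω - Y' (i + j) ω | natF W (D.t N i)] ω) 2 μ := fun j hj' =>
        (hδ _ (hj i hi j hj')).sub ((hδ _ (hj i hi j hj')).condExp one_le_two)
      rw [hz_of i (by omega), Finset.sum_congr rfl fun j hj' => by
        rw [hcond i (by omega) _ (hj i hi j hj'), hy_of _ (hj i hi j hj'),
          ← toL2_sub (hδ _ (hj i hi j hj')) ((hδ _ (hj i hi j hj')).condExp one_le_two),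
          norm_toL2_sq (hm' j hj')]]
      exact h)
    (fun i hi => if_neg (by omega))
    (fun i hi => by
      by_cases hiN : i ≤ N
      · rw [hy_norm i hiN]; exact hs_le i hi hiN
      · simp [hy, hiN, hs0])
  have hG : s + ∑ i ∈ Finset.range (n + 1),
        (D.h N * ∫ ω, ‖εZ i ω‖ ^ 2 ∂μ + (∫ ω, |εY i ω| ^ 2 ∂μ) / D.h N)
      = s + ∑ i ∈ Finset.range (n + 1),
        (D.h N * ∫ ω, ‖εZ i ω‖ ^ 2 ∂μ + 1 / D.h N * ∫ ω, |εY i ω| ^ 2 ∂μ) := by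
    congr 1
    exact Finset.sum_congr rfl fun i _ => by ring
  rw [hG] at h1 h2
  rw [mul_assoc, two_mul]
  refine add_le_add (ciSup_le fun i => ?_) (le_trans (le_of_eq ?_) h2)
  · have hi : (i : ℕ) ≤ n := by have := i.2; omega
    have := h1 i hi
    rw [hy_norm i (by omega)] at this
    simpa only [sq_abs] using this
  · exact Finset.sum_congr rfl fun i hi => by
      have := Finset.mem_range.1 hi
      rw [hz_of i (by omega)]

end Assumptions

/-! ### Unbounded solutions of the homogeneous difference equation -/

open Polynomial in
-- The difference equation at index `n` in polynomial form. Evaluating it at a root yields the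
-- solution `ζ^n`; differentiating it first yields `n ζ^n` at a multiple root.
lemma X_pow_mul_charPoly (S : Coeffs) {n : ℕ} (hn : S.m ≤ n) :
    X ^ (n - S.m) * charPoly S
      = X ^ n - ∑ j ∈ Finset.Icc 1 S.m, C (S.α j : ℂ) * X ^ (n - j) := by
  rw [charPoly, mul_sub, ← pow_add, Finset.mul_sum, Nat.sub_add_cancel hn]
  congr 1
  refine Finset.sum_congr rfl fun j hj => ?_
  have := (Finset.mem_Icc.1 hj).2
  rw [mul_left_comm, ← pow_add, show n - S.m + (S.m - j) = n - j by omega]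

/-- If the root condition fails, then the homogeneous difference equation has an unbounded complex
solution. -/
lemma exists_unbounded_complex_of_not_rootCondition {S : Coeffs} (hS : ¬ RootCondition S) :
    ∃ u : ℕ → ℂ, (∀ n, S.m ≤ n → u n = ∑ j ∈ Finset.Icc 1 S.m, (S.α j : ℂ) * u (n - j)) ∧
      ∀ B : ℝ, ∃ n, B < ‖u n‖ := by
  simp only [RootCondition, not_forall] at hS
  obtain ⟨ζ, hζ, hS⟩ := hS
  by_cases h1 : ‖ζ‖ ≤ 1
  · have h2 : ‖ζ‖ = 1 ∧ (charPoly S).rootMultiplicity ζ ≠ 1 := by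
      by_contra hcon
      exact hS ⟨h1, fun h => by by_contra h'; exact hcon ⟨h, h'⟩⟩
    have hne := (charPoly_monic S).ne_zero
    have hpos := (Polynomial.rootMultiplicity_pos hne).2 hζ
    have hder := ((Polynomial.one_lt_rootMultiplicity_iff_isRoot (t := ζ) hne).1
      (by have := h2.2; omega)).2
    -- A multiple root on the unit circle produces linear growth. The factor `ζ` in front of the
    -- derivative restores `k ζ^k` from `k ζ^(k-1)`, also for `k = 0`.
    refine ⟨fun n => n * ζ ^ n, fun n hn => ?_, fun B => ?_⟩
    · have hpow : ∀ k : ℕ, ζ * ((k : ℂ) * ζ ^ (k - 1)) = k * ζ ^ k := fun k => by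
        rcases k with _ | k
        · simp
        · rw [Nat.add_sub_cancel, pow_succ]; ring
      have h3 := congrArg (fun p => ζ * (Polynomial.derivative p).eval ζ) (X_pow_mul_charPoly S hn)
      simp only [Polynomial.derivative_mul, Polynomial.eval_add, Polynomial.eval_mul, hζ.eq_zero,
        Polynomial.IsRoot.eq_zero hder, mul_zero, add_zero, Polynomial.derivative_sub,
        Polynomial.derivative_sum, Polynomial.derivative_X_pow, Polynomial.derivative_C, zero_mul,
        zero_add, Polynomial.eval_sub, Polynomial.eval_finsetSum, Polynomial.eval_C,
        Polynomial.eval_pow, Polynomial.eval_X, mul_sub, hpow, Finset.mul_sum] at h3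
      rw [eq_comm, sub_eq_zero] at h3
      refine h3.trans (Finset.sum_congr rfl fun j _ => ?_)
      rw [mul_left_comm, hpow]
    · obtain ⟨n, hn⟩ := exists_nat_gt B
      exact ⟨n, by simpa [h2.1] using hn⟩
  · refine ⟨fun n => ζ ^ n, fun n hn => ?_, fun B => ?_⟩
    · have h3 := congrArg (Polynomial.eval ζ) (X_pow_mul_charPoly S hn)
      simp only [Polynomial.eval_mul, hζ.eq_zero, mul_zero, Polynomial.eval_sub,
        Polynomial.eval_finsetSum, Polynomial.eval_C, Polynomial.eval_pow, Polynomial.eval_X] at h3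
      exact sub_eq_zero.1 h3.symm
    · obtain ⟨n, hn⟩ := pow_unbounded_of_one_lt B (not_le.1 h1)
      exact ⟨n, by simpa using hn⟩

/-- If the root condition fails, then the homogeneous difference equation has an unbounded
solution. -/
lemma exists_unbounded_of_not_rootCondition {S : Coeffs} (hS : ¬ RootCondition S) :
    ∃ u : ℕ → ℝ, (∀ n, S.m ≤ n → u n = ∑ j ∈ Finset.Icc 1 S.m, S.α j * u (n - j)) ∧
      ∀ B : ℝ, ∃ n, B < |u n| := by
  obtain ⟨u, hu, hB⟩ := exists_unbounded_complex_of_not_rootCondition hS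
  -- The `α_j` are real, so real and imaginary parts are again solutions, and they cannot both be
  -- bounded.
  by_contra! hcon
  obtain ⟨B₁, hB₁⟩ := hcon (fun n => (u n).re) fun n hn => by
    simp [congrArg Complex.re (hu n hn)]
  obtain ⟨B₂, hB₂⟩ := hcon (fun n => (u n).im) fun n hn => by
    simp [congrArg Complex.im (hu n hn)]
  obtain ⟨n, hn⟩ := hB (B₁ + B₂)
  linarith [Complex.norm_le_abs_re_add_abs_im (u n), hB₁ n, hB₂ n]

/-! ### Construction of solutions by backward recursion -/

section Construction

variable {Ω : Type*} [mΩ : MeasurableSpace Ω] {d : ℕ} {D : FBSDE d} {W : ℝ → Ω → E d}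
  {μ : Measure Ω} {S : Coeffs} {N i : ℕ}

/-- Locality: only the values at `i + 1, …, i + m` enter. This and its two companions below allow
the recursion to be solved by overwriting one index at a time. -/
lemma predictor_congr {Y Y' : ℕ → Ω → ℝ} {Z Z' : ℕ → Ω → E d}
    (hY : ∀ j ∈ Finset.Icc 1 S.m, Y (i + j) = Y' (i + j))
    (hZ : ∀ j ∈ Finset.Icc 1 S.m, Z (i + j) = Z' (i + j)) :
    predictor D S W μ N Y Z i = predictor D S W μ N Y' Z' i := by
  unfold predictor
  congr 1
  funext ω
  congr 1
  · exact Finset.sum_congr rfl fun j hj => by rw [hY j hj]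
  · exact Finset.sum_congr rfl fun j hj => by rw [hY j hj, hZ j hj]

lemma corrector_congr {Y Y' : ℕ → Ω → ℝ} {Z Z' : ℕ → Ω → E d}
    (hY : ∀ j ∈ Finset.Icc 1 S.m, Y (i + j) = Y' (i + j))
    (hZ : ∀ j ∈ Finset.Icc 1 S.m, Z (i + j) = Z' (i + j)) (hZi : Z i = Z' i) :
    corrector D S W μ N Y Z i = corrector D S W μ N Y' Z' i := by
  unfold corrector
  rw [predictor_congr hY hZ, hZi]
  congr 1
  funext ω
  congr 1
  · congr 1
    exact Finset.sum_congr rfl fun j hj => by rw [hY j hj]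
  · exact Finset.sum_congr rfl fun j hj => by rw [hY j hj, hZ j hj]

lemma zStep_congr {Y Y' : ℕ → Ω → ℝ} (hY : ∀ j ∈ Finset.Icc 1 S.m, Y (i + j) = Y' (i + j)) :
    zStep D S W μ N Y i = zStep D S W μ N Y' i := by
  unfold zStep
  congr 1
  funext ω
  exact Finset.sum_congr rfl fun j hj => by rw [hY j hj]

/-- The backward recursion can be solved below any index. -/
lemma exists_backward_extension (D : FBSDE d) (S : Coeffs) (W : ℝ → Ω → E d) (μ : Measure Ω)
    (N M : ℕ) (Y₀ : ℕ → Ω → ℝ) (Z₀ : ℕ → Ω → E d) :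
    ∃ (Y : ℕ → Ω → ℝ) (Z : ℕ → Ω → E d), (∀ k, M ≤ k → Y k = Y₀ k ∧ Z k = Z₀ k) ∧
      ∀ i < M, Y i = corrector D S W μ N Y Z i ∧ Z i = zStep D S W μ N Y i := by
  induction M generalizing Y₀ Z₀ with
  | zero => exact ⟨Y₀, Z₀, by simp, by simp⟩
  | succ M ih =>
    -- `Z` is updated at `M` before `Y`, since the corrector at `M` uses `Z M`.
    set Z₁ := Function.update Z₀ M (zStep D S W μ N Y₀ M) with hZ₁
    set Y₁ := Function.update Y₀ M (corrector D S W μ N Y₀ Z₁ M) with hY₁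
    obtain ⟨Y, Z, hst, hrec⟩ := ih Y₁ Z₁
    have hYk : ∀ k, M + 1 ≤ k → Y k = Y₀ k := fun k hk => by
      rw [(hst k (by omega)).1, hY₁, Function.update_of_ne (by omega)]
    have hZk : ∀ k, M + 1 ≤ k → Z k = Z₀ k := fun k hk => by
      rw [(hst k (by omega)).2, hZ₁, Function.update_of_ne (by omega)]
    refine ⟨Y, Z, fun k hk => ⟨hYk k hk, hZk k hk⟩, fun i hi => ?_⟩
    rcases Nat.lt_succ_iff_lt_or_eq.1 hi with h | rfl
    · exact hrec i h
    · have hY : ∀ j ∈ Finset.Icc 1 S.m, Y₀ (i + j) = Y (i + j) := fun j hj =>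
        (hYk _ (by have := (Finset.mem_Icc.1 hj).1; omega)).symm
      constructor
      · rw [(hst i le_rfl).1, hY₁, Function.update_self]
        exact corrector_congr hY (fun j _ => ((hst _ (by omega)).2).symm) (hst i le_rfl).2.symm
      · rw [(hst i le_rfl).2, hZ₁, Function.update_self]
        exact zStep_congr hY

end Construction

/-! ### Necessity of the root condition -/

namespace Assumptions

variable {Ω : Type*} [mΩ : MeasurableSpace Ω] {d : ℕ} {D : FBSDE d} {W : ℝ → Ω → E d}
  {μ : Measure Ω} [IsProbabilityMeasure μ] {L Lf : ℝ} {S : Coeffs} {N : ℕ}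

/-- The scheme has a solution. -/
lemma exists_isSolution (A : Assumptions D W μ L Lf) (hΦm : Measurable D.Φ)
    (hΦb : ∃ M : ℝ, ∀ x, |D.Φ x| ≤ M) (hm : 1 ≤ S.m) (hN : S.m ≤ N) :
    ∃ (Y : ℕ → Ω → ℝ) (Z : ℕ → Ω → E d), IsSolution D S W μ N Y Z := by
  obtain ⟨M, hM⟩ := hΦb
  have hN0 : 0 < N := by omega
  obtain ⟨Y, Z, hst, hrec⟩ := exists_backward_extension D S W μ N (N - S.m + 1)
    (Function.update 0 N fun ω => D.Φ (D.euler W N N ω)) 0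
  have hΦ : StronglyMeasurable[natF W (D.t N N)] fun ω => D.Φ (D.euler W N N ω) :=
    (hΦm.comp (A.stronglyMeasurable_euler hN0 N le_rfl).measurable).stronglyMeasurable
  refine ⟨Y, Z, ⟨fun k hk hkN => ?_, fun k hk hkN => ?_, fun i hi => ?_, fun i hi => ?_⟩, ?_⟩
  · rw [(hst k (by omega)).1]
    by_cases h : k = N
    · subst h
      rw [Function.update_self]
      exact ⟨hΦ.aestronglyMeasurable, MemLp.of_bound
        (hΦ.mono (A.natF_le hN0 le_rfl)).aestronglyMeasurable M (ae_of_all _ fun ω => hM _)⟩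
    · rw [Function.update_of_ne h]
      exact inL2_const _ μ (0 : ℝ)
  · rw [(hst k (by omega)).2]
    exact inL2_const _ μ (0 : E d)
  · simpa using Filter.EventuallyEq.of_eq (hrec i (by omega)).1
  · simpa using Filter.EventuallyEq.of_eq (hrec i (by omega)).2
  · rw [(hst N (by omega)).1, Function.update_self]

/-- Shifting a solution near the terminal time by a deterministic solution of the homogeneous
difference equation yields a perturbed solution with small perturbations. -/
lemma exists_shifted_solution (A : Assumptions D W μ L Lf) (hΦm : Measurable D.Φ)
    (hΦb : ∃ M : ℝ, ∀ x, |D.Φ x| ≤ M) (hm : 1 ≤ S.m) {u : ℕ → ℝ}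
    (hu : ∀ n, S.m ≤ n → u n = ∑ j ∈ Finset.Icc 1 S.m, S.α j * u (n - j)) :
    ∃ c : ℝ, 0 ≤ c ∧ ∀ N K : ℕ, S.m ≤ K → K ≤ N →
      ∃ (εY : ℕ → Ω → ℝ) (Y : ℕ → Ω → ℝ) (Z : ℕ → Ω → E d) (Y' : ℕ → Ω → ℝ) (Z' : ℕ → Ω → E d),
        (∀ i, i + S.m ≤ N → InL2 μ (natF W (D.t N i)) (εY i)) ∧
        IsSolution D S W μ N Y Z ∧ IsPerturbedSolution D S W μ N εY 0 Y' Z' ∧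
        (∀ k, N - K ≤ k → Z' k = Z k ∧ Y' k = fun ω => Y k ω + u (N - k)) ∧
        (∀ i < N - K, εY i = 0) ∧
        ∀ i, N - K ≤ i → i + S.m ≤ N → ∫ ω, |εY i ω| ^ 2 ∂μ
          ≤ c * (D.h N ^ 2 * ∑ j ∈ Finset.Icc 1 S.m, u (N - (i + j)) ^ 2) := by
  obtain ⟨K₁, hK₁, hcorr⟩ := A.exists_integral_corrector_sub_sq_le S
  obtain ⟨K₂, hK₂, hzst⟩ := A.exists_integral_zStep_sub_sq_le S
  refine ⟨K₁, hK₁, fun N K hmK hKN => ?_⟩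
  have hN : 0 < N := by omega
  have hh := FBSDE.h_pos A.T_pos hN
  obtain ⟨Y, Z, hsol⟩ := A.exists_isSolution hΦm hΦb hm (hmK.trans hKN)
  have hL2 := A.inL2_of_isPerturbedSolution hN
    (fun i _ => ⟨inL2_const _ μ (0 : ℝ), inL2_const _ μ (0 : E d)⟩) hsol.toIsPerturbedSolution
  -- The shift is imposed from index `N - K` on; below it the unperturbed recursion is followed, so
  -- no perturbation arises there.
  obtain ⟨Y', Z', hst, hrec⟩ := exists_backward_extension D S W μ N (N - K)
    (fun k ω => Y k ω + u (N - k)) Z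
  have hY'k : ∀ k, N - K ≤ k → Y' k = fun ω => Y k ω + u (N - k) := fun k hk => (hst k hk).1
  have hZ'k : ∀ k, N - K ≤ k → Z' k = Z k := fun k hk => (hst k hk).2
  have hL2Y' : ∀ k, N - K ≤ k → k ≤ N → InL2 μ (natF W (D.t N k)) (Y' k) := fun k hk hkN => by
    rw [hY'k k hk]
    exact ⟨(hL2 k hkN).1.1.add (inL2_const _ μ (u (N - k))).1,
      (hL2 k hkN).1.2.add (memLp_const (u (N - k)))⟩
  have hcond : ∀ i k, N - K ≤ k → i ≤ N →
      μ[fun ω => Y k ω - Y' k ω | natF W (D.t N i)] = fun _ => -u (N - k) := fun i k hk hi => by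
    have : (fun ω => Y k ω - Y' k ω) = fun _ => -u (N - k) := by
      funext ω
      rw [hY'k k hk]
      ring
    rw [this, condExp_const (A.natF_le hN hi)]
  have hjN : ∀ i, i + S.m ≤ N → ∀ j ∈ Finset.Icc 1 S.m, i + j ≤ N := fun i hi j hj => by
    have := (Finset.mem_Icc.1 hj).2; omega
  have hY : ∀ i, i + S.m ≤ N → ∀ j ∈ Finset.Icc 1 S.m, MemLp (Y (i + j)) 2 μ :=
    fun i hi j hj => (hL2 _ (hjN i hi j hj)).1.2
  have hZ : ∀ i, i + S.m ≤ N → ∀ j ∈ Finset.Icc 1 S.m, MemLp (Z (i + j)) 2 μ :=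
    fun i hi j hj => (hL2 _ (hjN i hi j hj)).2.2
  have hY' : ∀ i, N - K ≤ i → i + S.m ≤ N → ∀ j ∈ Finset.Icc 1 S.m, MemLp (Y' (i + j)) 2 μ :=
    fun i hi hi' j hj => (hL2Y' _ (by omega) (hjN i hi' j hj)).2
  have hZ' : ∀ i, N - K ≤ i → i + S.m ≤ N → ∀ j ∈ Finset.Icc 1 S.m, MemLp (Z' (i + j)) 2 μ :=
    fun i hi hi' j hj => by rw [hZ'k _ (by omega)]; exact hZ i hi' j hj
  have hZi' : ∀ i, N - K ≤ i → i ≤ N → MemLp (Z' i) 2 μ := fun i hi hi' => by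
    rw [hZ'k i hi]; exact (hL2 i hi').2.2
  refine ⟨fun i => if N - K ≤ i then fun ω => Y' i ω - corrector D S W μ N Y' Z' i ω else 0,
    Y, Z, Y', Z', fun i hi => ?_, hsol, ⟨fun k hk hkN => hL2Y' k (by omega) hkN,
      fun k hk hkN => ?_, fun i hi => ?_, fun i hi => ?_⟩,
    fun k hk => ⟨hZ'k k hk, hY'k k hk⟩, fun i hi => if_neg (by omega), fun i hi hi' => ?_⟩
  · by_cases h : N - K ≤ i
    · simp only [h, if_true]
      exact ⟨(hL2Y' i h (by omega)).1.sub stronglyMeasurable_condExp.aestronglyMeasurable,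
        (hL2Y' i h (by omega)).2.sub (A.memLp_corrector hN hi (hY' i h hi) (hZ' i h hi)
          (hZi' i h (by omega)))⟩
    · simp only [h, if_false]
      exact inL2_const _ μ (0 : ℝ)
  · rw [hZ'k k (by omega)]
    exact hsol.startZ k hk hkN
  · by_cases h : N - K ≤ i
    · refine Filter.EventuallyEq.of_eq (funext fun ω => ?_)
      simp [h]
    · simpa [h] using Filter.EventuallyEq.of_eq (hrec i (by omega)).1
  · by_cases h : N - K ≤ i
    · have h1 := hzst N hN i hi Y Y' (hY i hi) (hY' i h hi)
      -- A deterministic shift has conditional variance zero. The two `Z` steps therefore agree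
      -- almost surely, and `Z' = Z` needs no perturbation `εZ`.
      have h2 : ∑ j ∈ Finset.Icc 1 S.m, ∫ ω, (Y (i + j) ω - Y' (i + j) ω
          - μ[fun ω => Y (i + j) ω - Y' (i + j) ω | natF W (D.t N i)] ω) ^ 2 ∂μ = 0 := by
        refine Finset.sum_eq_zero fun j _ => ?_
        rw [hcond i (i + j) (by omega) (by omega), hY'k (i + j) (by omega)]
        simp
      rw [h2, mul_zero] at h1
      have h3 : ∫ ω, ‖zStep D S W μ N Y i ω - zStep D S W μ N Y' i ω‖ ^ 2 ∂μ = 0 :=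
        le_antisymm (nonpos_of_mul_nonpos_right h1 hh) (integral_nonneg fun ω => sq_nonneg _)
      have hint : Integrable
          (fun ω => ‖zStep D S W μ N Y i ω - zStep D S W μ N Y' i ω‖ ^ 2) μ :=
        ((A.memLp_zStep hN hi (hY i hi)).sub
          (A.memLp_zStep hN hi (hY' i h hi))).norm.integrable_sq
      rw [integral_eq_zero_iff_of_nonneg (fun ω => sq_nonneg _) hint] at h3
      rw [hZ'k i h]
      filter_upwards [hsol.stepZ i hi, h3] with ω h4 h5
      have h6 : zStep D S W μ N Y i ω = zStep D S W μ N Y' i ω :=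
        sub_eq_zero.1 (norm_eq_zero.1 (pow_eq_zero_iff two_ne_zero |>.1 h5))
      rw [h4]
      simp [h6]
    · simpa using Filter.EventuallyEq.of_eq (hrec i (by omega)).2
  · simp only [hi, if_true]
    have h1 := hcorr N hN i hi' Y Y' Z Z' (hY i hi') (hZ i hi') (hL2 i (by omega)).2.2
      (hY' i hi hi') (hZ' i hi hi') (hZi' i hi (by omega))
    have h2 : ∫ ω, |Y' i ω - corrector D S W μ N Y' Z' i ω| ^ 2 ∂μ
        = ∫ ω, (corrector D S W μ N Y Z i ω - corrector D S W μ N Y' Z' i ω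
          - ∑ j ∈ Finset.Icc 1 S.m,
            S.α j * μ[fun ω => Y (i + j) ω - Y' (i + j) ω | natF W (D.t N i)] ω) ^ 2 ∂μ := by
      refine integral_congr_ae ?_
      filter_upwards [hsol.stepY i hi'] with ω hω
      -- By the difference equation, the linear part transports the shift exactly. Hence `εY i` is
      -- the difference of the correctors minus its linear part, and this is of order `h`.
      have h3 : ∑ j ∈ Finset.Icc 1 S.m,
            S.α j * μ[fun ω => Y (i + j) ω - Y' (i + j) ω | natF W (D.t N i)] ω = -u (N - i) := by
        rw [hu (N - i) (by omega), ← Finset.sum_neg_distrib]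
        refine Finset.sum_congr rfl fun j _ => ?_
        rw [hcond i (i + j) (by omega) (by omega), Nat.sub_sub]
        ring
      rw [sq_abs, h3, hY'k i hi]
      simp only [hω, Pi.add_apply, Pi.zero_apply]
      ring
    rw [h2]
    refine h1.trans (le_of_eq ?_)
    congr 2
    rw [hZ'k i hi]
    simp only [sub_self, norm_zero, ne_eq, OfNat.ofNat_ne_zero, not_false_eq_true, zero_pow,
      integral_zero, add_zero]
    refine Finset.sum_congr rfl fun j _ => ?_
    rw [hZ'k _ (by omega), hY'k _ (by omega)]
    simp

/-- Stability implies the root condition. -/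
theorem rootCondition_of_l2Stable (A : Assumptions D W μ L Lf) (hΦm : Measurable D.Φ)
    (hΦb : ∃ M : ℝ, ∀ x, |D.Φ x| ≤ M) (hm : 1 ≤ S.m) (hst : L2Stable D S W μ) :
    RootCondition S := by
  by_contra hS
  obtain ⟨u, hu, hunb⟩ := exists_unbounded_of_not_rootCondition hS
  obtain ⟨C, hC⟩ := hst
  obtain ⟨c, hc, hshift⟩ := A.exists_shifted_solution hΦm hΦb hm hu
  set B₀ := ∑ n ∈ Finset.range S.m, u n ^ 2 with hB₀
  have hB₀0 : 0 ≤ B₀ := Finset.sum_nonneg fun n _ => sq_nonneg _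
  have hB₀u : ∀ n < S.m, u n ^ 2 ≤ B₀ := fun n hn =>
    Finset.single_le_sum (f := fun n => u n ^ 2) (fun n _ => sq_nonneg _) (Finset.mem_range.2 hn)
  -- The summand `|C| * B₀ + 1` contradicts stability once the perturbations contribute at most `1`.
  -- The summand `B₀` forces `K ≥ m`, and the threshold being at least `1` allows squaring.
  obtain ⟨K, hK⟩ := hunb (|C| * B₀ + 1 + B₀)
  have hCB : 0 ≤ |C| * B₀ := by positivity
  have huK : |C| * B₀ + 1 + B₀ < u K ^ 2 := by
    rw [← sq_abs]
    nlinarith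
  have hmK : S.m ≤ K := by
    by_contra h
    linarith [hB₀u K (not_le.1 h)]
  set B := ∑ n ∈ Finset.range (K + 1), u n ^ 2 with hB
  have hB0 : 0 ≤ B := Finset.sum_nonneg fun n _ => sq_nonneg _
  have hBu : ∀ n ≤ K, u n ^ 2 ≤ B := fun n hn =>
    Finset.single_le_sum (f := fun n => u n ^ 2) (fun n _ => sq_nonneg _)
      (Finset.mem_range.2 (by omega))
  -- With `K` fixed, `N` is taken so large that the total contribution of the perturbations, of
  -- order `h = T / N`, is at most `1` after multiplication by `|C|`.
  obtain ⟨N, hN⟩ := exists_nat_ge (max (K : ℝ) (|C| * ((K + 1) * (c * (S.m * B))) * D.T))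
  have hKN : K ≤ N := by exact_mod_cast (le_max_left _ _).trans hN
  have hN0 : 0 < N := by omega
  have hh := FBSDE.h_pos A.T_pos hN0
  have hsmall : |C| * ((K + 1) * (c * (S.m * B))) * D.h N ≤ 1 := by
    rw [FBSDE.h, ← mul_div_assoc, div_le_one (by exact_mod_cast hN0)]
    exact (le_max_right _ _).trans hN
  obtain ⟨εY, Y, Z, Y', Z', hε, hsol, hsol', hYZ, hε0, hεle⟩ := hshift N K hmK hKN
  have hdiff : ∀ k, N - K ≤ k → ∫ ω, |Y k ω - Y' k ω| ^ 2 ∂μ = u (N - k) ^ 2 := fun k hk => by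
    rw [(hYZ k hk).2]
    simp
  have hmain := hC N (hmK.trans hKN) εY 0 Y Z Y' Z' (fun i hi => ⟨hε i hi, inL2_const _ μ (0 : E d)⟩)
    hsol hsol' fun k hk _ => by rw [(hYZ k (by omega)).1]
  have hl1 : u K ^ 2 ≤ ⨆ i : Fin (N - S.m + 1), ∫ ω, |Y i ω - Y' i ω| ^ 2 ∂μ := by
    have h1 := le_ciSup (f := fun i : Fin (N - S.m + 1) => ∫ ω, |Y i ω - Y' i ω| ^ 2 ∂μ)
      (Set.finite_range _).bddAbove ⟨N - K, by omega⟩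
    simp only at h1
    rwa [hdiff (N - K) le_rfl, Nat.sub_sub_self hKN] at h1
  have hl2 : 0 ≤ ∑ i ∈ Finset.range (N - S.m + 1), D.h N * ∫ ω, ‖Z i ω - Z' i ω‖ ^ 2 ∂μ :=
    Finset.sum_nonneg fun i _ => mul_nonneg hh.le (integral_nonneg fun ω => sq_nonneg _)
  have hr1 : (⨆ k : Fin S.m, ∫ ω, |Y (N - S.m + 1 + k) ω - Y' (N - S.m + 1 + k) ω| ^ 2 ∂μ)
      ≤ B₀ := by
    have : Nonempty (Fin S.m) := ⟨⟨0, by omega⟩⟩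
    refine ciSup_le fun k => ?_
    have := k.2
    rw [hdiff _ (by omega)]
    exact hB₀u _ (by omega)
  have hr0 : 0 ≤ ⨆ k : Fin S.m,
      ∫ ω, |Y (N - S.m + 1 + k) ω - Y' (N - S.m + 1 + k) ω| ^ 2 ∂μ :=
    Real.iSup_nonneg fun k => integral_nonneg fun ω => sq_nonneg _
  have hterm : ∀ i ∈ Finset.range (N - S.m + 1),
      D.h N * ∫ ω, ‖(0 : ℕ → Ω → E d) i ω‖ ^ 2 ∂μ + 1 / D.h N * ∫ ω, |εY i ω| ^ 2 ∂μ
        ≤ if N - K ≤ i then c * (S.m * B) * D.h N else 0 := fun i hi => by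
    have hi := Finset.mem_range.1 hi
    split_ifs with h
    · have h1 : ∑ j ∈ Finset.Icc 1 S.m, u (N - (i + j)) ^ 2 ≤ S.m * B := by
        refine (Finset.sum_le_card_nsmul _ _ B fun j _ => hBu _ (by omega)).trans (le_of_eq ?_)
        simp
      have h2 : ∫ ω, |εY i ω| ^ 2 ∂μ ≤ c * (D.h N ^ 2 * (S.m * B)) :=
        (hεle i h (by omega)).trans (by gcongr)
      calc _ = 1 / D.h N * ∫ ω, |εY i ω| ^ 2 ∂μ := by simp
        _ ≤ 1 / D.h N * (c * (D.h N ^ 2 * (S.m * B))) := by gcongr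
        _ = _ := by field_simp
    · simp [hε0 i (by omega)]
  have hr2 : ∑ i ∈ Finset.range (N - S.m + 1),
      (D.h N * ∫ ω, ‖(0 : ℕ → Ω → E d) i ω‖ ^ 2 ∂μ + 1 / D.h N * ∫ ω, |εY i ω| ^ 2 ∂μ)
        ≤ (K + 1) * (c * (S.m * B)) * D.h N := by
    refine (Finset.sum_le_sum hterm).trans ?_
    rw [← Finset.sum_filter, Finset.sum_const, nsmul_eq_mul]
    have hcard : ((Finset.range (N - S.m + 1)).filter fun i => N - K ≤ i).card ≤ K + 1 := by
      refine (Finset.card_le_card (t := Finset.Icc (N - K) N) fun i hi => ?_).trans ?_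
      · rw [Finset.mem_filter, Finset.mem_range] at hi
        exact Finset.mem_Icc.2 ⟨hi.2, by omega⟩
      · rw [Nat.card_Icc]; omega
    have : (((Finset.range (N - S.m + 1)).filter fun i => N - K ≤ i).card : ℝ) ≤ K + 1 := by
      exact_mod_cast hcard
    exact (mul_le_mul_of_nonneg_right this (by positivity)).trans (le_of_eq (by ring))
  have hr3 : 0 ≤ ∑ i ∈ Finset.range (N - S.m + 1),
      (D.h N * ∫ ω, ‖(0 : ℕ → Ω → E d) i ω‖ ^ 2 ∂μ + 1 / D.h N * ∫ ω, |εY i ω| ^ 2 ∂μ) :=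
    Finset.sum_nonneg fun i _ => add_nonneg
      (mul_nonneg hh.le (integral_nonneg fun ω => sq_nonneg _))
      (mul_nonneg (by positivity) (integral_nonneg fun ω => sq_nonneg _))
  have hfin := hmain.trans ((mul_le_mul_of_nonneg_right (le_abs_self C) (add_nonneg hr0 hr3)).trans
    (mul_le_mul_of_nonneg_left (add_le_add hr1 hr2) (abs_nonneg C)))
  linarith

end Assumptions

end MultistepBSDE

end

theorem theorem3p6 {Ω : Type*} [MeasurableSpace Ω] (μ : Measure Ω) [IsProbabilityMeasure μ]
    {d : ℕ} (D : MultistepBSDE.FBSDE d) (hT : 0 < D.T)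
    (W : ℝ → Ω → MultistepBSDE.E d) (hW : MultistepBSDE.IsBrownianMotion D.T W μ)
    (hbσ : ∃ L : ℝ, 0 ≤ L ∧ ∀ t ∈ Set.Icc (0 : ℝ) D.T, ∀ x₁ x₂ : MultistepBSDE.E d,
      ‖D.b t x₁ - D.b t x₂‖ + ‖D.σ t x₁ - D.σ t x₂‖ ≤ L * ‖x₁ - x₂‖)
    (hf : ∃ Lf : ℝ, 0 ≤ Lf ∧ ∀ t₁ ∈ Set.Icc (0 : ℝ) D.T, ∀ t₂ ∈ Set.Icc (0 : ℝ) D.T,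
      ∀ (x₁ x₂ : MultistepBSDE.E d) (y₁ y₂ : ℝ) (z₁ z₂ : MultistepBSDE.E d),
        |D.f t₁ x₁ y₁ z₁ - D.f t₂ x₂ y₂ z₂|
          ≤ Lf * (√|t₁ - t₂| + ‖x₁ - x₂‖ + |y₁ - y₂| + ‖z₁ - z₂‖))
    (hΦm : Measurable D.Φ) (hΦb : ∃ M : ℝ, ∀ x, |D.Φ x| ≤ M)
    (S : MultistepBSDE.Coeffs) (hm : 1 ≤ S.m) :
    MultistepBSDE.L2Stable D S W μ ↔ MultistepBSDE.RootCondition S := by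
  obtain ⟨L, _, hL⟩ := hbσ
  obtain ⟨Lf, hLf, hlipf⟩ := hf
  have A : MultistepBSDE.Assumptions D W μ L Lf := ⟨hT, hW, hL, hLf, hlipf⟩
  exact ⟨A.rootCondition_of_l2Stable hΦm hΦb hm, A.l2Stable_of_rootCondition hm⟩
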